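/- **Setting.** Let $\mathcal H$ be a separable complex Hilbert space, $\mathcal H_N=\mathcal H^{\otimes N}$, and let $h$ be a self-adjoint operator on $\mathcal H$ with compact resolvent; $H_N=\sum_{j=1}^N h_j$ is the $N$-particle Hamiltonian. A *collision specification* $(\mathcal C,U,\nu)$ consists of a compact metric space $\mathcal C$, a (strongly) continuous one-to-one map $U$ from $\mathcal C$ to the unitary operators on $\mathcal H_2$, and a Borel probability measure $\nu$ on $\mathcal C$ charging all non-empty open sets, such that (i) each $U(\sigma)$ commutes with $H_2$; (ii) $U(\sigma_0)=1$ for some $\sigma_0$; (iii) $\{U(\sigma)\}=\{U(\sigma)^*\}$, and the map $\sigma\mapsto\sigma'$ with $U(\sigma)^*=U(\sigma')$ is measurable and preserves $\nu$; (iv) with $V$ the swap of the two factors of $\mathcal H_2$, $\{U(\sigma)\}=\{VU(\sigma)V^*\}$, and the map $\sigma\mapsto\sigma'$ with $VU(\sigma)V^*=U(\sigma')$ is measurable and preserves $\nu$. For $N\ge 2$ and $i<j$ let $U_{i,j}(\sigma)$ be $U(\sigma)$ acting on the $i$-th and $j$-th factors of $\mathcal H_N$. For bounded operators $A$ on $\mathcal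 H_N$ put $$\mathscr Q_{i,j}A=\int_{\mathcal C}U_{i,j}(\sigma)AU_{i,j}(\sigma)^*\,d\nu(\sigma),\qquad \mathscr Q_N=\binom N2^{-1}\sum_{i<j}\mathscr Q_{i,j},\qquad \mathscr L_N=N(\mathscr Q_N-1).$$ Let $\mathscr QA=\int_{\mathcal C}U(\sigma)AU(\sigma)^*\,d\nu(\sigma)$ on $\mathcal H_2$. The quantum Wild convolution of trace class operators $A,B$ on $\mathcal H$ is $A\star B=\mathrm{Tr}_2[\mathscr Q(A\otimes B)]$. A density matrix is a positive trace class operator of trace $1$. It is symmetric if it is invariant under all permutations of the factors. A sequence $\{\varrho_N\}_{N\ge 2}$ of symmetric density matrices on $\mathcal H_N$ is *$\rho$-chaotic*, for a density matrix $\rho$ on $\mathcal H$, if for each $k\ge1$ the reduced density matrices $\varrho_N^{(k)}=\mathrm{Tr}_{k+1,\dots,N}\,\varrho_N$ converge to $\rho^{\otimes k}$ in trace norm as $N\to\infty$. **Theorem.** Suppose that $\{\varrho_N(0)\}$ is $\rho(0)$-chaotic and that $\varrho_N(t)=e^{t\mathscr L_N}\varrho_N(0)$ for each $N$ and all $t\ge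 0$. Then there are density matrices $\rho(t)$ on $\mathcal H$, $t\ge 0$, equal to the given $\rho(0)$ at $t=0$, such that for every $t\ge0$ the sequence $\{\varrho_N(t)\}$ is $\rho(t)$-chaotic (in particular $\rho(t)=\lim_{N\to\infty}\varrho_N(t)^{(1)}$), and $\rho(t)$ satisfies the Quantum Kac–Boltzmann Equation $$\frac{d}{dt}\rho(t)=2\bigl(\rho(t)\star\rho(t)-\rho(t)\bigr),\qquad t\ge0,$$ where the derivative is taken in trace norm (one-sided at $t=0$). -/

import Mathlib

open scoped InnerProductSpace ENNReal Topology
open MeasureTheory Filter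

noncomputable section

set_option linter.unusedSectionVars false

namespace QuantumKac

section Traces
variable {K : Type*} [NormedAddCommGroup K] [InnerProductSpace ℂ K] [CompleteSpace K]

/-- The index set of a fixed orthonormal basis of the Hilbert space `K`. -/
def basisIdx (K : Type*) [NormedAddCommGroup K] [InnerProductSpace ℂ K] [CompleteSpace K] :
    Set K := (exists_hilbertBasis ℂ K).choose

/-- A fixed orthonormal basis of the Hilbert space `K`. It serves to realize tensor powers in
coordinates; another choice changes them only by a canonical unitary. -/
def basis (K : Type*) [NormedAddCommGroup K] [InnerProductSpace ℂ K] [CompleteSpace K] :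
    HilbertBasis (basisIdx K) ℂ K := (exists_hilbertBasis ℂ K).choose_spec.choose

/-- The trace norm `‖T‖₁ = Tr (T* T)^(1/2)`, as the supremum of `∑ᵢ |⟨fᵢ, T eᵢ⟩|` over finite
orthonormal families `e`, `f`; it is `∞` exactly when `T` is not trace class. -/
def traceNorm (T : K →L[ℂ] K) : ℝ≥0∞ :=
  ⨆ (n : ℕ) (e : Fin n → K) (f : Fin n → K) (_ : Orthonormal ℂ e) (_ : Orthonormal ℂ f),
    ∑ i, ‖⟪f i, T (e i)⟫_ℂ‖ₑ

/-- Density matrices: positive trace class operators of trace one. -/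
def IsDensityMatrix (T : K →L[ℂ] K) : Prop :=
  T.IsPositive ∧ HasSum (fun j => ⟪basis K j, T (basis K j)⟫_ℂ) 1

end Traces

section Isometries
variable {X E : Type*} [NormedAddCommGroup E] [InnerProductSpace ℂ E] [CompleteSpace E]

theorem orthogonalFamily_of_orthonormal {v : X → E} (hv : Orthonormal ℂ v) :
    OrthogonalFamily ℂ (fun _ : X => ℂ)
      (fun x => LinearIsometry.toSpanSingleton ℂ E (hv.1 x)) := by
  intro x y hxy a b
  simp [LinearIsometry.toSpanSingleton_apply, inner_smul_left, inner_smul_right, hv.2 hxy]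

/-- The isometry from `ℓ²(X)` that sends the unit vector at `x` to `v x`, for `v` orthonormal. -/
def isometryOfOrthonormal {v : X → E} (hv : Orthonormal ℂ v) :
    lp (fun _ : X => ℂ) 2 →ₗᵢ[ℂ] E :=
  (orthogonalFamily_of_orthonormal hv).linearIsometry

theorem inner_isometryOfOrthonormal {v : X → E} (hv : Orthonormal ℂ v) {a : E}
    (ha : ∀ x, ⟪a, v x⟫_ℂ = 0) (w : lp (fun _ : X => ℂ) 2) :
    ⟪a, isometryOfOrthonormal hv w⟫_ℂ = 0 := by
  have h := ((orthogonalFamily_of_orthonormal hv).hasSum_linearIsometry w).mapL (innerSL ℂ a)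
  refine h.unique ?_
  simp [LinearIsometry.toSpanSingleton_apply, ha, hasSum_zero]

end Isometries

section Fiberwise
variable {Y K : Type*} [NormedAddCommGroup K] [InnerProductSpace ℂ K] [CompleteSpace K]

theorem memℓp_fiberwise (A : K →L[ℂ] K) (w : lp (fun _ : Y => K) 2) :
    Memℓp (fun y => A (w y)) 2 := by
  apply memℓp_gen
  have h := ((lp.memℓp w).summable (by norm_num)).mul_left (‖A‖ ^ (2 : ℝ≥0∞).toReal)
  refine h.of_nonneg_of_le (fun y => by positivity) (fun y => ?_)
  rw [← Real.mul_rpow (norm_nonneg _) (norm_nonneg _)]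
  exact Real.rpow_le_rpow (norm_nonneg _) (A.le_opNorm _) (by norm_num)

theorem norm_sq_lp (w : lp (fun _ : Y => K) 2) : ‖w‖ ^ 2 = ∑' y, ‖w y‖ ^ 2 := by
  have := lp.norm_rpow_eq_tsum (p := 2) (by norm_num) w
  simpa using this

theorem summable_sq_lp (w : lp (fun _ : Y => K) 2) : Summable fun y => ‖w y‖ ^ 2 := by
  have := (lp.memℓp w).summable (by norm_num)
  simpa using this

/-- `A` applied at each point of `Y`, on `ℓ²(Y; K)`. -/
def fiberwise (A : K →L[ℂ] K) : lp (fun _ : Y => K) 2 →L[ℂ] lp (fun _ : Y => K) 2 :=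
  LinearMap.mkContinuous
    { toFun := fun w => ⟨fun y => A (w y), memℓp_fiberwise A w⟩
      map_add' := fun v w => by ext y; exact map_add A (v y) (w y)
      map_smul' := fun c w => by ext y; exact map_smul A c (w y) } ‖A‖ <| by
    intro w
    refine le_of_sq_le_sq ?_ (by positivity)
    rw [mul_pow, norm_sq_lp, norm_sq_lp, ← tsum_mul_left]
    refine Summable.tsum_le_tsum (fun y => ?_) (summable_sq_lp _) ((summable_sq_lp w).mul_left _)
    rw [← mul_pow]
    exact pow_le_pow_left₀ (norm_nonneg _) (A.le_opNorm _) 2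

@[simp]
theorem fiberwise_apply (A : K →L[ℂ] K) (w : lp (fun _ : Y => K) 2) (y : Y) :
    fiberwise A w y = A (w y) := rfl

theorem norm_fiberwise_le (A : K →L[ℂ] K) : ‖(fiberwise A : lp (fun _ : Y => K) 2 →L[ℂ] _)‖ ≤ ‖A‖ :=
  LinearMap.mkContinuous_norm_le _ (norm_nonneg _) _

theorem adjoint_fiberwise (A : K →L[ℂ] K) :
    (fiberwise A : lp (fun _ : Y => K) 2 →L[ℂ] _).adjoint = fiberwise A.adjoint := by
  symm
  rw [ContinuousLinearMap.eq_adjoint_iff]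
  intro v w
  simp [lp.inner_eq_tsum, ContinuousLinearMap.adjoint_inner_left]

theorem continuous_fiberwise {C : Type*} [TopologicalSpace C] (A : C → K →L[ℂ] K)
    (hA : ∀ x, Continuous fun σ => A σ x) (hb : ∀ σ, ‖A σ‖ ≤ 1) (w : lp (fun _ : Y => K) 2) :
    Continuous fun σ => fiberwise (A σ) w := by
  rw [continuous_iff_continuousAt]
  intro σ₀
  rw [ContinuousAt, tendsto_iff_norm_sub_tendsto_zero]
  have h1 : Continuous fun σ => ∑' y, ‖A σ (w y) - A σ₀ (w y)‖ ^ 2 := by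
    refine continuous_tsum (u := fun y => 4 * ‖w y‖ ^ 2)
      (fun y => (((hA (w y)).sub continuous_const).norm.pow 2))
      ((summable_sq_lp w).mul_left 4) (fun y σ => ?_)
    have h2 : ∀ τ, ‖A τ (w y)‖ ≤ ‖w y‖ := fun τ =>
      ((A τ).le_opNorm _).trans (mul_le_of_le_one_left (norm_nonneg _) (hb τ))
    have h3 : ‖A σ (w y) - A σ₀ (w y)‖ ≤ 2 * ‖w y‖ :=
      (norm_sub_le _ _).trans (by linarith [h2 σ, h2 σ₀])
    rw [Real.norm_of_nonneg (by positivity)]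
    calc _ ≤ (2 * ‖w y‖) ^ 2 := pow_le_pow_left₀ (norm_nonneg _) h3 2
      _ = _ := by ring
  have h4 : (fun σ => ‖fiberwise (A σ) w - fiberwise (A σ₀) w‖) =
      fun σ => √(∑' y, ‖A σ (w y) - A σ₀ (w y)‖ ^ 2) := by
    ext σ
    rw [← Real.sqrt_sq (norm_nonneg (fiberwise (A σ) w - fiberwise (A σ₀) w)), norm_sq_lp]
    rfl
  rw [h4]
  have h5 := (Real.continuous_sqrt.comp h1).tendsto σ₀
  simpa [Function.comp_def] using h5

end Fiberwise

section Tensor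
variable (H : Type*) [NormedAddCommGroup H] [InnerProductSpace ℂ H] [CompleteSpace H]

/-- The Hilbert space tensor product `⨂_{i ∈ ι} H`, with orthonormal basis the product vectors
`⨂ᵢ ψ_{α i}`, `α : ι → basisIdx H`, where `ψ` is the fixed basis of `H`.
The `N`-particle space `H_N` is `TensorPow H (Fin N)`. -/
abbrev TensorPow (ι : Type) := lp (fun _ : ι → basisIdx H => ℂ) 2

variable {H} {ι κ : Type}

/-- The basis vector `⨂ᵢ ψ_{α i}`. -/
def basisVec (α : ι → basisIdx H) : TensorPow H ι :=
  HilbertBasis.ofRepr (LinearIsometryEquiv.refl ℂ (TensorPow H ι)) α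

theorem orthonormal_basisVec : Orthonormal ℂ (basisVec : (ι → basisIdx H) → TensorPow H ι) :=
  HilbertBasis.orthonormal _

theorem sum_prod_le {J : Type*} [Fintype ι] (c : ι → J → ℝ) (B : ι → ℝ) (hc : ∀ i j, 0 ≤ c i j)
    (hB : ∀ i (s : Finset J), ∑ j ∈ s, c i j ≤ B i) (s : Finset (ι → J)) :
    ∑ α ∈ s, ∏ i, c i (α i) ≤ ∏ i, B i := by
  classical
  have hs : s ⊆ Fintype.piFinset (fun i => s.image (fun α => α i)) := by
    intro α hα
    rw [Fintype.mem_piFinset]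
    exact fun i => Finset.mem_image_of_mem (fun α => α i) hα
  calc _ ≤ ∑ α ∈ Fintype.piFinset (fun i => s.image (fun α => α i)), ∏ i, c i (α i) :=
        Finset.sum_le_sum_of_subset_of_nonneg hs fun _ _ _ =>
          Finset.prod_nonneg fun _ _ => hc _ _
    _ = ∏ i, ∑ j ∈ s.image (fun α => α i), c i j := (Finset.prod_univ_sum _ _).symm
    _ ≤ _ := Finset.prod_le_prod (fun _ _ => Finset.sum_nonneg fun _ _ => hc _ _)
        fun i _ => hB i _

theorem memℓp_tprod [Fintype ι] (φ : ι → H) :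
    Memℓp (fun α : ι → basisIdx H => ∏ i, ⟪basis H (α i), φ i⟫_ℂ) 2 := by
  refine memℓp_gen' (C := ∏ i, ‖φ i‖ ^ 2) fun s => ?_
  refine le_trans (le_of_eq (Finset.sum_congr rfl fun α _ => ?_)) (sum_prod_le (fun i j => ‖⟪basis H j, φ i⟫_ℂ‖ ^ 2) _
    (fun _ _ => sq_nonneg _) (fun i _ => (basis H).orthonormal.sum_inner_products_le _) s)
  rw [norm_prod, Finset.prod_pow, ENNReal.toReal_ofNat, Real.rpow_ofNat]

/-- The product vector `⨂ᵢ φᵢ`; its coordinate at `α` is `∏ᵢ ⟨ψ_{α i}, φᵢ⟩`. -/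
def tprod [Fintype ι] (φ : ι → H) : TensorPow H ι :=
  ⟨fun α => ∏ i, ⟪basis H (α i), φ i⟫_ℂ, memℓp_tprod φ⟩

open scoped Classical in
/-- The function on `ι` that is `x k` at `f k` and `y i` at each `i` outside the range of `f`. -/
def merge (f : κ ↪ ι) (y : {i // i ∉ Set.range f} → basisIdx H) (x : κ → basisIdx H) :
    ι → basisIdx H :=
  fun i => if hi : i ∈ Set.range f then x hi.choose else y ⟨i, hi⟩

theorem merge_apply_mem (f : κ ↪ ι) (y : {i // i ∉ Set.range f} → basisIdx H)
    (x : κ → basisIdx H) (k : κ) : merge f y x (f k) = x k := by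
  have hk : f k ∈ Set.range f := ⟨k, rfl⟩
  rw [merge, dif_pos hk, f.injective hk.choose_spec]

theorem merge_apply_not_mem (f : κ ↪ ι) (y : {i // i ∉ Set.range f} → basisIdx H)
    (x : κ → basisIdx H) (i : {i // i ∉ Set.range f}) : merge f y x i = y i := by
  rw [merge, dif_neg i.2]

theorem merge_injective (f : κ ↪ ι) {y y' : {i // i ∉ Set.range f} → basisIdx H}
    {x x' : κ → basisIdx H} (h : merge f y x = merge f y' x') : y = y' ∧ x = x' := by
  constructor
  · ext1 i
    rw [← merge_apply_not_mem f y x, h, merge_apply_not_mem]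
  · ext1 k
    rw [← merge_apply_mem f y x, h, merge_apply_mem]

/-- `x ↦ x ⊗ Ψ_y`: the vector `x` is placed in the factors `f k`, `k : κ`, and the basis vector
`⨂ ψ_{y i}` in the remaining ones. -/
def insertVec (f : κ ↪ ι) (y : {i // i ∉ Set.range f} → basisIdx H) :
    TensorPow H κ →ₗᵢ[ℂ] TensorPow H ι :=
  isometryOfOrthonormal (orthonormal_basisVec.comp (merge f y)
    fun _ _ h => (merge_injective f h).2)

theorem orthogonalFamily_insertVec (f : κ ↪ ι) :
    OrthogonalFamily ℂ (fun _ : {i // i ∉ Set.range f} → basisIdx H => TensorPow H κ)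
      (insertVec f) := by
  intro y y' hy v w
  refine inner_isometryOfOrthonormal _ (fun x' => ?_) w
  rw [inner_eq_zero_symm]
  refine inner_isometryOfOrthonormal _ (fun x => ?_) v
  exact orthonormal_basisVec.2 fun h => hy (merge_injective f h).1.symm

/-- The identification of `ℓ²(Y; ⨂_κ H)` with `⨂_ι H`, where `Y` indexes the basis of the tensor
product of the factors outside the range of `f`: `w ↦ ∑_y w_y ⊗ Ψ_y`. -/
def fibration (f : κ ↪ ι) :
    lp (fun _ : {i // i ∉ Set.range f} → basisIdx H => TensorPow H κ) 2 →ₗᵢ[ℂ] TensorPow H ι :=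
  (orthogonalFamily_insertVec f).linearIsometry

/-- `A` acting on the factors `f k`, `k : κ`, tensored with the identity on all the others. -/
def amplify (f : κ ↪ ι) (A : TensorPow H κ →L[ℂ] TensorPow H κ) :
    TensorPow H ι →L[ℂ] TensorPow H ι :=
  (fibration f).toContinuousLinearMap ∘L fiberwise A ∘L
    (fibration f).toContinuousLinearMap.adjoint

/-- The defining property of `amplify`: `(A ⊗ 1)(x ⊗ Ψ_y) = (A x) ⊗ Ψ_y`. -/
theorem amplify_insertVec (f : κ ↪ ι) (A : TensorPow H κ →L[ℂ] TensorPow H κ)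
    (y : {i // i ∉ Set.range f} → basisIdx H) (x : TensorPow H κ) :
    amplify f A (insertVec f y x) = insertVec f y (A x) := by
  classical
  have h1 : ∀ x : TensorPow H κ, insertVec f y x = fibration f (lp.single 2 y x) := fun x =>
    ((orthogonalFamily_insertVec f).linearIsometry_apply_single x).symm
  have h2 : (fibration f).toContinuousLinearMap.adjoint (fibration f (lp.single 2 y x)) =
      lp.single 2 y x :=
    congrArg (fun T => T (lp.single 2 y x)) (fibration f).adjoint_comp_self
  have h3 : fiberwise A (lp.single 2 y x) = lp.single 2 y (A x) := by
    ext z : 2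
    by_cases hz : z = y
    · subst hz; simp
    · simp [hz]
  rw [h1, h1, amplify, ContinuousLinearMap.comp_apply, ContinuousLinearMap.comp_apply, h2, h3]
  rfl

theorem adjoint_amplify (f : κ ↪ ι) (A : TensorPow H κ →L[ℂ] TensorPow H κ) :
    (amplify f A).adjoint = amplify f A.adjoint := by
  simp [amplify, ContinuousLinearMap.adjoint_comp, adjoint_fiberwise,
    ContinuousLinearMap.comp_assoc]

theorem norm_amplify_le (f : κ ↪ ι) (A : TensorPow H κ →L[ℂ] TensorPow H κ) :
    ‖amplify f A‖ ≤ ‖A‖ := by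
  have h1 := (fibration (H := H) f).norm_toContinuousLinearMap_le
  have h2 : ‖(fibration (H := H) f).toContinuousLinearMap.adjoint‖ ≤ 1 := by
    rwa [LinearIsometryEquiv.norm_map]
  calc ‖amplify f A‖ ≤ 1 * (‖A‖ * 1) := by
        refine (ContinuousLinearMap.opNorm_comp_le _ _).trans ?_
        refine mul_le_mul h1 ?_ (norm_nonneg _) zero_le_one
        refine (ContinuousLinearMap.opNorm_comp_le _ _).trans ?_
        exact mul_le_mul (norm_fiberwise_le A) h2 (norm_nonneg _) (norm_nonneg _)
    _ = ‖A‖ := by ring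

theorem continuous_amplify {C : Type*} [TopologicalSpace C] (f : κ ↪ ι)
    (A : C → TensorPow H κ →L[ℂ] TensorPow H κ) (hA : ∀ x, Continuous fun σ => A σ x)
    (hb : ∀ σ, ‖A σ‖ ≤ 1) (x : TensorPow H ι) : Continuous fun σ => amplify f (A σ) x :=
  (fibration f).continuous.comp (continuous_fiberwise A hA hb _)

/-- Partial trace over the factors outside the range of `f`: the sum of `V_y* T V_y` with
`V_y x = x ⊗ Ψ_y`. It converges absolutely in operator norm for trace class `T`. -/
def partialTrace (f : κ ↪ ι) (T : TensorPow H ι →L[ℂ] TensorPow H ι) :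
    TensorPow H κ →L[ℂ] TensorPow H κ :=
  ∑' y, (insertVec f y).toContinuousLinearMap.adjoint ∘L T ∘L
    (insertVec f y).toContinuousLinearMap

/-- The unitary `U_π (φ_1 ⊗ ⋯ ⊗ φ_N) = φ_{π 1} ⊗ ⋯ ⊗ φ_{π N}`. -/
def permute (π : Equiv.Perm ι) : TensorPow H ι →ₗᵢ[ℂ] TensorPow H ι :=
  isometryOfOrthonormal (orthonormal_basisVec.comp (fun α => α ∘ π)
    fun _ _ h => π.surjective.injective_comp_right h)

/-- The identification of `H` with its first tensor power. -/
def oneParticle : H →ₗᵢ[ℂ] TensorPow H (Fin 1) :=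
  (isometryOfOrthonormal (orthonormal_basisVec.comp (fun (j : basisIdx H) (_ : Fin 1) => j)
    fun _ _ h => congrFun h 0)).comp (basis H).repr.toLinearIsometry

/-- An operator on `H` as an operator on the first tensor power. -/
def liftOp (A : H →L[ℂ] H) : TensorPow H (Fin 1) →L[ℂ] TensorPow H (Fin 1) :=
  oneParticle.toContinuousLinearMap ∘L A ∘L oneParticle.toContinuousLinearMap.adjoint

/-- An operator on the first tensor power as an operator on `H`. -/
def lowerOp (T : TensorPow H (Fin 1) →L[ℂ] TensorPow H (Fin 1)) : H →L[ℂ] H :=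
  oneParticle.toContinuousLinearMap.adjoint ∘L T ∘L oneParticle.toContinuousLinearMap

/-- `A_i`: the operator `A` acting on the `i`-th factor only. -/
def atFactor (i : ι) (A : H →L[ℂ] H) : TensorPow H ι →L[ℂ] TensorPow H ι :=
  amplify ⟨fun _ : Fin 1 => i, fun _ _ _ => Subsingleton.elim _ _⟩ (liftOp A)

/-- `A ⊗ ⋯ ⊗ A` (`k` factors). -/
def tensorPowOp (k : ℕ) (A : H →L[ℂ] H) : TensorPow H (Fin k) →L[ℂ] TensorPow H (Fin k) :=
  (List.ofFn fun i => atFactor i A).prod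

/-- `A ⊗ B` on the two-particle space. -/
def tensorOp (A B : H →L[ℂ] H) : TensorPow H (Fin 2) →L[ℂ] TensorPow H (Fin 2) :=
  atFactor 0 A * atFactor 1 B

end Tensor

section Average
variable {C K : Type*} [MetricSpace C] [CompactSpace C] [MeasurableSpace C] [BorelSpace C]
  [NormedAddCommGroup K] [InnerProductSpace ℂ K] [CompleteSpace K]

/-- Families of contractions for which `W(σ) A W(σ)*` can be averaged strongly over `σ`. -/
structure IsContractiveFamily (W : C → K →L[ℂ] K) : Prop where
  cont : ∀ x, Continuous fun σ => W σ x
  cont_adjoint : ∀ x, Continuous fun σ => (W σ).adjoint x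
  norm_le : ∀ σ, ‖W σ‖ ≤ 1

variable {W : C → K →L[ℂ] K}

theorem IsContractiveFamily.continuous_conj (hW : IsContractiveFamily W) (A : K →L[ℂ] K) (x : K) :
    Continuous fun σ => W σ (A ((W σ).adjoint x)) := by
  have h : Continuous fun p : C × K => W p.1 p.2 := by
    refine continuous_prod_of_continuous_lipschitzWith' _ 1 (fun σ => ?_) hW.cont
    exact (W σ).lipschitz.weaken (hW.norm_le σ)
  exact h.comp (continuous_id.prodMk (A.continuous.comp (hW.cont_adjoint x)))

theorem IsContractiveFamily.integrable (hW : IsContractiveFamily W) (ν : Measure C)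
    [IsFiniteMeasure ν] (A : K →L[ℂ] K) (x : K) :
    Integrable (fun σ => W σ (A ((W σ).adjoint x))) ν :=
  (hW.continuous_conj A x).integrable_of_hasCompactSupport (HasCompactSupport.of_compactSpace _)

theorem IsContractiveFamily.norm_conj_le (hW : IsContractiveFamily W) (A : K →L[ℂ] K) (x : K)
    (σ : C) : ‖W σ (A ((W σ).adjoint x))‖ ≤ ‖A‖ * ‖x‖ := by
  have h1 : ‖(W σ).adjoint‖ ≤ 1 := by
    rw [LinearIsometryEquiv.norm_map]; exact hW.norm_le σ
  calc _ ≤ ‖A ((W σ).adjoint x)‖ := (W σ).le_of_opNorm_le_of_le (hW.norm_le σ) le_rfl |>.trans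
            (by rw [one_mul])
    _ ≤ ‖A‖ * ‖(W σ).adjoint x‖ := A.le_opNorm _
    _ ≤ ‖A‖ * ‖x‖ := by
        gcongr
        exact ((W σ).adjoint.le_of_opNorm_le h1 x).trans (by rw [one_mul])

theorem IsContractiveFamily.norm_integral_le (hW : IsContractiveFamily W) (ν : Measure C)
    [IsProbabilityMeasure ν] (A : K →L[ℂ] K) (x : K) :
    ‖∫ σ, W σ (A ((W σ).adjoint x)) ∂ν‖ ≤ ‖A‖ * ‖x‖ := by
  have h := norm_integral_le_of_norm_le_const (μ := ν)
    (Filter.Eventually.of_forall (hW.norm_conj_le A x))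
  simpa using h

/-- The operator `∫ W(σ) A W(σ)* dν(σ)` (strong integral). -/
def averageOp (hW : IsContractiveFamily W) (ν : Measure C) [IsProbabilityMeasure ν]
    (A : K →L[ℂ] K) : K →L[ℂ] K :=
  LinearMap.mkContinuous
    { toFun := fun x => ∫ σ, W σ (A ((W σ).adjoint x)) ∂ν
      map_add' := fun x y => by
        simp only [map_add]
        exact integral_add (hW.integrable ν A x) (hW.integrable ν A y)
      map_smul' := fun c x => by
        simp only [map_smul, RingHom.id_apply]
        exact integral_smul _ _ } ‖A‖ (hW.norm_integral_le ν A)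

theorem norm_averageOp_le (hW : IsContractiveFamily W) (ν : Measure C) [IsProbabilityMeasure ν]
    (A : K →L[ℂ] K) : ‖averageOp hW ν A‖ ≤ ‖A‖ :=
  LinearMap.mkContinuous_norm_le _ (norm_nonneg _) (hW.norm_integral_le ν A)

/-- The linear map `A ↦ ∫ W(σ) A W(σ)* dν(σ)` on bounded operators. -/
def average (hW : IsContractiveFamily W) (ν : Measure C) [IsProbabilityMeasure ν] :
    (K →L[ℂ] K) →L[ℂ] (K →L[ℂ] K) :=
  LinearMap.mkContinuous
    { toFun := averageOp hW ν
      map_add' := fun A B => by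
        ext x
        exact (integral_congr_ae (Filter.Eventually.of_forall fun σ => by simp)).trans
          (integral_add (hW.integrable ν A x) (hW.integrable ν B x))
      map_smul' := fun c A => by
        ext x
        exact (integral_congr_ae (Filter.Eventually.of_forall fun σ => by simp)).trans
          (integral_smul c _) } 1 fun A => by
    rw [one_mul]
    exact norm_averageOp_le hW ν A

theorem norm_unitary_le (u : unitary (K →L[ℂ] K)) : ‖(u : K →L[ℂ] K)‖ ≤ 1 := by
  refine ContinuousLinearMap.opNorm_le_bound _ zero_le_one fun x => ?_
  rw [one_mul, Unitary.norm_map]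

theorem continuous_adjoint_unitary (U : C → unitary (K →L[ℂ] K))
    (hU : ∀ x, Continuous fun σ => (U σ : K →L[ℂ] K) x) (x : K) :
    Continuous fun σ => (U σ : K →L[ℂ] K).adjoint x := by
  have key : ∀ σ y, (U σ : K →L[ℂ] K) ((U σ : K →L[ℂ] K).adjoint y) = y := fun σ y =>
    congrArg (fun T : K →L[ℂ] K => T y) (Unitary.mul_star_self_of_mem (U σ).2)
  rw [continuous_iff_continuousAt]
  intro σ₀
  rw [ContinuousAt, tendsto_iff_norm_sub_tendsto_zero]
  have h1 : ∀ σ, ‖(U σ : K →L[ℂ] K).adjoint x - (U σ₀ : K →L[ℂ] K).adjoint x‖ =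
      ‖x - (U σ : K →L[ℂ] K) ((U σ₀ : K →L[ℂ] K).adjoint x)‖ := fun σ => by
    rw [← Unitary.norm_map (U σ), map_sub, key]
  simp only [h1]
  have h2 : Continuous fun σ => ‖x - (U σ : K →L[ℂ] K) ((U σ₀ : K →L[ℂ] K).adjoint x)‖ :=
    (continuous_const.sub (hU _)).norm
  have h3 := h2.tendsto σ₀
  simpa only [key, sub_self, norm_zero] using h3

end Average

section Model
variable {H : Type*} [NormedAddCommGroup H] [InnerProductSpace ℂ H] [CompleteSpace H]

/-- The exponential of a bounded linear map of the Banach space of bounded operators on `K`. -/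
def expSuperOp {K : Type*} [NormedAddCommGroup K] [InnerProductSpace ℂ K] [CompleteSpace K]
    (L : (K →L[ℂ] K) →L[ℂ] (K →L[ℂ] K)) : (K →L[ℂ] K) →L[ℂ] (K →L[ℂ] K) :=
  NormedSpace.exp L

/-- `h` has a compact resolvent: `(h - z)⁻¹` exists and is compact for some `z`. -/
def HasCompactResolvent (h : H →ₗ.[ℂ] H) : Prop :=
  ∃ (z : ℂ) (R : H →L[ℂ] H), IsCompactOperator R ∧
    (∀ x, ∃ hx : R x ∈ h.domain, h ⟨R x, hx⟩ - z • R x = x) ∧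
    ∀ y : h.domain, R (h y - z • (y : H)) = y

/-- The graph of the `N`-particle Hamiltonian `H_N = ∑ⱼ h_j`: the closure of the operator
`⨂ φᵢ ↦ ∑ⱼ φ_1 ⊗ ⋯ ⊗ h φ_j ⊗ ⋯ ⊗ φ_N` on the algebraic tensor power of the domain of `h`. -/
def hamiltonianGraph (h : H →ₗ.[ℂ] H) (N : ℕ) :
    Submodule ℂ (TensorPow H (Fin N) × TensorPow H (Fin N)) :=
  (Submodule.span ℂ {p | ∃ φ : Fin N → h.domain,
    p = (tprod fun i => (φ i : H),
      ∑ j, tprod (Function.update (fun i => (φ i : H)) j (h (φ j))))}).topologicalClosure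

/-- A collision specification `(C, U, ν)` for the one-particle Hamiltonian `h`. -/
structure CollisionSpec (h : H →ₗ.[ℂ] H) (C : Type*) [MetricSpace C] [CompactSpace C]
    [MeasurableSpace C] [BorelSpace C] where
  /-- The scattering matrices, unitaries on `H ⊗ H`. -/
  U : C → unitary (TensorPow H (Fin 2) →L[ℂ] TensorPow H (Fin 2))
  /-- Continuity in the strong operator topology. -/
  continuous_U : ∀ x, Continuous fun σ => (U σ : TensorPow H (Fin 2) →L[ℂ] TensorPow H (Fin 2)) x
  injective_U : Function.Injective U
  /-- A Borel probability measure charging every non-empty open set. -/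
  ν : Measure C
  isProbabilityMeasure_ν : IsProbabilityMeasure ν
  isOpenPosMeasure_ν : ν.IsOpenPosMeasure
  /-- `U(σ)` commutes with `H_2`: `(x, y)` lies in the graph iff `(U(σ) x, U(σ) y)` does, that is,
  `U(σ)* H_2 U(σ) = H_2`. -/
  commutes : ∀ σ (p : TensorPow H (Fin 2) × TensorPow H (Fin 2)),
    ((U σ : TensorPow H (Fin 2) →L[ℂ] TensorPow H (Fin 2)) p.1,
      (U σ : TensorPow H (Fin 2) →L[ℂ] TensorPow H (Fin 2)) p.2) ∈ hamiltonianGraph h 2 ↔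
    p ∈ hamiltonianGraph h 2
  exists_one : ∃ σ₀, U σ₀ = 1
  /-- Time reversal: `U(σ)* = U(σ')` with `σ ↦ σ'` measurable and `ν`-preserving (hence
  `{U(σ)} = {U(σ)*}`). -/
  reversible : ∃ τ : C → C, MeasurePreserving τ ν ν ∧ ∀ σ, star (U σ) = U (τ σ)
  /-- Exchange of the particles: `V U(σ) V* = U(σ')` with `V` the swap and `σ ↦ σ'` measurable and
  `ν`-preserving (hence `{U(σ)} = {V U(σ) V*}`). -/
  swap_symm : ∃ τ : C → C, MeasurePreserving τ ν ν ∧ ∀ σ,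
    (permute (Equiv.swap 0 1)).toContinuousLinearMap ∘L
      (U σ : TensorPow H (Fin 2) →L[ℂ] TensorPow H (Fin 2)) ∘L
      (permute (Equiv.swap 0 1)).toContinuousLinearMap.adjoint =
    (U (τ σ) : TensorPow H (Fin 2) →L[ℂ] TensorPow H (Fin 2))

attribute [instance] CollisionSpec.isProbabilityMeasure_ν

variable {h : H →ₗ.[ℂ] H} {C : Type*} [MetricSpace C] [CompactSpace C] [MeasurableSpace C]
  [BorelSpace C]

/-- `U(σ)` as a bounded operator. -/
def CollisionSpec.op (S : CollisionSpec h C) (σ : C) :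
    TensorPow H (Fin 2) →L[ℂ] TensorPow H (Fin 2) := S.U σ

theorem CollisionSpec.isContractiveFamily_op (S : CollisionSpec h C) :
    IsContractiveFamily S.op where
  cont := S.continuous_U
  norm_le σ := norm_unitary_le (S.U σ)
  cont_adjoint := continuous_adjoint_unitary S.U S.continuous_U

/-- `U_{i,j}(σ)`: the operator `U(σ)` acting on the factors `p 0 = i` and `p 1 = j`. -/
def CollisionSpec.opAt (S : CollisionSpec h C) {ι : Type} (p : Fin 2 ↪ ι) (σ : C) :
    TensorPow H ι →L[ℂ] TensorPow H ι := amplify p (S.op σ)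

theorem CollisionSpec.isContractiveFamily_opAt (S : CollisionSpec h C) {ι : Type} (p : Fin 2 ↪ ι) :
    IsContractiveFamily (S.opAt p) where
  cont := continuous_amplify p S.op S.isContractiveFamily_op.cont S.isContractiveFamily_op.norm_le
  norm_le σ := (norm_amplify_le p _).trans (S.isContractiveFamily_op.norm_le σ)
  cont_adjoint x := by
    simp only [CollisionSpec.opAt, adjoint_amplify]
    exact continuous_amplify p _ S.isContractiveFamily_op.cont_adjoint (fun σ => by
      rw [LinearIsometryEquiv.norm_map]; exact S.isContractiveFamily_op.norm_le σ) x

/-- `Q_{i,j} A = ∫ U_{i,j}(σ) A U_{i,j}(σ)* dν(σ)`, for `p 0 = i` and `p 1 = j`. -/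
def CollisionSpec.collision (S : CollisionSpec h C) {ι : Type} (p : Fin 2 ↪ ι) :
    (TensorPow H ι →L[ℂ] TensorPow H ι) →L[ℂ] (TensorPow H ι →L[ℂ] TensorPow H ι) :=
  average (S.isContractiveFamily_opAt p) S.ν

/-- The pair of particles `i < j`. -/
def pairEmb {N : ℕ} (i j : Fin N) (hij : i < j) : Fin 2 ↪ Fin N :=
  ⟨![i, j], by
    intro a b
    fin_cases a <;> fin_cases b <;> simp [hij.ne, hij.ne']⟩

/-- `Q_N = (N choose 2)⁻¹ ∑_{i<j} Q_{i,j}` (of interest for `N ≥ 2`). -/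
def CollisionSpec.kacAverage (S : CollisionSpec h C) (N : ℕ) :
    (TensorPow H (Fin N) →L[ℂ] TensorPow H (Fin N)) →L[ℂ]
      (TensorPow H (Fin N) →L[ℂ] TensorPow H (Fin N)) :=
  (N.choose 2 : ℂ)⁻¹ • ∑ i : Fin N, ∑ j : Fin N,
    if hij : i < j then S.collision (pairEmb i j hij) else 0

/-- The quantum Kac generator `L_N = N (Q_N - 1)` (of interest for `N ≥ 2`). -/
def CollisionSpec.kacGenerator (S : CollisionSpec h C) (N : ℕ) :
    (TensorPow H (Fin N) →L[ℂ] TensorPow H (Fin N)) →L[ℂ]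
      (TensorPow H (Fin N) →L[ℂ] TensorPow H (Fin N)) :=
  (N : ℂ) • (S.kacAverage N - 1)

/-- `exp (t L_N)`. -/
def CollisionSpec.kacSemigroup (S : CollisionSpec h C) (N : ℕ) (t : ℝ) :
    (TensorPow H (Fin N) →L[ℂ] TensorPow H (Fin N)) →L[ℂ]
      (TensorPow H (Fin N) →L[ℂ] TensorPow H (Fin N)) :=
  expSuperOp ((t : ℂ) • S.kacGenerator N)

/-- The collision operator `Q A = ∫ U(σ) A U(σ)* dν(σ)` on the two-particle space. -/
def CollisionSpec.collisionOp (S : CollisionSpec h C) :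
    (TensorPow H (Fin 2) →L[ℂ] TensorPow H (Fin 2)) →L[ℂ]
      (TensorPow H (Fin 2) →L[ℂ] TensorPow H (Fin 2)) :=
  average S.isContractiveFamily_op S.ν

/-- The quantum Wild convolution `A ⋆ B = Tr_2 [Q (A ⊗ B)]`. -/
def CollisionSpec.wild (S : CollisionSpec h C) (A B : H →L[ℂ] H) : H →L[ℂ] H :=
  lowerOp (partialTrace (Fin.castAddEmb 1 : Fin 1 ↪ Fin (1 + 1))
    (S.collisionOp (tensorOp A B)))

/-- The `k`-particle reduced density matrix of a state of `k + M` particles: the last `M` factors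
are traced out. -/
def marginal (k M : ℕ) (T : TensorPow H (Fin (k + M)) →L[ℂ] TensorPow H (Fin (k + M))) :
    TensorPow H (Fin k) →L[ℂ] TensorPow H (Fin k) :=
  partialTrace (Fin.castAddEmb M) T

/-- Invariance under the action of all permutations of the factors. -/
def IsPermSymmetric {ι : Type} (T : TensorPow H ι →L[ℂ] TensorPow H ι) : Prop :=
  ∀ π : Equiv.Perm ι,
    (permute π).toContinuousLinearMap ∘L T ∘L (permute π).toContinuousLinearMap.adjoint = T

/-- `{ϱ_N}` is `ρ`-chaotic: `ϱ_N^{(k)} → ρ^{⊗k}` in trace norm for each `k ≥ 1`, the `ϱ_N` being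
symmetric density matrices. Systems of `N ≥ 2` particles are meant; `N` is `k + M` in the limit. -/
def IsChaotic (ρ : H →L[ℂ] H)
    (ϱ : ∀ N : ℕ, TensorPow H (Fin N) →L[ℂ] TensorPow H (Fin N)) : Prop :=
  IsDensityMatrix ρ ∧
  (∀ N, 2 ≤ N → IsDensityMatrix (ϱ N) ∧ IsPermSymmetric (ϱ N)) ∧
  ∀ k, 1 ≤ k → Tendsto (fun M => traceNorm (marginal k M (ϱ (k + M)) - tensorPowOp k ρ))
    atTop (𝓝 0)

/-- `ρ` has derivative `G` at `t` within `s`, with respect to the trace norm. -/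
def HasTraceNormDerivWithinAt (ρ : ℝ → H →L[ℂ] H) (G : H →L[ℂ] H) (s : Set ℝ) (t : ℝ) : Prop :=
  Tendsto (fun r : ℝ => traceNorm (((r - t : ℝ) : ℂ)⁻¹ • (ρ r - ρ t) - G)) (𝓝[s \ {t}] t) (𝓝 0)

/-- `ρ(t)`, `t ≥ 0`, are density matrices with `dρ/dt = 2 (ρ ⋆ ρ - ρ)` in trace norm (from the right
at `t = 0`). -/
def CollisionSpec.SolvesQKBE (S : CollisionSpec h C) (ρ : ℝ → H →L[ℂ] H) : Prop :=
  ∀ t, 0 ≤ t → IsDensityMatrix (ρ t) ∧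
    HasTraceNormDerivWithinAt ρ ((2 : ℂ) • (S.wild (ρ t) (ρ t) - ρ t)) (Set.Ici 0) t

end Model
end QuantumKac

end

open QuantumKac

open scoped InnerProductSpace ENNReal Topology
open MeasureTheory Filter

noncomputable section

set_option linter.unusedSectionVars false

namespace QuantumKac

/-! ### The trace norm: ideal bounds, semicontinuity, value on positive operators -/

section TraceNorm
variable {K : Type*} [NormedAddCommGroup K] [InnerProductSpace ℂ K] [CompleteSpace K]
variable {S T : K →L[ℂ] K}

/-! The proof compares the hierarchy of marginals with a limiting hierarchy, in the Banach space
`TC` of trace class operators under the trace norm.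

Trace out all but `k` particles in the equation for `ϱ_N(t)`. Pairs among the discarded particles
contribute nothing. By symmetry each of the `k (N - k)` mixed pairs acts through the
`(k+1)`-particle marginal alone. The remaining `k (k - 1) / 2` pairs are too few to matter. As `N /
(N choose 2) = 2 / (N - 1)`, the marginals satisfy `d/dt ϱ^(k) = 2 (∑_i Tr_{k+1} Q_{i,k+1} ϱ^(k+1) -
k ϱ^(k))` up to an error `O(k² / N)`: this is `norm_ptr_generatorTC_sub_hierarchy_le`.

If `α` solves the quantum Kac–Boltzmann equation, its tensor powers solve the limiting hierarchy
exactly (`dpowTC_kacBoltzmann`): letting the `i`-th factor collide with a fresh independent particle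
and tracing the latter out puts `α ⋆ α` in slot `i`. The difference `f_k` between marginal and
tensor power then obeys `‖f_k'‖ ≤ 2k (‖f_k‖ + ‖f_{k+1}‖) + o(1)`, with `‖f_k‖ ≤ 2 c^k` a priori.
Iterating this inequality `m` times gives a bound that tends to `0` with `m` on a time interval
whose length depends only on `c` (`hierarchy_comparison`).

Picard iteration gives a local solution `α` on an interval whose length depends only on the norm of
the initial value. A limit of one-particle marginals is again a density matrix, of trace norm `1`,
so steps of one fixed length can be repeated for ever (`exists_chaotic_step`, `exists_chaotic`).
Positivity and trace of the nonlinear solution are thus inherited from the `N`-particle states.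
Uniqueness of limits glues the local solutions and yields the equation at every time
(`hasDerivWithinAt_of_chaotic`).

Identities between trace class operators are mostly proved by duality (`TC.ext_tr`): paired with a
bounded `A`, a partial trace becomes `A ⊗ 1` and an average over collisions becomes an average of
`U* A U`. -/

theorem traceNorm_le {c : ℝ≥0∞} (h : ∀ (n : ℕ) (e f : Fin n → K), Orthonormal ℂ e →
    Orthonormal ℂ f → ∑ i, ‖⟪f i, T (e i)⟫_ℂ‖ₑ ≤ c) : traceNorm T ≤ c := by
  simp only [traceNorm, iSup_le_iff]
  exact fun n e f he hf => h n e f he hf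

theorem sum_enorm_inner_le_traceNorm {ι : Type*} [Fintype ι] {e f : ι → K}
    (he : Orthonormal ℂ e) (hf : Orthonormal ℂ f) :
    ∑ i, ‖⟪f i, T (e i)⟫_ℂ‖ₑ ≤ traceNorm T := by
  let g := (Fintype.equivFin ι).symm
  rw [← Equiv.sum_comp g]
  exact le_iSup_of_le _ <| le_iSup_of_le (e ∘ g) <| le_iSup_of_le (f ∘ g) <|
    le_iSup_of_le (he.comp g g.injective) <| le_iSup_of_le (hf.comp g g.injective) le_rfl

theorem tsum_enorm_inner_le_traceNorm {ι : Type*} {e f : ι → K}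
    (he : Orthonormal ℂ e) (hf : Orthonormal ℂ f) :
    ∑' i, ‖⟪f i, T (e i)⟫_ℂ‖ₑ ≤ traceNorm T := by
  rw [ENNReal.tsum_eq_iSup_sum]
  refine iSup_le fun s => ?_
  rw [← Finset.sum_coe_sort s]
  exact sum_enorm_inner_le_traceNorm (he.comp _ Subtype.val_injective)
    (hf.comp _ Subtype.val_injective)

theorem traceNorm_zero : traceNorm (0 : K →L[ℂ] K) = 0 :=
  le_antisymm (traceNorm_le fun n e f _ _ => by simp) (zero_le)

theorem traceNorm_add_le : traceNorm (S + T) ≤ traceNorm S + traceNorm T := by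
  refine traceNorm_le fun n e f he hf => ?_
  refine le_trans ?_ (add_le_add (sum_enorm_inner_le_traceNorm he hf)
    (sum_enorm_inner_le_traceNorm he hf))
  rw [← Finset.sum_add_distrib]
  refine Finset.sum_le_sum fun i _ => ?_
  rw [add_apply, inner_add_right]
  exact enorm_add_le _ _

theorem traceNorm_smul_le (c : ℂ) : traceNorm (c • T) ≤ ‖c‖ₑ * traceNorm T := by
  refine traceNorm_le fun n e f he hf => ?_
  refine le_trans (le_of_eq ?_) (mul_le_mul_right (sum_enorm_inner_le_traceNorm he hf) _)
  rw [Finset.mul_sum]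
  refine Finset.sum_congr rfl fun i _ => ?_
  rw [smul_apply, inner_smul_right, enorm_mul]

theorem traceNorm_smul (c : ℂ) : traceNorm (c • T) = ‖c‖ₑ * traceNorm T := by
  refine le_antisymm (traceNorm_smul_le c) ?_
  rcases eq_or_ne c 0 with rfl | hc
  · simp
  have h := traceNorm_smul_le (T := c • T) c⁻¹
  rw [inv_smul_smul₀ hc, enorm_inv hc] at h
  calc _ ≤ ‖c‖ₑ * (‖c‖ₑ⁻¹ * traceNorm (c • T)) := by gcongr
    _ = _ := by rw [← mul_assoc, ENNReal.mul_inv_cancel (by simpa using hc) enorm_ne_top, one_mul]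

theorem traceNorm_neg : traceNorm (-T) = traceNorm T := by
  have := traceNorm_smul (T := T) (-1)
  simpa using this

theorem traceNorm_adjoint : traceNorm T.adjoint = traceNorm T := by
  have h : ∀ R : K →L[ℂ] K, traceNorm R.adjoint ≤ traceNorm R := fun R => by
    refine traceNorm_le fun n e f he hf => ?_
    refine le_trans (Finset.sum_le_sum fun i _ => le_of_eq ?_)
      (sum_enorm_inner_le_traceNorm (T := R) hf he)
    rw [ContinuousLinearMap.adjoint_inner_right, ← inner_conj_symm, ← ofReal_norm, ← ofReal_norm,
      RCLike.norm_conj]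
  refine le_antisymm (h T) ?_
  simpa using h T.adjoint

/-- Compressing by isometries does not increase the trace norm. -/
theorem traceNorm_conj_le {K' : Type*} [NormedAddCommGroup K'] [InnerProductSpace ℂ K']
    [CompleteSpace K'] (V W : K' →ₗᵢ[ℂ] K) :
    traceNorm (V.toContinuousLinearMap.adjoint ∘L T ∘L W.toContinuousLinearMap) ≤ traceNorm T := by
  refine traceNorm_le fun n e f he hf => ?_
  simp only [ContinuousLinearMap.comp_apply, ContinuousLinearMap.adjoint_inner_right]
  exact sum_enorm_inner_le_traceNorm (he.comp_linearIsometry W) (hf.comp_linearIsometry V)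

theorem orthonormal_unitary {ι : Type*} {e : ι → K} (he : Orthonormal ℂ e)
    (u : unitary (K →L[ℂ] K)) : Orthonormal ℂ (fun i => (u : K →L[ℂ] K) (e i)) := by
  classical
  rw [orthonormal_iff_ite] at he ⊢
  intro i j
  rw [Unitary.inner_map_map, he]

theorem traceNorm_unitary_mul_le (u : unitary (K →L[ℂ] K)) :
    traceNorm ((u : K →L[ℂ] K) * T) ≤ traceNorm T := by
  refine traceNorm_le fun n e f he hf => ?_
  refine le_trans (Finset.sum_le_sum fun i _ => le_of_eq ?_)
      (sum_enorm_inner_le_traceNorm (T := T) he (orthonormal_unitary hf (star u)))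
  rw [Unitary.coe_star, ContinuousLinearMap.star_eq_adjoint,
    ContinuousLinearMap.adjoint_inner_left]
  rfl

theorem traceNorm_sum_le {ι : Type*} (s : Finset ι) (T : ι → K →L[ℂ] K) :
    traceNorm (∑ i ∈ s, T i) ≤ ∑ i ∈ s, traceNorm (T i) := by
  classical
  induction s using Finset.induction_on with
  | empty => simp [traceNorm_zero]
  | insert i s hi ih =>
    rw [Finset.sum_insert hi, Finset.sum_insert hi]
    exact traceNorm_add_le.trans (by gcongr)

/-- Unitaries only permute the orthonormal families in the supremum, so they cost nothing; a general
`A` is a combination of four unitaries with coefficients at most `‖A‖ / 2`. The resulting factor `2`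
is not sharp, but only finiteness and linearity in `‖A‖` matter. -/
theorem traceNorm_mul_le (A : K →L[ℂ] K) :
    traceNorm (A * T) ≤ ENNReal.ofReal (2 * ‖A‖) * traceNorm T := by
  obtain ⟨u, c, hA, hc⟩ := CStarAlgebra.exists_sum_four_unitary A
  calc traceNorm (A * T) = traceNorm (∑ i, c i • ((u i : K →L[ℂ] K) * T)) := by
        conv_lhs => rw [hA]
        rw [Finset.sum_mul]; simp
    _ ≤ ∑ i, traceNorm (c i • ((u i : K →L[ℂ] K) * T)) := traceNorm_sum_le _ _
    _ ≤ ∑ i : Fin 4, ENNReal.ofReal (‖A‖ / 2) * traceNorm T := by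
        refine Finset.sum_le_sum fun i _ => ?_
        rw [traceNorm_smul, ← ofReal_norm]
        exact mul_le_mul' (ENNReal.ofReal_le_ofReal (hc i)) (traceNorm_unitary_mul_le _)
    _ = _ := by
        rw [Finset.sum_const, Finset.card_univ, Fintype.card_fin, nsmul_eq_mul, ← mul_assoc]
        congr 1
        rw [← ENNReal.ofReal_natCast, ← ENNReal.ofReal_mul (by positivity)]
        congr 1; push_cast; ring

theorem traceNorm_mul_le' (A : K →L[ℂ] K) :
    traceNorm (T * A) ≤ ENNReal.ofReal (2 * ‖A‖) * traceNorm T := by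
  have h := traceNorm_mul_le (T := T.adjoint) A.adjoint
  rw [LinearIsometryEquiv.norm_map, traceNorm_adjoint] at h
  refine le_trans (le_of_eq ?_) h
  rw [← traceNorm_adjoint (T := T * A)]
  congr 1
  exact ContinuousLinearMap.adjoint_comp T A

theorem enorm_inner_le_traceNorm {x y : K} (hx : ‖x‖ ≤ 1) (hy : ‖y‖ ≤ 1) :
    ‖⟪x, T y⟫_ℂ‖ₑ ≤ traceNorm T := by
  rcases eq_or_ne x 0 with rfl | hx0
  · simp
  rcases eq_or_ne y 0 with rfl | hy0
  · simp
  have hn : ∀ z : K, z ≠ 0 → Orthonormal ℂ (fun _ : Fin 1 => (‖z‖⁻¹ : ℂ) • z) := fun z hz => by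
    refine ⟨fun _ => ?_, fun i j hij => absurd (Subsingleton.elim i j) hij⟩
    exact norm_smul_inv_norm hz
  have h := sum_enorm_inner_le_traceNorm (T := T) (hn y hy0) (hn x hx0)
  simp only [Finset.univ_unique, Finset.sum_singleton] at h
  refine le_trans ?_ h
  rw [← ofReal_norm, ← ofReal_norm, map_smul, inner_smul_left, inner_smul_right, norm_mul, norm_mul]
  refine ENNReal.ofReal_le_ofReal ?_
  simp only [map_inv₀, Complex.conj_ofReal, norm_inv, Complex.norm_real, norm_norm]
  have hx1 := one_le_inv_iff₀.2 ⟨norm_pos_iff.2 hx0, hx⟩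
  have hy1 := one_le_inv_iff₀.2 ⟨norm_pos_iff.2 hy0, hy⟩
  calc ‖⟪x, T y⟫_ℂ‖ = 1 * (1 * ‖⟪x, T y⟫_ℂ‖) := by ring
    _ ≤ _ := by gcongr

theorem enorm_le_traceNorm : ‖T‖ₑ ≤ traceNorm T := by
  by_cases h : traceNorm T = ∞
  · simp [h]
  rw [← ofReal_norm, ENNReal.ofReal_le_iff_le_toReal h]
  refine ContinuousLinearMap.opNorm_le_of_unit_norm ENNReal.toReal_nonneg fun y hy => ?_
  rcases eq_or_ne (T y) 0 with h0 | h0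
  · simp [h0]
  have h1 := enorm_inner_le_traceNorm (T := T) (x := (‖T y‖⁻¹ : ℂ) • T y)
    (norm_smul_inv_norm h0).le hy.le
  rw [← ofReal_norm, ENNReal.ofReal_le_iff_le_toReal h] at h1
  refine le_trans (le_of_eq ?_) h1
  rw [inner_smul_left, inner_self_eq_norm_sq_to_K]
  have : ‖T y‖ ≠ 0 := by simpa using h0
  simp
  field_simp

/-- The trace norm is lower semicontinuous for the weak operator topology. -/
theorem traceNorm_le_of_tendsto {ι : Type*} {l : Filter ι} [l.NeBot] {S : ι → K →L[ℂ] K}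
    (h : ∀ x y, Tendsto (fun i => ⟪x, S i y⟫_ℂ) l (𝓝 ⟪x, T y⟫_ℂ)) {c : ℝ≥0∞}
    (hc : ∀ᶠ i in l, traceNorm (S i) ≤ c) : traceNorm T ≤ c := by
  refine traceNorm_le fun n e f he hf => ?_
  have h1 : Tendsto (fun i => ∑ j, ‖⟪f j, S i (e j)⟫_ℂ‖ₑ) l (𝓝 (∑ j, ‖⟪f j, T (e j)⟫_ℂ‖ₑ)) :=
    tendsto_finsetSum _ fun j _ => (h _ _).enorm
  exact le_of_tendsto h1 (hc.mono fun i hi => (sum_enorm_inner_le_traceNorm he hf).trans hi)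

theorem tendsto_inner_apply {ι : Type*} {l : Filter ι} {S : ι → K →L[ℂ] K}
    (h : Tendsto S l (𝓝 T)) (x y : K) : Tendsto (fun i => ⟪x, S i y⟫_ℂ) l (𝓝 ⟪x, T y⟫_ℂ) :=
  tendsto_const_nhds.inner (((ContinuousLinearMap.apply ℂ K y).continuous.tendsto T).comp h)

theorem tsum_enorm_sq_inner {ι : Type*} (b : HilbertBasis ι ℂ K) (x : K) :
    ∑' i, ‖⟪b i, x⟫_ℂ‖ₑ ^ 2 = ‖x‖ₑ ^ 2 := by
  have h := b.hasSum_inner_mul_inner x x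
  have h1 : ∀ i, ⟪x, b i⟫_ℂ * ⟪b i, x⟫_ℂ = ((‖⟪b i, x⟫_ℂ‖ ^ 2 : ℝ) : ℂ) := fun i => by
    rw [← inner_conj_symm x, RCLike.conj_mul]; norm_cast
  simp only [h1, inner_self_eq_norm_sq_to_K] at h
  have h2 : HasSum (fun i => ‖⟪b i, x⟫_ℂ‖ ^ 2) (‖x‖ ^ 2) := by
    have := Complex.hasSum_re h
    simpa [← Complex.ofReal_pow] using this
  rw [← ofReal_norm, ← ENNReal.ofReal_pow (norm_nonneg _), ← h2.tsum_eq,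
    ENNReal.ofReal_tsum_of_nonneg (fun _ => by positivity) h2.summable]
  simp_rw [ENNReal.ofReal_pow (norm_nonneg _), ofReal_norm]

theorem exists_sqrt (hT : T.IsPositive) : ∃ R : K →L[ℂ] K, IsSelfAdjoint R ∧ R * R = T := by
  have h0 : 0 ≤ T := (ContinuousLinearMap.nonneg_iff_isPositive T).2 hT
  exact ⟨CFC.sqrt T, (CFC.sqrt_nonneg T).isSelfAdjoint, CFC.sqrt_mul_sqrt_self T⟩

theorem inner_mul_self {R : K →L[ℂ] K} (hR : IsSelfAdjoint R) (x y : K) :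
    ⟪x, (R * R) y⟫_ℂ = ⟪R x, R y⟫_ℂ := by
  rw [mul_apply_eq_comp, ← ContinuousLinearMap.adjoint_inner_left, hR.adjoint_eq]

theorem enorm_inner_mul_self {R : K →L[ℂ] K} (hR : IsSelfAdjoint R) (x : K) :
    ‖⟪x, (R * R) x⟫_ℂ‖ₑ = ‖R x‖ₑ ^ 2 := by
  rw [inner_mul_self hR, inner_self_eq_norm_sq_to_K, enorm_pow, ← ofReal_norm, ← ofReal_norm]
  simp

/-- For a positive operator the trace norm is the trace, computed in any orthonormal basis. -/
theorem traceNorm_eq_tsum (hT : T.IsPositive) {ι : Type*} (b : HilbertBasis ι ℂ K) :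
    traceNorm T = ∑' i, ‖⟪b i, T (b i)⟫_ℂ‖ₑ := by
  refine le_antisymm ?_ (tsum_enorm_inner_le_traceNorm b.orthonormal b.orthonormal)
  obtain ⟨R, hR, rfl⟩ := exists_sqrt hT
  -- With `T = R²`, expand `‖R eᵢ‖²` in the basis `b`, exchange the sums and apply Bessel to each `R
  -- (b j)`. The pairing of `e` with `f` then splits by `|⟨R f, R e⟩| ≤ (‖R e‖² + ‖R f‖²) / 2`.
  have hb : ∀ (n : ℕ) (e : Fin n → K), Orthonormal ℂ e →
      ∑ i, ‖R (e i)‖ₑ ^ 2 ≤ ∑' i, ‖⟪b i, (R * R) (b i)⟫_ℂ‖ₑ := fun n e he => by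
    simp_rw [enorm_inner_mul_self hR, ← tsum_enorm_sq_inner b (R (e _))]
    rw [← Summable.tsum_finsetSum fun _ _ => ENNReal.summable]
    refine ENNReal.tsum_le_tsum fun j => ?_
    have h1 := he.sum_inner_products_le (R (b j)) (s := Finset.univ)
    rw [← ofReal_norm (R (b j)), ← ENNReal.ofReal_pow (norm_nonneg _)]
    refine le_trans (le_of_eq ?_) (ENNReal.ofReal_le_ofReal h1)
    rw [ENNReal.ofReal_sum_of_nonneg fun _ _ => by positivity]
    refine Finset.sum_congr rfl fun i _ => ?_
    rw [ENNReal.ofReal_pow (norm_nonneg _), ofReal_norm, ← ContinuousLinearMap.adjoint_inner_left,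
      hR.adjoint_eq, ← inner_conj_symm, ← ofReal_norm, RCLike.norm_conj, ofReal_norm]
  refine traceNorm_le fun n e f he hf => ?_
  have h2 : ∀ i, ‖⟪f i, (R * R) (e i)⟫_ℂ‖ₑ ≤ (‖R (e i)‖ₑ ^ 2 + ‖R (f i)‖ₑ ^ 2) / 2 := fun i => by
    rw [inner_mul_self hR]
    simp only [← ofReal_norm]
    rw [← ENNReal.ofReal_pow (norm_nonneg _), ← ENNReal.ofReal_pow (norm_nonneg _),
      ← ENNReal.ofReal_add (by positivity) (by positivity),
      show (2 : ℝ≥0∞) = ENNReal.ofReal 2 by simp, ← ENNReal.ofReal_div_of_pos two_pos]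
    refine ENNReal.ofReal_le_ofReal ((norm_inner_le_norm _ _).trans ?_)
    nlinarith [sq_nonneg (‖R (f i)‖ - ‖R (e i)‖)]
  refine (Finset.sum_le_sum fun i _ => h2 i).trans ?_
  simp only [div_eq_mul_inv]
  rw [← Finset.sum_mul, Finset.sum_add_distrib]
  refine (mul_le_mul_left (add_le_add (hb n e he) (hb n f hf)) _).trans ?_
  rw [← two_mul, mul_comm 2, mul_assoc, ENNReal.mul_inv_cancel two_ne_zero ENNReal.ofNat_ne_top,
    mul_one]

end TraceNorm

/-! ### Trace class operators as combinations of positive ones -/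

section Decomposition
variable {K : Type*} [NormedAddCommGroup K] [InnerProductSpace ℂ K] [CompleteSpace K]
variable {S T : K →L[ℂ] K}

/-- The positive part is a norm limit of `gₙ(T) T` with `‖gₙ(T)‖ ≤ 1`, so the ideal bound and lower
semicontinuity give `‖P‖₁ ≤ 2 ‖T‖₁`; the negative part `P - T` then costs one more `‖T‖₁`. This
replaces the polar decomposition. -/
theorem exists_positive_sub_positive (hT : IsSelfAdjoint T) :
    ∃ P N : K →L[ℂ] K, P.IsPositive ∧ N.IsPositive ∧ T = P - N ∧
      traceNorm P ≤ 3 * traceNorm T ∧ traceNorm N ≤ 3 * traceNorm T := by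
  set P : K →L[ℂ] K := cfc (fun x : ℝ => max x 0) T with hP
  have hP0 : 0 ≤ P := cfc_nonneg fun x _ => le_max_right x 0
  have hN : P - T = cfc (fun x : ℝ => max x 0 - x) T := by
    rw [cfc_sub (fun x : ℝ => max x 0) (fun x => x) T (by fun_prop) (by fun_prop), cfc_id' ℝ T]
  have hN0 : 0 ≤ P - T := by
    rw [hN]
    exact cfc_nonneg fun x _ => sub_nonneg.2 (le_max_left x 0)
  have hp : ∀ (n : ℕ) (x : ℝ), 0 < max x 0 + 1 / ((n : ℝ) + 1) := fun n x =>
    add_pos_of_nonneg_of_pos (le_max_right x 0) (by positivity)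
  -- Continuous approximations of the indicator of the positive half-line, satisfying `gₙ(x) x - x⁺
  -- = -gₙ(x) / (n + 1)`; hence convergence in operator norm at rate `1 / (n + 1)`.
  let g : ℕ → ℝ → ℝ := fun n x => max x 0 / (max x 0 + 1 / ((n : ℝ) + 1))
  have hgc : ∀ n, Continuous (g n) := fun n =>
    Continuous.div (by fun_prop) (by fun_prop) fun x => (hp n x).ne'
  have hg1 : ∀ n, ‖cfc (g n) T‖ ≤ 1 := fun n => by
    refine norm_cfc_le zero_le_one fun x _ => ?_
    rw [Real.norm_of_nonneg (div_nonneg (le_max_right x 0) (hp n x).le), div_le_one (hp n x)]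
    have : (0 : ℝ) < 1 / ((n : ℝ) + 1) := by positivity
    linarith
  have hlim : Tendsto (fun n => cfc (g n) T * T) atTop (𝓝 P) := by
    rw [tendsto_iff_norm_sub_tendsto_zero]
    refine squeeze_zero (fun _ => norm_nonneg _)
      (fun n => ?_) tendsto_one_div_add_atTop_nhds_zero_nat
    have h1 : cfc (g n) T * T - P = cfc (fun x => g n x * x - max x 0) T := by
      rw [cfc_sub (fun x : ℝ => g n x * x) (fun x => max x 0) T
        ((hgc n).mul continuous_id).continuousOn (by fun_prop),
        cfc_mul (g n) (fun x => x) T (hgc n).continuousOn (by fun_prop), cfc_id' ℝ T]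
    rw [h1]
    have hn : (0 : ℝ) < 1 / ((n : ℝ) + 1) := by positivity
    refine norm_cfc_le hn.le fun x _ => ?_
    have h2 : g n x * x - max x 0 = - (1 / ((n : ℝ) + 1) * g n x) := by
      have := (hp n x).ne'
      simp only [g]
      rw [div_mul_eq_mul_div, ← mul_div_assoc, ← neg_div, eq_div_iff this, sub_mul,
        div_mul_cancel₀ _ this]
      rcases le_total x 0 with hx | hx
      · simp [max_eq_right hx]
      · rw [max_eq_left hx]; ring
    have h3 : 0 ≤ g n x := div_nonneg (le_max_right x 0) (hp n x).le
    have h4 : g n x ≤ 1 := by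
      rw [div_le_one (hp n x)]; linarith
    rw [h2, norm_neg, Real.norm_of_nonneg (mul_nonneg hn.le h3)]
    nlinarith
  have hPn : traceNorm P ≤ 2 * traceNorm T := by
    refine traceNorm_le_of_tendsto (fun x y => tendsto_inner_apply hlim x y)
      (Eventually.of_forall fun n => (traceNorm_mul_le _).trans ?_)
    gcongr
    rw [ENNReal.ofReal_le_iff_le_toReal (by simp)]
    simpa using hg1 n
  refine ⟨P, P - T, (ContinuousLinearMap.nonneg_iff_isPositive P).1 hP0,
    (ContinuousLinearMap.nonneg_iff_isPositive _).1 hN0, by abel, hPn.trans ?_, ?_⟩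
  · gcongr; norm_num
  · rw [sub_eq_add_neg]
    refine traceNorm_add_le.trans ?_
    rw [traceNorm_neg]
    calc _ ≤ 2 * traceNorm T + traceNorm T := by gcongr
      _ = _ := by ring

/-- A trace class operator is a linear combination of four positive ones. -/
theorem exists_sum_positive (T : K →L[ℂ] K) :
    ∃ (P : Fin 4 → K →L[ℂ] K) (c : Fin 4 → ℂ), (∀ i, (P i).IsPositive) ∧ (∀ i, ‖c i‖ = 1) ∧
      (∀ i, traceNorm (P i) ≤ 3 * traceNorm T) ∧ T = ∑ i, c i • P i := by
  have hs : traceNorm (T + T.adjoint) ≤ 2 * traceNorm T := by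
    refine traceNorm_add_le.trans ?_
    rw [traceNorm_adjoint, two_mul]
  have hd : traceNorm (T - T.adjoint) ≤ 2 * traceNorm T := by
    rw [sub_eq_add_neg]
    refine traceNorm_add_le.trans ?_
    rw [traceNorm_neg, traceNorm_adjoint, two_mul]
  have half : ∀ (c : ℂ) (R : K →L[ℂ] K), ‖c‖ = 1 / 2 → traceNorm R ≤ 2 * traceNorm T →
      traceNorm (c • R) ≤ traceNorm T := fun c R hc hR => by
    rw [traceNorm_smul, ← ofReal_norm, hc]
    calc _ ≤ ENNReal.ofReal (1 / 2) * (2 * traceNorm T) := by gcongr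
      _ = _ := by
        rw [← mul_assoc, show (2 : ℝ≥0∞) = ENNReal.ofReal 2 by simp,
          ← ENNReal.ofReal_mul (by norm_num)]
        norm_num
  have hst : star T = T.adjoint := rfl
  obtain ⟨P, N, hP, hN, h1, hPn, hNn⟩ := exists_positive_sub_positive
    (T := (1 / 2 : ℂ) • (T + T.adjoint)) (by
      rw [IsSelfAdjoint, star_smul, star_add, ← hst, star_star, add_comm (star T)]; simp)
  obtain ⟨P', N', hP', hN', h2, hPn', hNn'⟩ := exists_positive_sub_positive
    (T := (-Complex.I / 2 : ℂ) • (T - T.adjoint)) (by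
      rw [IsSelfAdjoint, star_smul, star_sub, ← hst, star_star, ← neg_sub T, smul_neg, ← neg_smul]
      congr 1
      simp [neg_div])
  have hn1 := half (1 / 2) _ (by simp) hs
  have hn2 := half (-Complex.I / 2) _ (by simp) hd
  refine ⟨![P, N, P', N'], ![1, -1, Complex.I, -Complex.I], ?_, ?_, ?_, ?_⟩
  · intro i; fin_cases i <;> simpa
  · intro i; fin_cases i <;> simp
  · intro i
    fin_cases i
    · exact hPn.trans (by gcongr)
    · exact hNn.trans (by gcongr)
    · exact hPn'.trans (by gcongr)
    · exact hNn'.trans (by gcongr)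
  · have h3 : T = (1 / 2 : ℂ) • (T + T.adjoint) +
        Complex.I • ((-Complex.I / 2 : ℂ) • (T - T.adjoint)) := by
      rw [smul_smul, show Complex.I * (-Complex.I / 2) = 1 / 2 by
        rw [mul_div_assoc', mul_neg, Complex.I_mul_I, neg_neg]]
      module
    rw [h1, h2] at h3
    conv_lhs => rw [h3]
    simp [Fin.sum_univ_four]
    module

end Decomposition

/-! ### The Banach space of trace class operators and the trace -/

section TraceClass
variable (K : Type*) [NormedAddCommGroup K] [InnerProductSpace ℂ K] [CompleteSpace K]

/-- The trace class operators, as a subspace of the bounded operators. -/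
def traceClass : Submodule ℂ (K →L[ℂ] K) where
  carrier := {T | traceNorm T ≠ ∞}
  zero_mem' := by simp [traceNorm_zero]
  add_mem' := fun {S T} hS hT =>
    ne_top_of_le_ne_top (ENNReal.add_ne_top.2 ⟨hS, hT⟩) traceNorm_add_le
  smul_mem' := fun c T hT => by
    simp only [Set.mem_ofPred_eq, traceNorm_smul]
    exact ENNReal.mul_ne_top enorm_ne_top hT

/-- The space of trace class operators, normed by the trace norm. -/
def TC : Type _ := traceClass K

namespace TC

instance : AddCommGroup (TC K) := inferInstanceAs (AddCommGroup (traceClass K))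
instance : Module ℂ (TC K) := inferInstanceAs (Module ℂ (traceClass K))

variable {K}

/-- The operator underlying an element of `TC K`. -/
def op : TC K →ₗ[ℂ] (K →L[ℂ] K) := (traceClass K).subtype

theorem op_injective : Function.Injective (op : TC K → K →L[ℂ] K) := Subtype.val_injective

@[ext]
theorem ext {S T : TC K} (h : op S = op T) : S = T := op_injective h

theorem traceNorm_op_ne_top (T : TC K) : traceNorm (op T) ≠ ∞ := T.2

/-- A bounded operator of finite trace norm as an element of `TC K`. -/
def mk (T : K →L[ℂ] K) (h : traceNorm T ≠ ∞) : TC K := ⟨T, h⟩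

@[simp]
theorem op_mk (T : K →L[ℂ] K) (h : traceNorm T ≠ ∞) : op (mk T h) = T := rfl

instance : Norm (TC K) := ⟨fun T => (traceNorm (op T)).toReal⟩

theorem norm_def (T : TC K) : ‖T‖ = (traceNorm (op T)).toReal := rfl

theorem ofReal_norm (T : TC K) : ENNReal.ofReal ‖T‖ = traceNorm (op T) :=
  ENNReal.ofReal_toReal T.2

theorem norm_op_le (T : TC K) : ‖op T‖ ≤ ‖T‖ := by
  rw [norm_def, ← ENNReal.ofReal_le_iff_le_toReal T.traceNorm_op_ne_top, _root_.ofReal_norm]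
  exact enorm_le_traceNorm

theorem core : NormedSpace.Core ℂ (TC K) where
  norm_nonneg _ := ENNReal.toReal_nonneg
  norm_smul c T := by
    rw [norm_def, map_smul, traceNorm_smul, ENNReal.toReal_mul, toReal_enorm, norm_def]
  norm_triangle S T := by
    rw [norm_def, norm_def, norm_def, map_add,
      ← ENNReal.toReal_add S.traceNorm_op_ne_top T.traceNorm_op_ne_top]
    exact ENNReal.toReal_mono (ENNReal.add_ne_top.2 ⟨S.2, T.2⟩) traceNorm_add_le
  norm_eq_zero_iff T := by
    refine ⟨fun h => ?_, fun h => by rw [h, norm_def, map_zero, traceNorm_zero]; rfl⟩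
    refine op_injective (norm_le_zero_iff.1 ?_)
    exact (norm_op_le T).trans h.le

instance : NormedAddCommGroup (TC K) := NormedAddCommGroup.ofCore core
instance : NormedSpace ℂ (TC K) := NormedSpace.ofCore core

theorem norm_le_iff {T : TC K} {c : ℝ} (hc : 0 ≤ c) :
    ‖T‖ ≤ c ↔ traceNorm (op T) ≤ ENNReal.ofReal c := by
  rw [← ofReal_norm, ENNReal.ofReal_le_ofReal_iff hc]

/-- The inclusion of the trace class operators into the bounded operators. -/
def opL : TC K →L[ℂ] (K →L[ℂ] K) :=
  LinearMap.mkContinuous op 1 fun T => by rw [one_mul]; exact norm_op_le T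

@[simp]
theorem opL_apply (T : TC K) : opL T = op T := rfl

/-- A Cauchy sequence for the trace norm has a limit in operator norm, because the latter is
smaller. Lower semicontinuity of the trace norm turns the Cauchy estimate into convergence to that
limit. -/
instance : CompleteSpace (TC K) := by
  refine Metric.complete_of_cauchySeq_tendsto fun u hu => ?_
  have hu' : CauchySeq fun n => op (u n) := (opL (K := K)).uniformContinuous.comp_cauchySeq hu
  obtain ⟨T, hT⟩ := cauchySeq_tendsto_of_complete hu'
  have key : ∀ ε > 0, ∃ N, ∀ n ≥ N, traceNorm (T - op (u n)) ≤ ENNReal.ofReal ε := by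
    intro ε hε
    obtain ⟨N, hN⟩ := Metric.cauchySeq_iff.1 hu ε hε
    refine ⟨N, fun n hn => ?_⟩
    have h1 : Tendsto (fun m => op (u m) - op (u n)) atTop (𝓝 (T - op (u n))) :=
      hT.sub_const _
    refine traceNorm_le_of_tendsto (tendsto_inner_apply h1) ?_
    filter_upwards [eventually_ge_atTop N] with m hm
    rw [← map_sub, ← norm_le_iff hε.le, ← dist_eq_norm]
    exact (hN m hm n hn).le
  have hT' : traceNorm T ≠ ∞ := by
    obtain ⟨N, hN⟩ := key 1 one_pos
    have h2 := hN N le_rfl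
    have h3 : T = (T - op (u N)) + op (u N) := by abel
    rw [h3]
    exact ne_top_of_le_ne_top (ENNReal.add_ne_top.2
      ⟨ne_top_of_le_ne_top ENNReal.ofReal_ne_top h2, (u N).2⟩) traceNorm_add_le
  refine ⟨mk T hT', ?_⟩
  rw [Metric.tendsto_atTop]
  intro ε hε
  obtain ⟨N, hN⟩ := key (ε / 2) (half_pos hε)
  refine ⟨N, fun n hn => ?_⟩
  rw [dist_comm, dist_eq_norm]
  refine lt_of_le_of_lt ((norm_le_iff (half_pos hε).le).2 ?_) (half_lt_self hε)
  simpa using hN n hn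

variable {K' : Type*} [NormedAddCommGroup K'] [InnerProductSpace ℂ K'] [CompleteSpace K']
  {E : Type*} [NormedAddCommGroup E] [NormedSpace ℂ E]

/-- A linear map into the bounded operators that is bounded for the trace norm, as a bounded linear
map into the trace class operators. -/
def lift (Φ : E →ₗ[ℂ] (K →L[ℂ] K)) (c : ℝ)
    (h : ∀ x, traceNorm (Φ x) ≤ ENNReal.ofReal (c * ‖x‖)) : E →L[ℂ] TC K :=
  LinearMap.mkContinuous
    { toFun := fun x => mk (Φ x) (ne_top_of_le_ne_top ENNReal.ofReal_ne_top (h x))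
      map_add' := fun x y => ext (by simp)
      map_smul' := fun a x => ext (by simp) } (max c 0) fun x => by
    refine (norm_le_iff (mul_nonneg (le_max_right _ _) (norm_nonneg _))).2 ((h x).trans ?_)
    exact ENNReal.ofReal_le_ofReal (mul_le_mul_of_nonneg_right (le_max_left _ _) (norm_nonneg _))

/-- `lift` for maps of trace class operators that do not increase the trace norm. -/
def contraction (Φ : TC K →ₗ[ℂ] (K' →L[ℂ] K')) (h : ∀ T, traceNorm (Φ T) ≤ traceNorm (op T)) :
    TC K →L[ℂ] TC K' :=
  lift Φ 1 fun T => by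
    rw [one_mul, ofReal_norm]
    exact h T

theorem norm_contraction_apply_le (Φ : TC K →ₗ[ℂ] (K' →L[ℂ] K'))
    (h : ∀ T, traceNorm (Φ T) ≤ traceNorm (op T)) (T : TC K) : ‖contraction Φ h T‖ ≤ ‖T‖ := by
  rw [norm_le_iff (norm_nonneg _), ofReal_norm]
  exact h T

/-- Multiplication of trace class operators by a bounded operator on the right. -/
def mulRight (A : K →L[ℂ] K) : TC K →L[ℂ] TC K :=
  lift ((LinearMap.mulRight ℂ A).comp op) (2 * ‖A‖) fun T => by
    rw [ENNReal.ofReal_mul (by positivity), ofReal_norm]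
    exact traceNorm_mul_le' A

/-- Multiplication of trace class operators by a bounded operator on the left. -/
def mulLeft (A : K →L[ℂ] K) : TC K →L[ℂ] TC K :=
  lift ((LinearMap.mulLeft ℂ A).comp op) (2 * ‖A‖) fun T => by
    rw [ENNReal.ofReal_mul (by positivity), ofReal_norm]
    exact traceNorm_mul_le A

@[simp]
theorem op_mulRight (A : K →L[ℂ] K) (T : TC K) : op (mulRight A T) = op T * A := rfl

@[simp]
theorem op_mulLeft (A : K →L[ℂ] K) (T : TC K) : op (mulLeft A T) = A * op T := rfl

theorem sum_norm_inner_le {ι : Type*} (T : TC K) {e f : ι → K} (he : Orthonormal ℂ e)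
    (hf : Orthonormal ℂ f) (s : Finset ι) : ∑ i ∈ s, ‖⟪f i, op T (e i)⟫_ℂ‖ ≤ ‖T‖ := by
  rw [norm_def, ← ENNReal.ofReal_le_iff_le_toReal T.traceNorm_op_ne_top,
    ENNReal.ofReal_sum_of_nonneg fun _ _ => norm_nonneg _]
  simp_rw [_root_.ofReal_norm]
  exact (ENNReal.sum_le_tsum s).trans (tsum_enorm_inner_le_traceNorm he hf)

theorem summable_norm_inner {ι : Type*} (T : TC K) {e f : ι → K} (he : Orthonormal ℂ e)
    (hf : Orthonormal ℂ f) : Summable fun i => ‖⟪f i, op T (e i)⟫_ℂ‖ :=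
  summable_of_sum_le (fun _ => norm_nonneg _) (T.sum_norm_inner_le he hf)

/-- The trace. -/
def tr : TC K →L[ℂ] ℂ :=
  LinearMap.mkContinuous
    { toFun := fun T => ∑' i, ⟪basis K i, op T (basis K i)⟫_ℂ
      map_add' := fun S T => by
        simp only [map_add, add_apply, inner_add_right]
        exact ((S.summable_norm_inner (basis K).orthonormal (basis K).orthonormal).of_norm).tsum_add
          ((T.summable_norm_inner (basis K).orthonormal (basis K).orthonormal).of_norm)
      map_smul' := fun c T => by
        simp only [map_smul, smul_apply, inner_smul_right, tsum_mul_left]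
        rfl } 1 fun T => by
    rw [one_mul]
    have h := T.summable_norm_inner (basis K).orthonormal (basis K).orthonormal
    exact (norm_tsum_le_tsum_norm h).trans (h.tsum_le_of_sum_le
      (T.sum_norm_inner_le (basis K).orthonormal (basis K).orthonormal))

theorem tr_def (T : TC K) : tr T = ∑' i, ⟪basis K i, op T (basis K i)⟫_ℂ := rfl

theorem tsum_inner_of_isPositive (T : TC K) (hT : (op T).IsPositive) {ι : Type*}
    (b : HilbertBasis ι ℂ K) : ∑' i, ⟪b i, op T (b i)⟫_ℂ = ‖T‖ := by
  have h1 : ∀ i, ⟪b i, op T (b i)⟫_ℂ = (‖⟪b i, op T (b i)⟫_ℂ‖ : ℂ) := fun i =>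
    RCLike.norm_of_nonneg' (hT.inner_nonneg_right (b i)) |>.symm
  rw [norm_def, traceNorm_eq_tsum hT b, ENNReal.tsum_toReal_eq fun _ => enorm_ne_top]
  simp_rw [toReal_enorm]
  rw [Complex.ofReal_tsum]
  exact tsum_congr h1

theorem tr_of_isPositive (T : TC K) (hT : (op T).IsPositive) : tr T = ‖T‖ :=
  T.tsum_inner_of_isPositive hT _

/-- The trace may be computed in any orthonormal basis. -/
theorem hasSum_tr (T : TC K) {ι : Type*} (b : HilbertBasis ι ℂ K) :
    HasSum (fun i => ⟪b i, op T (b i)⟫_ℂ) (tr T) := by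
  -- For positive operators the trace in any basis equals the trace norm, which mentions no basis;
  -- linearity does the rest.
  obtain ⟨P, c, hP, -, hn, hT⟩ := exists_sum_positive (op T)
  have hf : ∀ i, traceNorm (P i) ≠ ∞ := fun i => ne_top_of_le_ne_top
    (ENNReal.mul_ne_top ENNReal.ofNat_ne_top T.2) (hn i)
  have hT' : T = ∑ i, c i • mk (P i) (hf i) := ext (by simpa [map_sum] using hT)
  have hp : ∀ i, HasSum (fun j => ⟪b j, P i (b j)⟫_ℂ) (tr (mk (P i) (hf i))) := fun i => by
    rw [tr_of_isPositive _ (hP i), ← tsum_inner_of_isPositive _ (hP i) b]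
    exact ((mk (P i) (hf i)).summable_norm_inner b.orthonormal b.orthonormal).of_norm.hasSum
  have h := hasSum_sum (s := Finset.univ) fun i _ => (hp i).mul_left (c i)
  rw [hT', map_sum]
  simp only [map_sum, map_smul, op_mk, sum_apply, smul_apply, inner_sum,
    inner_smul_right, smul_eq_mul]
  exact h

/-- The image of an orthonormal basis under a unitary. -/
def _root_.QuantumKac.unitaryBasis {ι : Type*} (b : HilbertBasis ι ℂ K)
    (u : unitary (K →L[ℂ] K)) : HilbertBasis ι ℂ K :=
  HilbertBasis.mk (orthonormal_unitary b.orthonormal u) <| by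
    have h := b.dense_span
    rw [top_le_iff, ← Submodule.dense_iff_topologicalClosure_eq_top] at *
    have h1 := (Unitary.linearIsometryEquiv u).surjective.denseRange.dense_image
      (Unitary.linearIsometryEquiv u).continuous h
    refine h1.mono ?_
    rintro _ ⟨x, hx, rfl⟩
    have := Submodule.mem_map_of_mem (f := ((u : K →L[ℂ] K) : K →ₗ[ℂ] K)) hx
    rw [Submodule.map_span, ← Set.range_comp] at this
    exact this

@[simp]
theorem _root_.QuantumKac.unitaryBasis_apply {ι : Type*} (b : HilbertBasis ι ℂ K)
    (u : unitary (K →L[ℂ] K)) (i : ι) : unitaryBasis b u i = (u : K →L[ℂ] K) (b i) := by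
  simp [unitaryBasis]

/-- The diagonal entries of `S` in the basis `u bᵢ` are those of `T` in the basis `bᵢ`. This is the
only form of cyclicity of the trace that is needed. -/
theorem tr_eq_of_conj {S T : TC K} (u : unitary (K →L[ℂ] K))
    (h : op S = (u : K →L[ℂ] K) * op T * star (u : K →L[ℂ] K)) : tr S = tr T := by
  refine (S.hasSum_tr (unitaryBasis (basis K) u)).unique ?_
  convert T.hasSum_tr (basis K) using 2 with i
  have hu : star (u : K →L[ℂ] K) ((u : K →L[ℂ] K) (basis K i)) = basis K i :=
    congrArg (fun R : K →L[ℂ] K => R (basis K i)) (Unitary.star_mul_self_of_mem u.2)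
  rw [h, unitaryBasis_apply, mul_apply_eq_comp, mul_apply_eq_comp, hu, Unitary.inner_map_map]

/-- Trace class operators are determined by their pairing with the bounded operators. -/
theorem ext_tr {S T : TC K} (h : ∀ A : K →L[ℂ] K, tr (mulRight A S) = tr (mulRight A T)) :
    S = T := by
  -- Rank-one operators already suffice as test operators, since they recover all matrix elements.
  have key : ∀ (R : TC K) (x y : K),
      tr (mulRight (InnerProductSpace.rankOne ℂ y x) R) = ⟪x, op R y⟫_ℂ := fun R x y => by
    rw [tr_def, ← (basis K).tsum_inner_mul_inner x (op R y)]
    refine tsum_congr fun i => ?_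
    simp
  refine ext (ContinuousLinearMap.ext fun y => ext_inner_left ℂ fun x => ?_)
  rw [← key, ← key, h]

end TC
end TraceClass

/-- Distinct orthonormal vectors are `√2` apart, so the balls of radius `1/2` around them are
disjoint. Separability enters the proof only here: countable bases allow sums over them to be
exchanged with integrals over `C`. -/
theorem countable_of_orthonormal {E ι : Type*} [NormedAddCommGroup E] [InnerProductSpace ℂ E]
    [TopologicalSpace.SeparableSpace E] {v : ι → E} (hv : Orthonormal ℂ v) : Countable ι := by
  refine Pairwise.countable_of_isOpen_disjoint (s := fun i => Metric.ball (v i) (1 / 2))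
    (fun i j hij => ?_) (fun i => Metric.isOpen_ball) (fun i => ⟨v i, by simp⟩)
  refine Metric.ball_disjoint_ball ?_
  rw [dist_eq_norm]
  have h : ‖v i - v j‖ ^ 2 = 2 := by
    rw [@norm_sub_sq ℂ, hv.2 hij, hv.1, hv.1]; norm_num
  nlinarith [norm_nonneg (v i - v j)]

/-! ### Unitary averages on trace class operators -/

section Average
variable {C K : Type*} [MetricSpace C] [CompactSpace C] [MeasurableSpace C] [BorelSpace C]
  [NormedAddCommGroup K] [InnerProductSpace ℂ K] [CompleteSpace K]
  {W : C → K →L[ℂ] K} (hW : IsContractiveFamily W) (ν : Measure C) [IsProbabilityMeasure ν]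

theorem average_apply (A : K →L[ℂ] K) (x : K) :
    average hW ν A x = ∫ σ, W σ (A ((W σ).adjoint x)) ∂ν := rfl

theorem inner_average (A : K →L[ℂ] K) (x y : K) :
    ⟪x, average hW ν A y⟫_ℂ = ∫ σ, ⟪x, W σ (A ((W σ).adjoint y))⟫_ℂ ∂ν := by
  rw [average_apply, integral_inner (hW.integrable ν A y)]

theorem IsContractiveFamily.continuous_inner_conj (hW : IsContractiveFamily W) (A : K →L[ℂ] K) (x y : K) :
    Continuous fun σ => ⟪x, W σ (A ((W σ).adjoint y))⟫_ℂ :=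
  continuous_const.inner (hW.continuous_conj A y)

theorem isPositive_average {A : K →L[ℂ] K} (hA : A.IsPositive) : (average hW ν A).IsPositive := by
  rw [ContinuousLinearMap.isPositive_iff_complex]
  intro x
  have h1 : ∀ σ, ⟪x, W σ (A ((W σ).adjoint x))⟫_ℂ =
      ((⟪(W σ).adjoint x, A ((W σ).adjoint x)⟫_ℂ).re : ℂ) := fun σ => by
    rw [← ContinuousLinearMap.adjoint_inner_left]
    have := hA.inner_nonneg_right ((W σ).adjoint x)
    exact Complex.ext rfl (by simpa using (Complex.nonneg_iff.1 this).2.symm)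
  have h2 : ⟪x, average hW ν A x⟫_ℂ =
      ((∫ σ, (⟪(W σ).adjoint x, A ((W σ).adjoint x)⟫_ℂ).re ∂ν : ℝ) : ℂ) := by
    rw [inner_average, ← integral_complex_ofReal]
    exact integral_congr_ae (Eventually.of_forall h1)
  rw [← inner_conj_symm, h2]
  have h3 : 0 ≤ ∫ σ, (⟪(W σ).adjoint x, A ((W σ).adjoint x)⟫_ℂ).re ∂ν :=
    integral_nonneg fun σ => (Complex.nonneg_iff.1 (hA.inner_nonneg_right _)).1
  simpa using h3

/-- For each fixed `σ` the adjoint of `W σ` moves the two test families to orthonormal families, so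
the integrand is at most `traceNorm T`, and `ν` has mass one. -/
theorem traceNorm_average_le (hu : ∀ σ, W σ ∈ unitary (K →L[ℂ] K)) (T : K →L[ℂ] K) :
    traceNorm (average hW ν T) ≤ traceNorm T := by
  refine traceNorm_le fun n e f he hf => ?_
  calc ∑ i, ‖⟪f i, average hW ν T (e i)⟫_ℂ‖ₑ
      ≤ ∑ i, ∫⁻ σ, ‖⟪f i, W σ (T ((W σ).adjoint (e i)))⟫_ℂ‖ₑ ∂ν := by
        refine Finset.sum_le_sum fun i _ => ?_
        rw [inner_average]
        exact enorm_integral_le_lintegral_enorm _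
    _ = ∫⁻ σ, ∑ i, ‖⟪f i, W σ (T ((W σ).adjoint (e i)))⟫_ℂ‖ₑ ∂ν := by
        rw [lintegral_finsetSum]
        exact fun i _ => (hW.continuous_inner_conj T _ _).enorm.measurable
    _ ≤ ∫⁻ _, traceNorm T ∂ν := by
        refine lintegral_mono fun σ => ?_
        have h1 : ∀ i, ⟪f i, W σ (T ((W σ).adjoint (e i)))⟫_ℂ =
            ⟪(W σ).adjoint (f i), T ((W σ).adjoint (e i))⟫_ℂ := fun i =>
          (ContinuousLinearMap.adjoint_inner_left _ _ _).symm
        simp only [h1]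
        exact sum_enorm_inner_le_traceNorm (orthonormal_unitary he (star ⟨W σ, hu σ⟩))
          (orthonormal_unitary hf (star ⟨W σ, hu σ⟩))
    _ = traceNorm T := by simp

variable (hu : ∀ σ, W σ ∈ unitary (K →L[ℂ] K))

/-- The average over a unitary family, on trace class operators. -/
def averageTC : TC K →L[ℂ] TC K :=
  TC.contraction ((average hW ν : (K →L[ℂ] K) →ₗ[ℂ] _).comp TC.op) fun T =>
    traceNorm_average_le hW ν hu (TC.op T)

@[simp]
theorem op_averageTC (T : TC K) : TC.op (averageTC hW ν hu T) = average hW ν (TC.op T) := rfl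

theorem norm_averageTC_apply_le (T : TC K) : ‖averageTC hW ν hu T‖ ≤ ‖T‖ :=
  TC.norm_contraction_apply_le _ _ T

/-- The passage to the Heisenberg picture: the average of states is dual to the average of `W* A W`.
It turns statements about collisions of states into commutation relations between operators. -/
theorem tr_mulRight_averageTC [TopologicalSpace.SeparableSpace K] (T : TC K) (A : K →L[ℂ] K) :
    TC.tr (TC.mulRight A (averageTC hW ν hu T)) =
      ∫ σ, TC.tr (TC.mulRight (star (W σ) * A * W σ) T) ∂ν := by
  have : Countable (basisIdx K) := countable_of_orthonormal (basis K).orthonormal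
  -- Conjugating `T (W* A W)` by `W` gives `(W T)(W* A)`, whose diagonal entries can be compared
  -- with those of the averaged operator.
  have hc : ∀ σ, TC.tr (TC.mulRight (star (W σ) * A * W σ) T) =
      TC.tr (TC.mulRight (star (W σ) * A) (TC.mulLeft (W σ) T)) := fun σ => by
    symm
    refine TC.tr_eq_of_conj ⟨W σ, hu σ⟩ ?_
    simp only [TC.op_mulRight, TC.op_mulLeft, mul_assoc, Unitary.mul_star_self_of_mem (hu σ),
      mul_one]
  have hi : ∀ σ i, ⟪basis K i, (W σ * TC.op T * (star (W σ) * A)) (basis K i)⟫_ℂ =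
      ⟪basis K i, W σ (TC.op T ((W σ).adjoint (A (basis K i))))⟫_ℂ := fun σ i => rfl
  simp_rw [hc]
  -- A bound uniform in `σ`, hence integrable; it justifies exchanging the basis sum and the
  -- integral.
  have hn : ∀ σ, ∑' i, ‖⟪basis K i, W σ (TC.op T ((W σ).adjoint (A (basis K i))))⟫_ℂ‖ₑ ≤
      ENNReal.ofReal (2 * ‖A‖) * traceNorm (TC.op T) := fun σ => by
    simp_rw [← hi σ]
    refine (tsum_enorm_inner_le_traceNorm (basis K).orthonormal (basis K).orthonormal).trans ?_
    rw [← mul_assoc]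
    refine (traceNorm_mul_le' A).trans ?_
    gcongr
    rw [← traceNorm_adjoint]
    have h1 : (W σ * TC.op T * star (W σ)).adjoint =
        (⟨W σ, hu σ⟩ : unitary (K →L[ℂ] K)) * ((TC.op T).adjoint * star (W σ)) := by
      change star (W σ * TC.op T * star (W σ)) = W σ * (star (TC.op T) * star (W σ))
      simp
    rw [h1]
    refine (traceNorm_unitary_mul_le _).trans ?_
    rw [← traceNorm_adjoint]
    have h2 : ((TC.op T).adjoint * star (W σ)).adjoint =
        (⟨W σ, hu σ⟩ : unitary (K →L[ℂ] K)) * TC.op T := by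
      change star (star (TC.op T) * star (W σ)) = W σ * TC.op T
      simp
    rw [h2]
    exact traceNorm_unitary_mul_le _
  have hm : ∀ i, Continuous fun σ => ⟪basis K i, W σ (TC.op T ((W σ).adjoint (A (basis K i))))⟫_ℂ :=
    fun i => hW.continuous_inner_conj _ _ _
  simp only [TC.tr_def, TC.op_mulRight, TC.op_mulLeft, op_averageTC, hi]
  rw [integral_tsum (fun i => (hm i).aestronglyMeasurable)]
  · exact tsum_congr fun i => inner_average hW ν _ _ _
  · rw [← lintegral_tsum fun i => (hm i).enorm.aemeasurable]
    refine ne_top_of_le_ne_top ?_ (lintegral_mono hn)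
    rw [lintegral_const, measure_univ, mul_one]
    exact ENNReal.mul_ne_top ENNReal.ofReal_ne_top T.traceNorm_op_ne_top

/-- Averaging preserves the trace. -/
theorem tr_averageTC [TopologicalSpace.SeparableSpace K] (T : TC K) :
    TC.tr (averageTC hW ν hu T) = TC.tr T := by
  have h := tr_mulRight_averageTC hW ν hu T 1
  have h1 : ∀ S : TC K, TC.mulRight 1 S = S := fun S => TC.ext (by simp)
  simpa [Unitary.star_mul_self_of_mem (hu _), h1] using h

end Average

/-! ### Matrix elements in the product basis -/

section Entries
variable {H : Type*} [NormedAddCommGroup H] [InnerProductSpace ℂ H] [CompleteSpace H]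
variable {ι κ κ' : Type}

/-- The product vectors `basisVec α` as an orthonormal basis. -/
def tensorBasis (H : Type*) [NormedAddCommGroup H] [InnerProductSpace ℂ H] [CompleteSpace H]
    (ι : Type) : HilbertBasis (ι → basisIdx H) ℂ (TensorPow H ι) :=
  HilbertBasis.ofRepr (LinearIsometryEquiv.refl ℂ (TensorPow H ι))

theorem tensorBasis_apply (α : ι → basisIdx H) : tensorBasis H ι α = basisVec α := rfl

/-- The matrix elements of an operator in the product basis. -/
def entry (T : TensorPow H ι →L[ℂ] TensorPow H ι) (α β : ι → basisIdx H) : ℂ :=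
  ⟪basisVec α, T (basisVec β)⟫_ℂ

theorem ext_basisVec {E : Type*} [NormedAddCommGroup E] [NormedSpace ℂ E]
    {S T : TensorPow H ι →L[ℂ] E} (h : ∀ β, S (basisVec β) = T (basisVec β)) : S = T := by
  refine ContinuousLinearMap.ext_on
    (Submodule.dense_iff_topologicalClosure_eq_top.2 (tensorBasis H ι).dense_span) ?_
  rintro _ ⟨β, rfl⟩
  exact h β

theorem ext_inner_basisVec {x y : TensorPow H ι}
    (h : ∀ α : ι → basisIdx H, ⟪basisVec α, x⟫_ℂ = ⟪basisVec α, y⟫_ℂ) : x = y := by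
  refine (tensorBasis H ι).repr.injective ?_
  ext α
  rw [HilbertBasis.repr_apply_apply, HilbertBasis.repr_apply_apply]
  exact h α

theorem ext_entry {S T : TensorPow H ι →L[ℂ] TensorPow H ι}
    (h : ∀ α β, entry S α β = entry T α β) : S = T :=
  ext_basisVec fun β => ext_inner_basisVec fun α => h α β

open scoped Classical in
theorem inner_basisVec (α β : ι → basisIdx H) :
    ⟪basisVec α, basisVec β⟫_ℂ = if α = β then 1 else 0 :=
  orthonormal_iff_ite.1 orthonormal_basisVec α β

theorem isometryOfOrthonormal_basisVec {E : Type*} [NormedAddCommGroup E]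
    [InnerProductSpace ℂ E] [CompleteSpace E] {v : (ι → basisIdx H) → E} (hv : Orthonormal ℂ v)
    (α : ι → basisIdx H) : isometryOfOrthonormal hv (basisVec α) = v α := by
  classical
  have h : (basisVec α : TensorPow H ι) = lp.single 2 α 1 :=
    ((tensorBasis H ι).repr_symm_single α).symm
  rw [h, isometryOfOrthonormal, OrthogonalFamily.linearIsometry_apply_single]
  simp [LinearIsometry.toSpanSingleton_apply]

theorem insertVec_basisVec (f : κ ↪ ι) (y : {i // i ∉ Set.range f} → basisIdx H)
    (x : κ → basisIdx H) : insertVec f y (basisVec x) = basisVec (merge f y x) :=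
  isometryOfOrthonormal_basisVec _ x

theorem merge_restrict (f : κ ↪ ι) (α : ι → basisIdx H) :
    merge f (fun i => α i) (α ∘ f) = α := by
  ext1 i
  by_cases hi : i ∈ Set.range f
  · obtain ⟨k, rfl⟩ := hi
    exact merge_apply_mem f _ _ k
  · exact merge_apply_not_mem f _ _ ⟨i, hi⟩

theorem merge_comp (f : κ ↪ ι) (y : {i // i ∉ Set.range f} → basisIdx H) (x : κ → basisIdx H) :
    merge f y x ∘ f = x := funext (merge_apply_mem f y x)

theorem basisVec_eq_insertVec (f : κ ↪ ι) (α : ι → basisIdx H) :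
    (basisVec α : TensorPow H ι) = insertVec f (fun i => α i) (basisVec (α ∘ f)) := by
  rw [insertVec_basisVec, merge_restrict]

open scoped Classical in
theorem entry_amplify (f : κ ↪ ι) (A : TensorPow H κ →L[ℂ] TensorPow H κ)
    (α β : ι → basisIdx H) : entry (amplify f A) α β =
      if ∀ i, i ∉ Set.range f → α i = β i then entry A (α ∘ f) (β ∘ f) else 0 := by
  rw [entry, basisVec_eq_insertVec f β, amplify_insertVec, basisVec_eq_insertVec f α]
  by_cases h : ∀ i, i ∉ Set.range f → α i = β i
  · have h1 : (fun i : {i // i ∉ Set.range f} => α i) = fun i => β i.1 :=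
      funext fun i => h i i.2
    rw [if_pos h, h1, LinearIsometry.inner_map_map, entry]
  · rw [if_neg h]
    refine (orthogonalFamily_insertVec f) (fun h1 => h fun i hi => ?_) _ _
    exact congrFun h1 ⟨i, hi⟩

theorem amplify_one (f : κ ↪ ι) : amplify f (1 : TensorPow H κ →L[ℂ] TensorPow H κ) = 1 := by
  refine ext_basisVec fun β => ?_
  rw [basisVec_eq_insertVec f β, amplify_insertVec]
  rfl

theorem amplify_refl (A : TensorPow H ι →L[ℂ] TensorPow H ι) :
    amplify (Function.Embedding.refl ι) A = A := by
  classical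
  refine ext_entry fun α β => ?_
  rw [entry_amplify, if_pos fun i hi => absurd ⟨i, rfl⟩ hi]
  rfl

theorem amplify_mul (f : κ ↪ ι) (A B : TensorPow H κ →L[ℂ] TensorPow H κ) :
    amplify f (A * B) = amplify f A * amplify f B := by
  refine ext_basisVec fun β => ?_
  rw [mul_apply_eq_comp, basisVec_eq_insertVec f β, amplify_insertVec, amplify_insertVec,
    amplify_insertVec, mul_apply_eq_comp]

theorem amplify_star (f : κ ↪ ι) (A : TensorPow H κ →L[ℂ] TensorPow H κ) :
    amplify f (star A) = star (amplify f A) := (adjoint_amplify f A).symm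

/-- `A ↦ A ⊗ 1` as a bounded linear map. -/
def amplifyL (f : κ ↪ ι) :
    (TensorPow H κ →L[ℂ] TensorPow H κ) →L[ℂ] (TensorPow H ι →L[ℂ] TensorPow H ι) :=
  LinearMap.mkContinuous
    { toFun := amplify f
      map_add' := fun A B => ext_basisVec fun β => by
        rw [add_apply, basisVec_eq_insertVec f β, amplify_insertVec,
          amplify_insertVec, amplify_insertVec, add_apply, map_add]
      map_smul' := fun c A => ext_basisVec fun β => by
        rw [smul_apply, basisVec_eq_insertVec f β, amplify_insertVec,
          amplify_insertVec, smul_apply, map_smul]; rfl } 1 fun A => by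
    rw [one_mul]; exact norm_amplify_le f A

@[simp]
theorem amplifyL_apply (f : κ ↪ ι) (A : TensorPow H κ →L[ℂ] TensorPow H κ) :
    amplifyL f A = amplify f A := rfl

/-- `A ↦ A ⊗ 1` as a homomorphism of monoids. -/
def amplifyHom (f : κ ↪ ι) :
    (TensorPow H κ →L[ℂ] TensorPow H κ) →* (TensorPow H ι →L[ℂ] TensorPow H ι) where
  toFun := amplify f
  map_one' := amplify_one f
  map_mul' := amplify_mul f

theorem amplify_mem_unitary (f : κ ↪ ι) {A : TensorPow H κ →L[ℂ] TensorPow H κ}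
    (hA : A ∈ unitary (TensorPow H κ →L[ℂ] TensorPow H κ)) :
    amplify f A ∈ unitary (TensorPow H ι →L[ℂ] TensorPow H ι) := by
  rw [Unitary.mem_iff] at hA ⊢
  rw [← amplify_star, ← amplify_mul, ← amplify_mul, hA.1, hA.2, amplify_one]
  exact ⟨rfl, rfl⟩

theorem amplify_amplify (f : κ ↪ κ') (g : κ' ↪ ι) (A : TensorPow H κ →L[ℂ] TensorPow H κ) :
    amplify g (amplify f A) = amplify (f.trans g) A := by
  classical
  refine ext_entry fun α β => ?_
  simp only [entry_amplify]
  have h : (∀ i, i ∉ Set.range (f.trans g) → α i = β i) ↔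
      (∀ i, i ∉ Set.range g → α i = β i) ∧
      ∀ j, j ∉ Set.range f → (α ∘ g) j = (β ∘ g) j := by
    constructor
    · refine fun h => ⟨fun i hi => h i ?_, fun j hj => h _ ?_⟩
      · rintro ⟨k, rfl⟩; exact hi ⟨f k, rfl⟩
      · rintro ⟨k, hk⟩; exact hj ⟨k, g.injective hk⟩
    · rintro ⟨h1, h2⟩ i hi
      by_cases hg : i ∈ Set.range g
      · obtain ⟨j, rfl⟩ := hg
        refine h2 j ?_
        rintro ⟨k, rfl⟩
        exact hi ⟨k, rfl⟩
      · exact h1 i hg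
  rw [if_congr h rfl rfl, ite_and]
  rfl

-- In the sum over intermediate multi-indices only one term can be nonzero, since each of the two
-- operators leaves the indices outside its own factors unchanged. The resulting formula is
-- symmetric in the two operators, which yields their commutation, and it factorizes, which yields
-- traces of tensor products.
open scoped Classical in
theorem entry_amplify_mul_amplify {f : κ ↪ ι} {g : κ' ↪ ι}
    (hfg : ∀ k k', f k ≠ g k') (A : TensorPow H κ →L[ℂ] TensorPow H κ)
    (B : TensorPow H κ' →L[ℂ] TensorPow H κ') (α β : ι → basisIdx H) :
    entry (amplify f A * amplify g B) α β =
      if ∀ i, i ∉ Set.range f → i ∉ Set.range g → α i = β i then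
        entry A (α ∘ f) (β ∘ f) * entry B (α ∘ g) (β ∘ g) else 0 := by
  have h0 : entry (amplify f A * amplify g B) α β =
      ∑' γ, entry (amplify f A) α γ * entry (amplify g B) γ β := by
    rw [entry, mul_apply_eq_comp, ← ContinuousLinearMap.adjoint_inner_left,
      ← (tensorBasis H ι).tsum_inner_mul_inner]
    refine tsum_congr fun γ => ?_
    rw [ContinuousLinearMap.adjoint_inner_left]
    rfl
  -- The surviving intermediate index: the second operator has already acted off the range of `f`,
  -- the first has not yet acted on it.
  let γ₀ : ι → basisIdx H := fun i => if i ∈ Set.range f then β i else α i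
  have hf : ∀ k, γ₀ (f k) = β (f k) := fun k => if_pos ⟨k, rfl⟩
  have hn : ∀ i, i ∉ Set.range f → γ₀ i = α i := fun i hi => if_neg hi
  have hg : ∀ k, γ₀ (g k) = α (g k) := fun k => hn _ (by rintro ⟨j, hj⟩; exact hfg j k hj)
  rw [h0, tsum_eq_single γ₀]
  · rw [entry_amplify, entry_amplify, if_pos fun i hi => (hn i hi).symm,
      show γ₀ ∘ f = β ∘ f from funext hf, show γ₀ ∘ g = α ∘ g from funext hg, mul_ite, mul_zero]
    refine if_congr ⟨fun h i hi hi' => ?_, fun h i hi => ?_⟩ rfl rfl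
    · rw [← hn i hi]; exact h i hi'
    · by_cases hif : i ∈ Set.range f
      · obtain ⟨k, rfl⟩ := hif; exact hf k
      · rw [hn i hif]; exact h i hif hi
  · intro γ hγ
    rw [entry_amplify, entry_amplify]
    by_contra hne
    have h1 := left_ne_zero_of_mul hne
    have h2 := right_ne_zero_of_mul hne
    rw [ne_eq, ite_eq_right_iff, Classical.not_imp] at h1 h2
    refine hγ (funext fun i => ?_)
    by_cases hif : i ∈ Set.range f
    · obtain ⟨k, rfl⟩ := hif
      rw [hf]
      exact h2.1 _ (by rintro ⟨j, hj⟩; exact hfg k j hj.symm)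
    · rw [hn i hif]; exact (h1.1 i hif).symm

theorem commute_amplify {f : κ ↪ ι} {g : κ' ↪ ι} (hfg : ∀ k k', f k ≠ g k')
    (A : TensorPow H κ →L[ℂ] TensorPow H κ) (B : TensorPow H κ' →L[ℂ] TensorPow H κ') :
    Commute (amplify f A) (amplify g B) := by
  classical
  refine ext_entry fun α β => ?_
  rw [entry_amplify_mul_amplify hfg, entry_amplify_mul_amplify fun k k' => (hfg k' k).symm,
    mul_comm]
  refine if_congr ⟨fun h i h1 h2 => h i h2 h1, fun h i h1 h2 => h i h2 h1⟩ rfl rfl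

end Entries

/-! ### Permutations of the factors -/

section Permutations
variable {H : Type*} [NormedAddCommGroup H] [InnerProductSpace ℂ H] [CompleteSpace H]
variable {ι κ : Type}

/-- `permute π` as a bounded operator. -/
def permuteOp (π : Equiv.Perm ι) : TensorPow H ι →L[ℂ] TensorPow H ι :=
  (permute π).toContinuousLinearMap

theorem permuteOp_basisVec (π : Equiv.Perm ι) (α : ι → basisIdx H) :
    permuteOp π (basisVec α) = basisVec (α ∘ π) :=
  isometryOfOrthonormal_basisVec (orthonormal_basisVec.comp (fun α => α ∘ π)
    fun _ _ h => π.surjective.injective_comp_right h) α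

theorem star_permuteOp_basisVec (π : Equiv.Perm ι) (α : ι → basisIdx H) :
    star (permuteOp π) (basisVec α) = basisVec (α ∘ π.symm) := by
  classical
  refine ext_inner_basisVec fun β => ?_
  rw [ContinuousLinearMap.star_eq_adjoint, ContinuousLinearMap.adjoint_inner_right,
    permuteOp_basisVec, inner_basisVec, inner_basisVec]
  refine if_congr ⟨fun h => ?_, fun h => ?_⟩ rfl rfl
  · rw [← h]; ext i; simp
  · rw [h]; ext i; simp

theorem permuteOp_mem_unitary (π : Equiv.Perm ι) :
    permuteOp π ∈ unitary (TensorPow H ι →L[ℂ] TensorPow H ι) := by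
  rw [Unitary.mem_iff]
  constructor <;> refine ext_basisVec fun β => ?_
  · rw [mul_apply_eq_comp, permuteOp_basisVec, star_permuteOp_basisVec]
    simp [Function.comp_assoc]
  · rw [mul_apply_eq_comp, star_permuteOp_basisVec, permuteOp_basisVec]
    simp [Function.comp_assoc]

theorem star_permuteOp (π : Equiv.Perm ι) :
    star (permuteOp π : TensorPow H ι →L[ℂ] TensorPow H ι) = permuteOp π.symm :=
  ext_basisVec fun β => by rw [star_permuteOp_basisVec, permuteOp_basisVec]

/-- `permuteOp π` as a unitary. -/
def permuteU (π : Equiv.Perm ι) : unitary (TensorPow H ι →L[ℂ] TensorPow H ι) :=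
  ⟨permuteOp π, permuteOp_mem_unitary π⟩

/-- The inverse appears because `permuteOp π` composes multi-indices with `π` on the right: what
stood at position `π i` is moved to position `i`. -/
theorem permuteOp_conj_amplify (π : Equiv.Perm ι) (f : κ ↪ ι)
    (A : TensorPow H κ →L[ℂ] TensorPow H κ) :
    permuteOp π * amplify f A * star (permuteOp π) = amplify (f.trans π.symm.toEmbedding) A := by
  classical
  refine ext_entry fun α β => ?_
  have h : entry (permuteOp π * amplify f A * star (permuteOp π)) α β =
      entry (amplify f A) (α ∘ π.symm) (β ∘ π.symm) := by
    rw [entry, mul_apply_eq_comp, mul_apply_eq_comp, star_permuteOp_basisVec,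
      ← ContinuousLinearMap.adjoint_inner_left, ← ContinuousLinearMap.star_eq_adjoint,
      star_permuteOp_basisVec]
    rfl
  rw [h, entry_amplify, entry_amplify]
  refine if_congr ⟨fun h i hi => ?_, fun h i hi => ?_⟩ rfl rfl
  · have := h (π i) fun ⟨k, hk⟩ => hi ⟨k, by simp [hk]⟩
    simpa using this
  · refine h (π.symm i) ?_
    rintro ⟨k, hk⟩
    exact hi ⟨k, π.symm.injective hk⟩

theorem star_permuteOp_conj_amplify (π : Equiv.Perm ι) (f : κ ↪ ι)
    (A : TensorPow H κ →L[ℂ] TensorPow H κ) :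
    star (permuteOp π) * amplify f A * permuteOp π = amplify (f.trans π.toEmbedding) A := by
  have h := permuteOp_conj_amplify π.symm f A
  rwa [star_permuteOp, Equiv.symm_symm, ← star_permuteOp] at h

theorem isPermSymmetric_iff {T : TensorPow H ι →L[ℂ] TensorPow H ι} :
    IsPermSymmetric T ↔ ∀ π, permuteOp π * T * star (permuteOp π) = T := by
  simp only [mul_assoc]
  exact Iff.rfl

end Permutations

/-! ### Partial traces on trace class operators -/

section PartialTrace
variable {H : Type*} [NormedAddCommGroup H] [InnerProductSpace ℂ H] [CompleteSpace H]
variable {ι κ κ' : Type}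

/-- `x ↦ x ⊗ Ψ_y` as a bounded operator. -/
def insertOp (f : κ ↪ ι) (y : {i // i ∉ Set.range f} → basisIdx H) :
    TensorPow H κ →L[ℂ] TensorPow H ι := (insertVec f y).toContinuousLinearMap

/-- The block `V_y* T V_y`, where `V_y x = x ⊗ Ψ_y`. -/
def block (f : κ ↪ ι) (y : {i // i ∉ Set.range f} → basisIdx H)
    (T : TensorPow H ι →L[ℂ] TensorPow H ι) : TensorPow H κ →L[ℂ] TensorPow H κ :=
  (insertOp f y).adjoint ∘L T ∘L insertOp f y

theorem partialTrace_eq (f : κ ↪ ι) (T : TensorPow H ι →L[ℂ] TensorPow H ι) :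
    partialTrace f T = ∑' y, block f y T := rfl

theorem inner_block (f : κ ↪ ι) (y : {i // i ∉ Set.range f} → basisIdx H)
    (T : TensorPow H ι →L[ℂ] TensorPow H ι) (u v : TensorPow H κ) :
    ⟪u, block f y T v⟫_ℂ = ⟪insertVec f y u, T (insertVec f y v)⟫_ℂ := by
  rw [block, ContinuousLinearMap.comp_apply, ContinuousLinearMap.adjoint_inner_right]
  rfl

theorem entry_block (f : κ ↪ ι) (y : {i // i ∉ Set.range f} → basisIdx H)
    (T : TensorPow H ι →L[ℂ] TensorPow H ι) (α β : κ → basisIdx H) :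
    entry (block f y T) α β = entry T (merge f y α) (merge f y β) := by
  rw [entry, inner_block, insertVec_basisVec, insertVec_basisVec, entry]

theorem orthonormal_insertVec (f : κ ↪ ι) {X : Type*}
    {e : X → ({i // i ∉ Set.range f} → basisIdx H) → TensorPow H κ}
    (he : ∀ y, Orthonormal ℂ fun x => e x y) :
    Orthonormal ℂ fun p : X × ({i // i ∉ Set.range f} → basisIdx H) =>
      insertVec f p.2 (e p.1 p.2) := by
  classical
  rw [orthonormal_iff_ite]
  rintro ⟨x, y⟩ ⟨x', y'⟩
  by_cases hy : y = y'
  · subst hy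
    simp only [LinearIsometry.inner_map_map, orthonormal_iff_ite.1 (he y) x x', Prod.mk.injEq,
      and_true]
  · rw [if_neg fun h => hy (Prod.mk.inj h).2]
    exact orthogonalFamily_insertVec f hy _ _

/-- The operator norm need not be attained; a vector reaching more than half of it is enough, whence
the factor `2`. -/
theorem exists_unit_inner {K : Type*} [NormedAddCommGroup K] [InnerProductSpace ℂ K]
    {S : K →L[ℂ] K} (hS : S ≠ 0) :
    ∃ u v : K, ‖u‖ = 1 ∧ ‖v‖ = 1 ∧ ‖S‖ ≤ 2 * ‖⟪u, S v⟫_ℂ‖ := by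
  have hpos : 0 < ‖S‖ := norm_pos_iff.2 hS
  obtain ⟨v, hv⟩ : ∃ v, ‖S‖ / 2 * ‖v‖ < ‖S v‖ := by
    by_contra! h
    have := S.opNorm_le_bound (by positivity) h
    linarith
  have hSv : S v ≠ 0 := fun h => by
    rw [h, norm_zero] at hv
    exact absurd hv (not_lt.2 (by positivity))
  have hv0 : v ≠ 0 := fun h => hSv (by rw [h, map_zero])
  have h1 := norm_pos_iff.2 hv0
  have h2 := norm_pos_iff.2 hSv
  refine ⟨(‖S v‖⁻¹ : ℂ) • S v, (‖v‖⁻¹ : ℂ) • v, norm_smul_inv_norm hSv, norm_smul_inv_norm hv0, ?_⟩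
  rw [map_smul, inner_smul_left, inner_smul_right, inner_self_eq_norm_sq_to_K, norm_mul, norm_mul]
  simp only [map_inv₀, Complex.conj_ofReal, norm_inv, Complex.norm_real, norm_norm, norm_pow,
    Complex.coe_algebraMap]
  have h3 : 2 * (‖S v‖⁻¹ * (‖v‖⁻¹ * ‖S v‖ ^ 2)) = 2 * ‖S v‖ / ‖v‖ := by
    field_simp
  rw [h3, le_div_iff₀ h1]
  linarith

/-- Choose for each block unit vectors `u_y`, `v_y` that nearly realize its norm. Vectors inserted
at different `y` are orthogonal, so the chosen ones form two orthonormal families in the large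
space, and the block norms add up to at most twice the trace norm. -/
theorem summable_block (f : κ ↪ ι) (T : TC (TensorPow H ι)) :
    Summable fun y => block f y (TC.op T) := by
  classical
  refine Summable.of_norm ?_
  refine summable_of_sum_le (c := 2 * ‖T‖) (fun _ => norm_nonneg _) fun s => ?_
  -- A vanishing block may have no unit vectors to choose from, so it is dropped first.
  let s' := s.filter fun y => block f y (TC.op T) ≠ 0
  have h1 : ∑ y ∈ s, ‖block f y (TC.op T)‖ = ∑ y ∈ s', ‖block f y (TC.op T)‖ := by
    refine (Finset.sum_filter_of_ne fun y _ hy => ?_).symm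
    simpa using hy
  have h2 : ∀ y : s', ∃ u v : TensorPow H κ, ‖u‖ = 1 ∧ ‖v‖ = 1 ∧
      ‖block f y (TC.op T)‖ ≤ 2 * ‖⟪u, block f y (TC.op T) v⟫_ℂ‖ := fun y =>
    exists_unit_inner (Finset.mem_filter.1 y.2).2
  choose u v hu hv huv using h2
  have hon : ∀ w : s' → TensorPow H κ, (∀ y, ‖w y‖ = 1) →
      Orthonormal ℂ fun y : s' => insertVec f y.1 (w y) := fun w hw => by
    refine ⟨fun y => by rw [LinearIsometry.norm_map, hw], fun y y' hy => ?_⟩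
    exact orthogonalFamily_insertVec f (fun h => hy (Subtype.ext h)) _ _
  rw [h1, ← Finset.sum_coe_sort s']
  calc ∑ y : s', ‖block f y (TC.op T)‖
      ≤ ∑ y : s', 2 * ‖⟪insertVec f y.1 (u y), TC.op T (insertVec f y.1 (v y))⟫_ℂ‖ := by
        refine Finset.sum_le_sum fun y _ => ?_
        rw [← inner_block]
        exact huv y
    _ ≤ _ := by
        rw [← Finset.mul_sum]
        gcongr
        exact T.sum_norm_inner_le (hon v hv) (hon u hu) Finset.univ

theorem hasSum_partialTrace (f : κ ↪ ι) (T : TC (TensorPow H ι)) :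
    HasSum (fun y => block f y (TC.op T)) (partialTrace f (TC.op T)) :=
  (summable_block f T).hasSum

theorem hasSum_inner_partialTrace (f : κ ↪ ι) (T : TC (TensorPow H ι)) (u v : TensorPow H κ) :
    HasSum (fun y => ⟪insertVec f y u, TC.op T (insertVec f y v)⟫_ℂ)
      ⟪u, partialTrace f (TC.op T) v⟫_ℂ := by
  have h := ((hasSum_partialTrace f T).mapL (ContinuousLinearMap.apply ℂ _ v)).mapL (innerSL ℂ u)
  simpa [inner_block] using h

/-- Tensoring an orthonormal family with all the `Ψ_y` gives an orthonormal family of the large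
space, so the double sum over `i` and `y` is one of those controlled by `traceNorm (TC.op T)`. -/
theorem traceNorm_partialTrace_le (f : κ ↪ ι) (T : TC (TensorPow H ι)) :
    traceNorm (partialTrace f (TC.op T)) ≤ traceNorm (TC.op T) := by
  refine traceNorm_le fun n e e' he he' => ?_
  calc ∑ i, ‖⟪e' i, partialTrace f (TC.op T) (e i)⟫_ℂ‖ₑ
      ≤ ∑ i, ∑' y, ‖⟪insertVec f y (e' i), TC.op T (insertVec f y (e i))⟫_ℂ‖ₑ := by
        refine Finset.sum_le_sum fun i _ => ?_
        rw [← (hasSum_inner_partialTrace f T _ _).tsum_eq]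
        exact enorm_tsum_le_tsum_enorm
    _ = ∑' p : Fin n × _, ‖⟪insertVec f p.2 (e' p.1), TC.op T (insertVec f p.2 (e p.1))⟫_ℂ‖ₑ := by
        rw [ENNReal.tsum_prod', tsum_fintype]
    _ ≤ _ := tsum_enorm_inner_le_traceNorm (orthonormal_insertVec f (e := fun x _ => e x)
        fun _ => he) (orthonormal_insertVec f (e := fun x _ => e' x) fun _ => he')

/-- The partial trace as a linear map on trace class operators. -/
def partialTraceLM (f : κ ↪ ι) : TC (TensorPow H ι) →ₗ[ℂ] (TensorPow H κ →L[ℂ] TensorPow H κ) where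
  toFun T := partialTrace f (TC.op T)
  map_add' S T := by
    have h := (hasSum_partialTrace f S).add (hasSum_partialTrace f T)
    rw [← h.tsum_eq, partialTrace_eq]
    refine tsum_congr fun y => ?_
    simp [block, ContinuousLinearMap.comp_add, ContinuousLinearMap.add_comp]
  map_smul' c T := by
    have h := (hasSum_partialTrace f T).const_smul c
    rw [RingHom.id_apply, ← h.tsum_eq, partialTrace_eq]
    refine tsum_congr fun y => ?_
    simp [block, ContinuousLinearMap.smul_comp]

/-- The partial trace on trace class operators. -/
def ptr (f : κ ↪ ι) : TC (TensorPow H ι) →L[ℂ] TC (TensorPow H κ) :=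
  TC.contraction (partialTraceLM f) (traceNorm_partialTrace_le f)

@[simp]
theorem op_ptr (f : κ ↪ ι) (T : TC (TensorPow H ι)) :
    TC.op (ptr f T) = partialTrace f (TC.op T) := rfl

theorem norm_ptr_apply_le (f : κ ↪ ι) (T : TC (TensorPow H ι)) : ‖ptr f T‖ ≤ ‖T‖ := by
  exact TC.norm_contraction_apply_le _ _ T

/-- The values on and off the range of `f` determine a multi-index. -/
def mergeEquiv (f : κ ↪ ι) :
    (κ → basisIdx H) × ({i // i ∉ Set.range f} → basisIdx H) ≃ (ι → basisIdx H) where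
  toFun p := merge f p.2 p.1
  invFun := fun α => (α ∘ f, fun i => α i)
  left_inv _ := Prod.ext (merge_comp f _ _) (funext fun i => merge_apply_not_mem f _ _ i)
  right_inv α := merge_restrict f α

/-- The partial trace is dual to `A ↦ A ⊗ 1`. -/
theorem tr_mulRight_ptr (f : κ ↪ ι) (T : TC (TensorPow H ι))
    (A : TensorPow H κ →L[ℂ] TensorPow H κ) :
    TC.tr (TC.mulRight A (ptr f T)) = TC.tr (TC.mulRight (amplify f A) T) := by
  have h1 := (TC.mulRight (amplify f A) T).hasSum_tr (tensorBasis H ι)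
  rw [← (mergeEquiv f).hasSum_iff] at h1
  have h2 := (TC.mulRight A (ptr f T)).hasSum_tr (tensorBasis H κ)
  refine h2.unique (h1.prod_fiberwise fun x => ?_)
  change HasSum _ ⟪basisVec x, partialTrace f (TC.op T) (A (basisVec x))⟫_ℂ
  convert hasSum_inner_partialTrace f T (basisVec x) (A (basisVec x)) using 2 with y
  change ⟪basisVec (merge f y x), TC.op T (amplify f A (basisVec (merge f y x)))⟫_ℂ = _
  rw [← insertVec_basisVec, amplify_insertVec]

theorem tr_ptr (f : κ ↪ ι) (T : TC (TensorPow H ι)) : TC.tr (ptr f T) = TC.tr T := by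
  have h := tr_mulRight_ptr f T 1
  rw [amplify_one] at h
  have h1 : ∀ (ι : Type) (S : TC (TensorPow H ι)), TC.mulRight 1 S = S := fun _ S =>
    TC.ext (by simp)
  rwa [h1, h1] at h

theorem isPositive_of_hasSum {K X : Type*} [NormedAddCommGroup K] [InnerProductSpace ℂ K]
    [CompleteSpace K] {S : X → K →L[ℂ] K} {T : K →L[ℂ] K} (h : HasSum S T)
    (hS : ∀ i, (S i).IsPositive) : T.IsPositive := by
  rw [← ContinuousLinearMap.nonneg_iff_isPositive]
  exact CStarAlgebra.isClosed_nonneg.mem_of_tendsto h <| Eventually.of_forall fun s =>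
    Finset.sum_nonneg fun i _ => (ContinuousLinearMap.nonneg_iff_isPositive _).2 (hS i)

theorem isPositive_ptr (f : κ ↪ ι) {T : TC (TensorPow H ι)} (hT : (TC.op T).IsPositive) :
    (TC.op (ptr f T)).IsPositive :=
  isPositive_of_hasSum (hasSum_partialTrace f T) fun y => hT.adjoint_conj (insertOp f y)

theorem ptr_ptr (f : κ ↪ κ') (g : κ' ↪ ι) (T : TC (TensorPow H ι)) :
    ptr f (ptr g T) = ptr (f.trans g) T :=
  TC.ext_tr fun A => by
    rw [tr_mulRight_ptr, tr_mulRight_ptr, tr_mulRight_ptr, amplify_amplify]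

/-- The reduced density matrices of a symmetric state do not depend on the choice of factors. -/
theorem ptr_trans_perm (f : κ ↪ ι) (π : Equiv.Perm ι) {T : TC (TensorPow H ι)}
    (hT : IsPermSymmetric (TC.op T)) : ptr (f.trans π.toEmbedding) T = ptr f T :=
  TC.ext_tr fun A => by
    rw [tr_mulRight_ptr, tr_mulRight_ptr]
    symm
    refine TC.tr_eq_of_conj (permuteU π) ?_
    have h1 : star (permuteOp π) * permuteOp π = (1 : TensorPow H ι →L[ℂ] TensorPow H ι) :=
      Unitary.star_mul_self_of_mem (permuteOp_mem_unitary π)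
    have h2 : permuteOp π * star (permuteOp π) = (1 : TensorPow H ι →L[ℂ] TensorPow H ι) :=
      Unitary.mul_star_self_of_mem (permuteOp_mem_unitary π)
    have h3 := isPermSymmetric_iff.1 hT π
    rw [TC.op_mulRight, TC.op_mulRight, ← star_permuteOp_conj_amplify]
    change _ = permuteOp π * (TC.op T * (star (permuteOp π) * amplify f A * permuteOp π)) *
      star (permuteOp π)
    calc TC.op T * amplify f A
        = (permuteOp π * TC.op T * star (permuteOp π)) * amplify f A := by rw [h3]
      _ = permuteOp π * TC.op T * star (permuteOp π) * amplify f A *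
          (permuteOp π * star (permuteOp π)) := by rw [h2, mul_one]
      _ = _ := by simp only [mul_assoc]

/-- The permutations of `Fin N` act transitively on the embeddings of `Fin k`, so any two choices of
`k` factors differ by a permutation, which the state does not notice. -/
theorem ptr_eq_of_isPermSymmetric {k N : ℕ} (f g : Fin k ↪ Fin N) {T : TC (TensorPow H (Fin N))}
    (hT : IsPermSymmetric (TC.op T)) : ptr f T = ptr g T := by
  have := Equiv.Perm.isMultiplyPretransitive (Fin N) k
  obtain ⟨π, hπ⟩ := MulAction.exists_smul_eq (Equiv.Perm (Fin N)) f g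
  rw [← hπ, ← ptr_trans_perm f π hT]
  rfl

end PartialTrace

/-! ### Identification of the one-particle space with the first tensor power -/

section OneParticle
variable {H : Type*} [NormedAddCommGroup H] [InnerProductSpace ℂ H] [CompleteSpace H]

/-- `oneParticle` as a bounded operator. -/
def oneParticleOp (H : Type*) [NormedAddCommGroup H] [InnerProductSpace ℂ H] [CompleteSpace H] :
    H →L[ℂ] TensorPow H (Fin 1) := (oneParticle (H := H)).toContinuousLinearMap

theorem oneParticle_basis (j : basisIdx H) : oneParticle (basis H j) = basisVec fun _ => j := by
  classical
  change isometryOfOrthonormal (orthonormal_basisVec.comp (fun (j : basisIdx H) (_ : Fin 1) => j)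
    fun _ _ h => congrFun h 0) ((basis H).repr (basis H j)) = _
  rw [HilbertBasis.repr_self, isometryOfOrthonormal, OrthogonalFamily.linearIsometry_apply_single]
  simp [LinearIsometry.toSpanSingleton_apply]

theorem adjoint_oneParticle_apply (x : H) : (oneParticleOp H).adjoint (oneParticle x) = x :=
  congrArg (fun T : H →L[ℂ] H => T x) (oneParticle (H := H)).adjoint_comp_self

theorem adjoint_oneParticle_basisVec (α : Fin 1 → basisIdx H) :
    (oneParticleOp H).adjoint (basisVec α) = basis H (α 0) := by
  rw [← adjoint_oneParticle_apply (basis H (α 0)), oneParticle_basis]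
  congr 2
  ext i; rw [Subsingleton.elim i 0]

theorem oneParticle_comp_adjoint : oneParticleOp H ∘L (oneParticleOp H).adjoint = 1 :=
  ext_basisVec fun β => by
    rw [ContinuousLinearMap.comp_apply, adjoint_oneParticle_basisVec]
    change oneParticle _ = _
    rw [oneParticle_basis]
    change _ = basisVec β
    congr 1
    ext i; rw [Subsingleton.elim i 0]

theorem liftOp_lowerOp (T : TensorPow H (Fin 1) →L[ℂ] TensorPow H (Fin 1)) :
    liftOp (lowerOp T) = T := by
  change oneParticleOp H ∘L ((oneParticleOp H).adjoint ∘L T ∘L oneParticleOp H) ∘L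
    (oneParticleOp H).adjoint = T
  rw [ContinuousLinearMap.comp_assoc, ContinuousLinearMap.comp_assoc, oneParticle_comp_adjoint,
    ← ContinuousLinearMap.comp_assoc, oneParticle_comp_adjoint]
  rfl

theorem lowerOp_liftOp (A : H →L[ℂ] H) : lowerOp (liftOp A) = A := by
  ext x
  change (oneParticleOp H).adjoint (oneParticle (A ((oneParticleOp H).adjoint (oneParticle x)))) = _
  rw [adjoint_oneParticle_apply, adjoint_oneParticle_apply]

theorem traceNorm_lowerOp_le (T : TensorPow H (Fin 1) →L[ℂ] TensorPow H (Fin 1)) :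
    traceNorm (lowerOp T) ≤ traceNorm T :=
  traceNorm_conj_le oneParticle oneParticle

/-- `oneParticle` is onto, so its adjoint is an isometry too, and lifting is compression by that
isometry. -/
theorem traceNorm_liftOp_le (A : H →L[ℂ] H) : traceNorm (liftOp A) ≤ traceNorm A := by
  have hn : ∀ x, ‖(oneParticleOp H).adjoint x‖ = ‖x‖ := fun x => by
    have h : oneParticle ((oneParticleOp H).adjoint x) = x :=
      congrArg (fun T : TensorPow H (Fin 1) →L[ℂ] _ => T x) oneParticle_comp_adjoint
    rw [← (oneParticle (H := H)).norm_map, h]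
  let J : TensorPow H (Fin 1) →ₗᵢ[ℂ] H := ⟨(oneParticleOp H).adjoint, hn⟩
  have h := traceNorm_conj_le (T := A) J J
  have hJ : J.toContinuousLinearMap = (oneParticleOp H).adjoint := by ext; rfl
  rwa [hJ, ContinuousLinearMap.adjoint_adjoint] at h

/-- `lowerOp` as a linear map. -/
def lowerLM : (TensorPow H (Fin 1) →L[ℂ] TensorPow H (Fin 1)) →ₗ[ℂ] (H →L[ℂ] H) where
  toFun := lowerOp
  map_add' S T := by simp [lowerOp, ContinuousLinearMap.comp_add, ContinuousLinearMap.add_comp]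
  map_smul' c T := by simp [lowerOp, ContinuousLinearMap.smul_comp]

/-- `liftOp` as a linear map. -/
def liftLM : (H →L[ℂ] H) →ₗ[ℂ] (TensorPow H (Fin 1) →L[ℂ] TensorPow H (Fin 1)) where
  toFun := liftOp
  map_add' S T := by simp [liftOp, ContinuousLinearMap.comp_add, ContinuousLinearMap.add_comp]
  map_smul' c T := by simp [liftOp, ContinuousLinearMap.smul_comp]

/-- Conjugation by `oneParticle` on trace class operators. -/
def lower : TC (TensorPow H (Fin 1)) →L[ℂ] TC H :=
  TC.contraction (lowerLM.comp TC.op) fun T => traceNorm_lowerOp_le (TC.op T)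

/-- The inverse of `lower`. -/
def raise : TC H →L[ℂ] TC (TensorPow H (Fin 1)) :=
  TC.contraction (liftLM.comp TC.op) fun T => traceNorm_liftOp_le (TC.op T)

@[simp]
theorem op_lower (T : TC (TensorPow H (Fin 1))) : TC.op (lower T) = lowerOp (TC.op T) := rfl

@[simp]
theorem op_raise (T : TC H) : TC.op (raise T) = liftOp (TC.op T) := rfl

theorem lower_raise (T : TC H) : lower (raise T) = T := TC.ext (lowerOp_liftOp _)

end OneParticle

/-! ### Tracing out the last factor -/

section LastFactor
variable {H : Type*} [NormedAddCommGroup H] [InnerProductSpace ℂ H] [CompleteSpace H]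

/-- The embedding with the single value `i`. -/
def pointEmb {ι : Type} (i : ι) : Fin 1 ↪ ι :=
  ⟨fun _ : Fin 1 => i, fun _ _ _ => Subsingleton.elim _ _⟩

theorem atFactor_eq {ι : Type} (i : ι) (A : H →L[ℂ] H) :
    atFactor i A = amplify (pointEmb i) (liftOp A) := rfl

theorem atFactor_lowerOp {ι : Type} (i : ι) (T : TensorPow H (Fin 1) →L[ℂ] TensorPow H (Fin 1)) :
    atFactor i (lowerOp T) = amplify (pointEmb i) T := by
  rw [atFactor_eq, liftOp_lowerOp]

theorem amplify_atFactor {ι κ : Type} (f : κ ↪ ι) (i : κ) (A : H →L[ℂ] H) :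
    amplify f (atFactor i A) = atFactor (f i) A :=
  amplify_amplify _ _ _

theorem commute_atFactor {ι : Type} {i j : ι} (hij : i ≠ j) (A B : H →L[ℂ] H) :
    Commute (atFactor i A) (atFactor j B) :=
  commute_amplify (fun _ _ => hij) _ _

theorem not_mem_range_castAddEmb {k : ℕ} (i : Fin (k + 1)) :
    i ∉ Set.range (Fin.castAddEmb 1 : Fin k ↪ Fin (k + 1)) ↔ i = Fin.last k := by
  refine ⟨fun h => ?_, ?_⟩
  · induction i using Fin.lastCases with
    | last => rfl
    | cast j => exact absurd ⟨j, rfl⟩ h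
  · rintro rfl ⟨j, hj⟩
    exact (Fin.castSucc_lt_last j).ne hj

/-- The block of an operator at the basis vector `j` of the last factor. -/
def lastBlock {k : ℕ} (j : basisIdx H)
    (T : TensorPow H (Fin (k + 1)) →L[ℂ] TensorPow H (Fin (k + 1))) :
    TensorPow H (Fin k) →L[ℂ] TensorPow H (Fin k) :=
  block (Fin.castAddEmb 1) (fun _ => j) T

theorem tsum_lastBlock {k : ℕ} (T : TensorPow H (Fin (k + 1)) →L[ℂ] TensorPow H (Fin (k + 1))) :
    partialTrace (Fin.castAddEmb 1 : Fin k ↪ Fin (k + 1)) T = ∑' j, lastBlock j T := by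
  let u : Unique {i // i ∉ Set.range (Fin.castAddEmb 1 : Fin k ↪ Fin (k + 1))} :=
    { default := ⟨Fin.last k, (not_mem_range_castAddEmb _).2 rfl⟩
      uniq := fun i => Subtype.ext ((not_mem_range_castAddEmb _).1 i.2) }
  rw [partialTrace_eq]
  exact ((Equiv.funUnique _ (basisIdx H)).symm.tsum_eq fun y => block _ y T).symm

theorem hasSum_lastBlock {k : ℕ} (T : TC (TensorPow H (Fin (k + 1)))) :
    HasSum (fun j => lastBlock j (TC.op T))
      (partialTrace (Fin.castAddEmb 1 : Fin k ↪ Fin (k + 1)) (TC.op T)) := by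
  rw [tsum_lastBlock]
  refine Summable.hasSum ?_
  exact (summable_block (Fin.castAddEmb 1) T).comp_injective
    (i := fun (j : basisIdx H) (_ : {i // i ∉ Set.range (Fin.castAddEmb 1)}) => j)
    fun j j' h => congrFun h ⟨Fin.last k, (not_mem_range_castAddEmb _).2 rfl⟩

theorem merge_castSucc {k : ℕ} (j : basisIdx H) (α : Fin k → basisIdx H) (i : Fin k) :
    merge (Fin.castAddEmb 1 : Fin k ↪ Fin (k + 1)) (fun _ => j) α i.castSucc = α i :=
  merge_apply_mem (Fin.castAddEmb 1 : Fin k ↪ Fin (k + 1)) _ _ i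

theorem merge_last {k : ℕ} (j : basisIdx H) (α : Fin k → basisIdx H) :
    merge (Fin.castAddEmb 1 : Fin k ↪ Fin (k + 1)) (fun _ => j) α (Fin.last k) = j :=
  merge_apply_not_mem (Fin.castAddEmb 1 : Fin k ↪ Fin (k + 1)) _ _
    ⟨Fin.last k, (not_mem_range_castAddEmb _).2 rfl⟩

/-- The pair consisting of `i` and the last index. -/
def lastPair {k : ℕ} (i : Fin k) : Fin 2 ↪ Fin (k + 1) :=
  pairEmb i.castSucc (Fin.last k) (Fin.castSucc_lt_last i)

/-- A multi-index that ends in `j`, restricted to the pair formed by `i` and the last position, is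
the value at `i` followed by `j`; so taking the block sees the pair operator only through its own
last block, acting in slot `i`. -/
theorem lastBlock_amplify_lastPair {k : ℕ} (i : Fin k) (j : basisIdx H)
    (Y : TensorPow H (Fin 2) →L[ℂ] TensorPow H (Fin 2)) :
    lastBlock j (amplify (lastPair i) Y) = amplify (pointEmb i) (lastBlock (k := 1) j Y) := by
  classical
  refine ext_entry fun α β => ?_
  have h : ∀ α : Fin k → basisIdx H,
      merge (Fin.castAddEmb 1 : Fin k ↪ Fin (k + 1)) (fun _ => j) α ∘ lastPair i =
      merge (Fin.castAddEmb 1 : Fin 1 ↪ Fin 2) (fun _ => j) (α ∘ pointEmb i) := fun α => by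
    ext1 a
    refine Fin.lastCases ?_ (fun b => ?_) a
    · rw [merge_last]
      exact merge_last j α
    · rw [merge_castSucc, Subsingleton.elim b 0]
      exact merge_castSucc j α i
  rw [lastBlock, entry_block, entry_amplify, entry_amplify, lastBlock, entry_block, h, h]
  refine @if_congr _ _ _ (_) (_) _ _ _ _ ⟨fun h1 a ha => ?_, fun h1 a ha => ?_⟩ rfl rfl
  · have := h1 a.castSucc ?_
    · rwa [merge_castSucc, merge_castSucc] at this
    · rintro ⟨b, hb⟩
      induction b using Fin.lastCases with
      | last => exact (Fin.castSucc_lt_last a).ne hb.symm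
      | cast b =>
        rw [Subsingleton.elim b 0] at hb
        exact ha ⟨0, Fin.castSucc_injective _ hb⟩
  · induction a using Fin.lastCases with
    | last => rw [merge_last, merge_last]
    | cast a =>
      rw [merge_castSucc, merge_castSucc]
      refine h1 a ?_
      rintro ⟨b, rfl⟩
      exact ha ⟨0, rfl⟩

theorem lastBlock_amplify_mul {k : ℕ} (j : basisIdx H)
    (R : TensorPow H (Fin k) →L[ℂ] TensorPow H (Fin k))
    (T : TensorPow H (Fin (k + 1)) →L[ℂ] TensorPow H (Fin (k + 1))) :
    lastBlock j (amplify (Fin.castAddEmb 1) R * T) = R * lastBlock j T := by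
  refine ContinuousLinearMap.ext fun x => ext_inner_left ℂ fun u => ?_
  rw [lastBlock, inner_block, mul_apply_eq_comp, ← ContinuousLinearMap.adjoint_inner_left,
    adjoint_amplify, amplify_insertVec, mul_apply_eq_comp,
    ← ContinuousLinearMap.adjoint_inner_left R, lastBlock, inner_block]

/-- The partial trace over the last factor of an operator that acts on it and on the `i`-th factor
by a trace class operator. -/
theorem partialTrace_amplify_mul_lastPair {k : ℕ} (i : Fin k)
    (R : TensorPow H (Fin k) →L[ℂ] TensorPow H (Fin k)) (Y : TC (TensorPow H (Fin 2))) :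
    partialTrace (Fin.castAddEmb 1)
        (amplify (Fin.castAddEmb 1) R * amplify (lastPair i) (TC.op Y)) =
      R * amplify (pointEmb i)
        (partialTrace (Fin.castAddEmb 1 : Fin 1 ↪ Fin (1 + 1)) (TC.op Y)) := by
  rw [tsum_lastBlock]
  have h := ((hasSum_lastBlock (k := 1) Y).mapL (amplifyL (pointEmb i))).mul_left R
  rw [amplifyL_apply] at h
  rw [← h.tsum_eq]
  refine tsum_congr fun j => ?_
  rw [lastBlock_amplify_mul, lastBlock_amplify_lastPair]
  rfl

end LastFactor

/-! ### Tensor products of trace class operators -/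

section TensorProduct
variable {H : Type*} [NormedAddCommGroup H] [InnerProductSpace ℂ H] [CompleteSpace H]
variable {ι κ κ' : Type}

/-- With `R`, `S` the square roots of `X`, `Y`, the product is `(R ⊗ S)* (R ⊗ S)`, hence positive,
and its trace norm is its trace. In the product basis this trace factorizes; `hcov` makes a
multi-index recoverable from its two restrictions. -/
theorem traceNorm_amplify_mul_amplify_le_of_isPositive {f : κ ↪ ι} {g : κ' ↪ ι}
    (hfg : ∀ k k', f k ≠ g k') (hcov : ∀ i, i ∈ Set.range f ∨ i ∈ Set.range g)
    {X : TensorPow H κ →L[ℂ] TensorPow H κ} {Y : TensorPow H κ' →L[ℂ] TensorPow H κ'}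
    (hX : X.IsPositive) (hY : Y.IsPositive) :
    traceNorm (amplify f X * amplify g Y) ≤ traceNorm X * traceNorm Y := by
  have hpos : (amplify f X * amplify g Y).IsPositive := by
    obtain ⟨R, hR, rfl⟩ := exists_sqrt hX
    obtain ⟨S, hS, rfl⟩ := exists_sqrt hY
    have h1 : amplify f (R * R) * amplify g (S * S) =
        star (amplify f R * amplify g S) * (amplify f R * amplify g S) := by
      rw [star_mul, ← amplify_star, ← amplify_star, hR.star_eq, hS.star_eq, amplify_mul,
        amplify_mul, ((commute_amplify hfg R S).eq).symm]
      simp only [mul_assoc]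
      rw [← mul_assoc (amplify g S), ((commute_amplify hfg R S).eq).symm]
      simp only [mul_assoc]
    rw [h1]
    exact ContinuousLinearMap.isPositive_adjoint_comp_self _
  rw [traceNorm_eq_tsum hpos (tensorBasis H ι), traceNorm_eq_tsum hX (tensorBasis H κ),
    traceNorm_eq_tsum hY (tensorBasis H κ'), ← ENNReal.tsum_mul_right]
  simp_rw [← ENNReal.tsum_mul_left]
  rw [← ENNReal.tsum_prod (f := fun a b => ‖⟪tensorBasis H κ a, X (tensorBasis H κ a)⟫_ℂ‖ₑ *
    ‖⟪tensorBasis H κ' b, Y (tensorBasis H κ' b)⟫_ℂ‖ₑ)]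
  have hinj : Function.Injective
      fun α : ι → basisIdx H => ((α ∘ f, α ∘ g) : (κ → basisIdx H) × (κ' → basisIdx H)) := by
    intro α β h
    ext1 i
    rcases hcov i with ⟨k, rfl⟩ | ⟨k, rfl⟩
    · exact congrFun (Prod.mk.inj h).1 k
    · exact congrFun (Prod.mk.inj h).2 k
  refine le_trans (le_of_eq (tsum_congr fun α => ?_))
    (ENNReal.tsum_comp_le_tsum_of_injective hinj _)
  have h2 := entry_amplify_mul_amplify hfg X Y α α
  rw [if_pos fun _ _ _ => rfl] at h2
  rw [tensorBasis_apply, ← enorm_mul]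
  exact congrArg enorm h2

/-- The constant counts `4 · 4` pairs of positive pieces, each with trace norms at most `3` times
the original ones. It is far from optimal and affects only the length of the time step. -/
theorem traceNorm_amplify_mul_amplify_le {f : κ ↪ ι} {g : κ' ↪ ι}
    (hfg : ∀ k k', f k ≠ g k') (hcov : ∀ i, i ∈ Set.range f ∨ i ∈ Set.range g)
    (X : TensorPow H κ →L[ℂ] TensorPow H κ) (Y : TensorPow H κ' →L[ℂ] TensorPow H κ') :
    traceNorm (amplify f X * amplify g Y) ≤ 144 * traceNorm X * traceNorm Y := by
  obtain ⟨P, c, hP, hc, hPn, hX⟩ := exists_sum_positive X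
  obtain ⟨Q, d, hQ, hd, hQn, hY⟩ := exists_sum_positive Y
  have h1 : amplify f X * amplify g Y =
      ∑ i, ∑ j, (c i * d j) • (amplify f (P i) * amplify g (Q j)) := by
    rw [← amplifyL_apply, ← amplifyL_apply]
    conv_lhs => rw [hX, hY]
    simp only [map_sum, map_smul, amplifyL_apply, Finset.sum_mul_sum, smul_mul_smul_comm]
  have h2 : ∀ i j, traceNorm ((c i * d j) • (amplify f (P i) * amplify g (Q j))) ≤
      9 * traceNorm X * traceNorm Y := fun i j => by
    rw [traceNorm_smul, ← ofReal_norm, norm_mul, hc, hd, mul_one, ENNReal.ofReal_one, one_mul]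
    refine (traceNorm_amplify_mul_amplify_le_of_isPositive hfg hcov (hP i) (hQ j)).trans ?_
    calc _ ≤ (3 * traceNorm X) * (3 * traceNorm Y) := mul_le_mul' (hPn i) (hQn j)
      _ = _ := by ring
  rw [h1]
  refine (traceNorm_sum_le _ _).trans ((Finset.sum_le_sum fun i _ => (traceNorm_sum_le _ _).trans
    (Finset.sum_le_sum fun j _ => h2 i j)).trans ?_)
  simp only [Finset.sum_const, Finset.card_univ, Fintype.card_fin, nsmul_eq_mul]
  refine le_of_eq ?_
  push_cast
  ring

/-- The tensor product of trace class operators on complementary factors. -/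
def tensorTC (f : κ ↪ ι) (g : κ' ↪ ι) (hfg : ∀ k k', f k ≠ g k')
    (hcov : ∀ i, i ∈ Set.range f ∨ i ∈ Set.range g) :
    TC (TensorPow H κ) →L[ℂ] TC (TensorPow H κ') →L[ℂ] TC (TensorPow H ι) :=
  have hle : ∀ (X : TC (TensorPow H κ)) (Y : TC (TensorPow H κ')),
      traceNorm (amplify f (TC.op X) * amplify g (TC.op Y)) ≤
        ENNReal.ofReal (144 * ‖X‖ * ‖Y‖) := fun X Y => by
    rw [ENNReal.ofReal_mul (by positivity), ENNReal.ofReal_mul (by positivity), TC.ofReal_norm,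
      TC.ofReal_norm, ENNReal.ofReal_ofNat]
    exact traceNorm_amplify_mul_amplify_le hfg hcov _ _
  LinearMap.mkContinuous₂
    (LinearMap.mk₂ ℂ
      (fun X Y => TC.mk (amplify f (TC.op X) * amplify g (TC.op Y))
        (ne_top_of_le_ne_top ENNReal.ofReal_ne_top (hle X Y)))
      (fun X X' Y => TC.ext (by simp [← amplifyL_apply, add_mul]))
      (fun c X Y => TC.ext (by simp [← amplifyL_apply]))
      (fun X Y Y' => TC.ext (by simp [← amplifyL_apply, mul_add]))
      (fun c X Y => TC.ext (by simp [← amplifyL_apply]))) 144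
    fun X Y => (TC.norm_le_iff (by positivity)).2 (hle X Y)

theorem op_tensorTC (f : κ ↪ ι) (g : κ' ↪ ι) (hfg : ∀ k k', f k ≠ g k')
    (hcov : ∀ i, i ∈ Set.range f ∨ i ∈ Set.range g) (X : TC (TensorPow H κ))
    (Y : TC (TensorPow H κ')) :
    TC.op (tensorTC f g hfg hcov X Y) = amplify f (TC.op X) * amplify g (TC.op Y) := rfl

theorem norm_tensorTC_apply_le (f : κ ↪ ι) (g : κ' ↪ ι) (hfg : ∀ k k', f k ≠ g k')
    (hcov : ∀ i, i ∈ Set.range f ∨ i ∈ Set.range g) (X : TC (TensorPow H κ))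
    (Y : TC (TensorPow H κ')) : ‖tensorTC f g hfg hcov X Y‖ ≤ 144 * ‖X‖ * ‖Y‖ := by
  rw [TC.norm_le_iff (by positivity), op_tensorTC, ENNReal.ofReal_mul (by positivity),
    ENNReal.ofReal_mul (by positivity), TC.ofReal_norm, TC.ofReal_norm, ENNReal.ofReal_ofNat]
  exact traceNorm_amplify_mul_amplify_le hfg hcov _ _

end TensorProduct

/-! ### Tensor powers -/

section TensorPowers
variable {H : Type*} [NormedAddCommGroup H] [InnerProductSpace ℂ H] [CompleteSpace H]

theorem castAddEmb_ne_last {k : ℕ} (i : Fin k) (j : Fin 1) :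
    (Fin.castAddEmb 1 : Fin k ↪ Fin (k + 1)) i ≠ pointEmb (Fin.last k) j :=
  (Fin.castSucc_lt_last i).ne

theorem mem_range_castAddEmb_or {k : ℕ} (i : Fin (k + 1)) :
    i ∈ Set.range (Fin.castAddEmb 1 : Fin k ↪ Fin (k + 1)) ∨
      i ∈ Set.range (pointEmb (Fin.last k)) := by
  by_cases h : i ∈ Set.range (Fin.castAddEmb 1 : Fin k ↪ Fin (k + 1))
  · exact Or.inl h
  · exact Or.inr ⟨0, ((not_mem_range_castAddEmb i).1 h).symm⟩

/-- `X ⊗ A`, with `X` acting on the first `k` factors and `A` on the last one. -/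
def snocTC (k : ℕ) : TC (TensorPow H (Fin k)) →L[ℂ] TC H →L[ℂ] TC (TensorPow H (Fin (k + 1))) :=
  (tensorTC (Fin.castAddEmb 1) (pointEmb (Fin.last k)) castAddEmb_ne_last
    mem_range_castAddEmb_or).bilinearComp (ContinuousLinearMap.id ℂ _) raise

theorem op_snocTC (k : ℕ) (X : TC (TensorPow H (Fin k))) (A : TC H) :
    TC.op (snocTC k X A) = amplify (Fin.castAddEmb 1) (TC.op X) * atFactor (Fin.last k) (TC.op A) :=
  rfl

theorem norm_raise_apply_le (A : TC H) : ‖raise A‖ ≤ ‖A‖ := TC.norm_contraction_apply_le _ _ A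

theorem norm_lower_apply_le (T : TC (TensorPow H (Fin 1))) : ‖lower T‖ ≤ ‖T‖ :=
  TC.norm_contraction_apply_le _ _ T

theorem norm_snocTC_apply_le (k : ℕ) (X : TC (TensorPow H (Fin k))) (A : TC H) :
    ‖snocTC k X A‖ ≤ 144 * ‖X‖ * ‖A‖ := by
  refine (norm_tensorTC_apply_le _ _ castAddEmb_ne_last mem_range_castAddEmb_or X
    (raise A)).trans ?_
  gcongr
  exact norm_raise_apply_le A

theorem tensorPowOp_succ (k : ℕ) (A : H →L[ℂ] H) :
    tensorPowOp (k + 1) A =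
      amplify (Fin.castAddEmb 1) (tensorPowOp k A) * atFactor (Fin.last k) A := by
  rw [tensorPowOp, List.ofFn_succ_last, List.prod_append, List.prod_singleton, tensorPowOp]
  congr 1
  change _ = amplifyHom (Fin.castAddEmb 1) (List.ofFn fun i => atFactor i A).prod
  rw [map_list_prod, List.map_ofFn]
  congr 2
  ext1 i
  exact (amplify_atFactor (Fin.castAddEmb 1) i A).symm

theorem traceNorm_one_fin_zero :
    traceNorm (1 : TensorPow H (Fin 0) →L[ℂ] TensorPow H (Fin 0)) = 1 := by
  rw [traceNorm_eq_tsum ContinuousLinearMap.isPositive_one (tensorBasis H (Fin 0)),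
    tsum_eq_single default fun a ha => absurd (Subsingleton.elim a default) ha]
  have h : ‖tensorBasis H (Fin 0) default‖ = 1 := (tensorBasis H (Fin 0)).orthonormal.1 _
  rw [one_apply_eq_self, inner_self_eq_norm_sq_to_K, h]
  simp

/-- The tensor powers of a trace class operator. -/
def powTC (A : TC H) : ∀ k : ℕ, TC (TensorPow H (Fin k))
  | 0 => TC.mk 1 (by rw [traceNorm_one_fin_zero]; exact ENNReal.one_ne_top)
  | k + 1 => snocTC k (powTC A k) A

theorem op_powTC (A : TC H) (k : ℕ) : TC.op (powTC A k) = tensorPowOp k (TC.op A) := by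
  induction k with
  | zero => rfl
  | succ k ih => rw [powTC, op_snocTC, ih, tensorPowOp_succ]

theorem norm_powTC_le (A : TC H) (k : ℕ) : ‖powTC A k‖ ≤ (144 * ‖A‖) ^ k := by
  induction k with
  | zero =>
    rw [TC.norm_def, powTC, TC.op_mk, traceNorm_one_fin_zero]
    simp
  | succ k ih =>
    refine (norm_snocTC_apply_le k _ A).trans ?_
    rw [pow_succ]
    calc 144 * ‖powTC A k‖ * ‖A‖ = ‖powTC A k‖ * (144 * ‖A‖) := by ring
      _ ≤ _ := by gcongr

end TensorPowers

/-! ### Exponentials of bounded generators -/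

section Exponential
variable {E F : Type*} [NormedAddCommGroup E] [NormedSpace ℂ E] [CompleteSpace E]
  [NormedAddCommGroup F] [NormedSpace ℂ F] [CompleteSpace F]

theorem hasSum_exp_apply (L : E →L[ℂ] E) (x : E) :
    HasSum (fun n : ℕ => ((n.factorial : ℂ)⁻¹) • (L ^ n) x) (NormedSpace.exp L x) :=
  (NormedSpace.exp_series_hasSum_exp' (𝕂 := ℂ) L).mapL (ContinuousLinearMap.apply ℂ E x)

/-- Bounded maps that intertwine two generators intertwine the exponentials. -/
theorem exp_intertwine (Φ : E →L[ℂ] F) {L : E →L[ℂ] E} {M : F →L[ℂ] F}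
    (h : ∀ x, Φ (L x) = M (Φ x)) (x : E) : Φ (NormedSpace.exp L x) = NormedSpace.exp M (Φ x) := by
  have hn : ∀ (n : ℕ) (x : E), Φ ((L ^ n) x) = (M ^ n) (Φ x) := by
    intro n
    induction n with
    | zero => intro x; simp
    | succ n ih => intro x; rw [pow_succ, pow_succ, mul_apply_eq_comp, mul_apply_eq_comp, ih, h]
  refine ((hasSum_exp_apply L x).mapL Φ).unique ?_
  simp only [map_smul, hn]
  exact hasSum_exp_apply M (Φ x)

theorem exp_add_of_commuting {L M : E →L[ℂ] E} (h : Commute L M) :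
    NormedSpace.exp (L + M) = NormedSpace.exp L * NormedSpace.exp M := by
  let _ : NormedAlgebra ℚ (E →L[ℂ] E) := NormedAlgebra.restrictScalars ℚ ℂ _
  exact NormedSpace.exp_add_of_commute h

theorem exp_smul_one_apply (c : ℂ) (x : E) :
    NormedSpace.exp (c • (1 : E →L[ℂ] E)) x = Complex.exp c • x := by
  refine (hasSum_exp_apply _ x).unique ?_
  have h := (NormedSpace.exp_series_hasSum_exp' (𝕂 := ℂ) c).smul_const x
  rw [← Complex.exp_eq_exp_ℂ] at h
  simpa [smul_pow, smul_smul] using h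

theorem smul_pow_apply (c : ℂ) (L : E →L[ℂ] E) (n : ℕ) (x : E) :
    ((c • L) ^ n) x = c ^ n • (L ^ n) x := by
  rw [smul_pow, smul_apply]

theorem pow_zero_apply (L : E →L[ℂ] E) (x : E) : (L ^ 0) x = x := by
  rw [pow_zero]; rfl

theorem pow_succ_apply (L : E →L[ℂ] E) (n : ℕ) (x : E) : (L ^ (n + 1)) x = L ((L ^ n) x) := by
  rw [pow_succ']; rfl

/-- Separates the scalar loss term from the gain: what remains is a power series in `L`, with
nonnegative coefficients when `c ≥ 0`, which is how positivity of the semigroup is seen. -/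
theorem exp_smul_sub_one_apply (c : ℂ) (L : E →L[ℂ] E) (x : E) :
    NormedSpace.exp (c • (L - 1)) x = Complex.exp (-c) • NormedSpace.exp (c • L) x := by
  have h1 : c • (L - 1) = (-c) • (1 : E →L[ℂ] E) + c • L := by
    rw [smul_sub, neg_smul]; abel
  rw [h1, exp_add_of_commuting (((Commute.one_left L).smul_left _).smul_right _), mul_apply_eq_comp,
    exp_smul_one_apply]

theorem hasDerivAt_exp_apply (L : E →L[ℂ] E) (x : E) (t : ℝ) :
    HasDerivAt (fun s : ℝ => NormedSpace.exp ((s : ℂ) • L) x)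
      (L (NormedSpace.exp ((t : ℂ) • L) x)) t := by
  have h := (hasDerivAt_exp_smul_const' (𝕂 := ℂ) L (t : ℂ)).scomp t Complex.ofRealCLM.hasDerivAt
  rw [Complex.ofRealCLM_apply, Complex.ofReal_one, one_smul] at h
  exact ((ContinuousLinearMap.apply ℂ E x).restrictScalars ℝ).hasFDerivAt.comp_hasDerivAt t h

theorem exp_add_smul_apply (L : E →L[ℂ] E) (s t : ℂ) (x : E) :
    NormedSpace.exp ((s + t) • L) x =
      NormedSpace.exp (s • L) (NormedSpace.exp (t • L) x) := by
  rw [add_smul, exp_add_of_commuting (((Commute.refl L).smul_left s).smul_right t)]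
  rfl

end Exponential

/-! ### Separability of finite tensor powers -/

section Separable
variable {H : Type*} [NormedAddCommGroup H] [InnerProductSpace ℂ H] [CompleteSpace H]

instance separableSpace_tensorPow [TopologicalSpace.SeparableSpace H] {ι : Type} [Finite ι] :
    TopologicalSpace.SeparableSpace (TensorPow H ι) := by
  have : Countable (basisIdx H) := countable_of_orthonormal (basis H).orthonormal
  have h1 : TopologicalSpace.IsSeparable (Set.range (tensorBasis H ι)) :=
    (Set.countable_range _).isSeparable
  have h2 := (h1.span (R := ℂ)).closure
  rw [← Submodule.topologicalClosure_coe, (tensorBasis H ι).dense_span, Submodule.top_coe] at h2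
  exact TopologicalSpace.isSeparable_univ_iff.1 h2

end Separable

/-! ### Averages under multiplication and conjugation -/

section AverageAlgebra
variable {C K : Type*} [MetricSpace C] [CompactSpace C] [MeasurableSpace C] [BorelSpace C]
  [NormedAddCommGroup K] [InnerProductSpace ℂ K] [CompleteSpace K]
  {W : C → K →L[ℂ] K} (hW : IsContractiveFamily W) (ν : Measure C) [IsProbabilityMeasure ν]

theorem average_mul_left {R : K →L[ℂ] K} (hR : ∀ σ, Commute R (W σ)) (A : K →L[ℂ] K) :
    average hW ν (R * A) = R * average hW ν A := by
  ext x
  rw [mul_apply_eq_comp, average_apply, average_apply,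
    ← R.integral_comp_comm (hW.integrable ν A x)]
  refine integral_congr_ae (Eventually.of_forall fun σ => ?_)
  exact congrArg (fun T : K →L[ℂ] K => T (A ((W σ).adjoint x))) (hR σ).eq.symm

theorem unitary_conj_average {W' : C → K →L[ℂ] K} (hW' : IsContractiveFamily W')
    (u : unitary (K →L[ℂ] K))
    (h : ∀ σ, W' σ = (u : K →L[ℂ] K) * W σ * star (u : K →L[ℂ] K)) (A : K →L[ℂ] K) :
    (u : K →L[ℂ] K) * average hW ν A * star (u : K →L[ℂ] K) =
      average hW' ν ((u : K →L[ℂ] K) * A * star (u : K →L[ℂ] K)) := by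
  ext x
  rw [mul_apply_eq_comp, mul_apply_eq_comp, average_apply, average_apply,
    ← (u : K →L[ℂ] K).integral_comp_comm (hW.integrable ν A _)]
  refine integral_congr_ae (Eventually.of_forall fun σ => ?_)
  have hu : star (u : K →L[ℂ] K) * (u : K →L[ℂ] K) = 1 := Unitary.star_mul_self_of_mem u.2
  have h1 : (W' σ).adjoint = (u : K →L[ℂ] K) * star (W σ) * star (u : K →L[ℂ] K) := by
    rw [← ContinuousLinearMap.star_eq_adjoint, h]
    simp [mul_assoc]
  have h2 : (u : K →L[ℂ] K) * W σ * A * star (W σ) * star (u : K →L[ℂ] K) =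
      W' σ * ((u : K →L[ℂ] K) * A * star (u : K →L[ℂ] K)) * (W' σ).adjoint := by
    rw [h1, h]
    calc _ = (u : K →L[ℂ] K) * W σ * 1 * A * 1 * star (W σ) * star (u : K →L[ℂ] K) := by
          simp only [mul_one]
      _ = _ := by rw [← hu]; simp only [mul_assoc]
  exact congrArg (fun T : K →L[ℂ] K => T x) h2

end AverageAlgebra

/-! ### Collision operators and partial traces -/

namespace CollisionSpec
variable {H : Type*} [NormedAddCommGroup H] [InnerProductSpace ℂ H] [CompleteSpace H]
variable {h : H →ₗ.[ℂ] H} {C : Type*} [MetricSpace C] [CompactSpace C] [MeasurableSpace C]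
  [BorelSpace C] (S : CollisionSpec h C) {ι κ : Type}

theorem op_mem_unitary (σ : C) :
    S.op σ ∈ unitary (TensorPow H (Fin 2) →L[ℂ] TensorPow H (Fin 2)) := (S.U σ).2

theorem opAt_mem_unitary (p : Fin 2 ↪ ι) (σ : C) :
    S.opAt p σ ∈ unitary (TensorPow H ι →L[ℂ] TensorPow H ι) :=
  amplify_mem_unitary p (S.op_mem_unitary σ)

/-- The operator `Q_{i,j}` on trace class operators. -/
def collisionTC (p : Fin 2 ↪ ι) : TC (TensorPow H ι) →L[ℂ] TC (TensorPow H ι) :=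
  averageTC (S.isContractiveFamily_opAt p) S.ν (S.opAt_mem_unitary p)

@[simp]
theorem op_collisionTC (p : Fin 2 ↪ ι) (T : TC (TensorPow H ι)) :
    TC.op (S.collisionTC p T) = S.collision p (TC.op T) := rfl

theorem norm_collisionTC_apply_le (p : Fin 2 ↪ ι) (T : TC (TensorPow H ι)) :
    ‖S.collisionTC p T‖ ≤ ‖T‖ := norm_averageTC_apply_le _ _ _ T

/-- The two-particle collision operator on trace class operators. -/
def collisionOpTC : TC (TensorPow H (Fin 2)) →L[ℂ] TC (TensorPow H (Fin 2)) :=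
  averageTC S.isContractiveFamily_op S.ν S.op_mem_unitary

@[simp]
theorem op_collisionOpTC (T : TC (TensorPow H (Fin 2))) :
    TC.op (S.collisionOpTC T) = S.collisionOp (TC.op T) := rfl

theorem isPositive_collision (p : Fin 2 ↪ ι) {A : TensorPow H ι →L[ℂ] TensorPow H ι}
    (hA : A.IsPositive) : (S.collision p A).IsPositive := isPositive_average _ _ hA

/-- Collisions among the factors that are traced out have no effect. -/
theorem ptr_collisionTC_of_disjoint [TopologicalSpace.SeparableSpace H] [Finite ι] (f : κ ↪ ι)
    (p : Fin 2 ↪ ι) (hfp : ∀ k a, f k ≠ p a) (T : TC (TensorPow H ι)) :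
    ptr f (S.collisionTC p T) = ptr f T :=
  TC.ext_tr fun A => by
    rw [tr_mulRight_ptr, tr_mulRight_ptr, collisionTC, tr_mulRight_averageTC]
    have h1 : ∀ σ, star (S.opAt p σ) * amplify f A * S.opAt p σ = amplify f A := fun σ => by
      rw [mul_assoc, opAt, (commute_amplify hfp A (S.op σ)).eq, ← mul_assoc, ← opAt,
        Unitary.star_mul_self_of_mem (S.opAt_mem_unitary p σ), one_mul]
    simp [h1]

/-- Collisions among the factors that are kept commute with the partial trace. -/
theorem ptr_collisionTC_trans [TopologicalSpace.SeparableSpace H] [Finite ι] (f : κ ↪ ι)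
    (p : Fin 2 ↪ κ) (T : TC (TensorPow H ι)) :
    ptr f (S.collisionTC (p.trans f) T) = S.collisionTC p (ptr f T) := by
  have : Finite κ := Finite.of_injective f f.injective
  refine TC.ext_tr fun A => ?_
  rw [tr_mulRight_ptr, collisionTC, collisionTC, tr_mulRight_averageTC, tr_mulRight_averageTC]
  refine integral_congr_ae (Eventually.of_forall fun σ => ?_)
  change _ = TC.tr (TC.mulRight (star (S.opAt p σ) * A * S.opAt p σ) (ptr f T))
  rw [tr_mulRight_ptr, amplify_mul, amplify_mul, amplify_star, opAt, amplify_amplify]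
  rfl

theorem amplify_collisionOp (p : Fin 2 ↪ ι) (A : TensorPow H (Fin 2) →L[ℂ] TensorPow H (Fin 2)) :
    amplify p (S.collisionOp A) = S.collision p (amplify p A) := by
  refine ext_basisVec fun β => ?_
  rw [basisVec_eq_insertVec p β, amplify_insertVec, collisionOp, average_apply, collision,
    average_apply]
  refine ((insertVec p _).toContinuousLinearMap.integral_comp_comm
    (S.isContractiveFamily_op.integrable S.ν A _)).symm.trans ?_
  refine integral_congr_ae (Eventually.of_forall fun σ => ?_)
  simp only [opAt, adjoint_amplify, amplify_insertVec]
  rfl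

/-- The order of the colliding particles does not matter. -/
theorem collision_swap [Finite ι] (p : Fin 2 ↪ ι) :
    S.collision ((Equiv.swap 0 1).toEmbedding.trans p) = S.collision p := by
  obtain ⟨τ, hτ, hU⟩ := S.swap_symm
  -- Exchanging the two factors amounts to relabelling `σ` by the map `τ`, and this relabelling is
  -- absorbed by the invariance of `ν`.
  have h1 : ∀ σ, S.opAt ((Equiv.swap 0 1).toEmbedding.trans p) σ = S.opAt p (τ σ) := fun σ => by
    have h2 := permuteOp_conj_amplify (Equiv.swap 0 1) (Function.Embedding.refl _) (S.op σ)
    rw [amplify_refl, mul_assoc] at h2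
    have h3 : S.op (τ σ) = amplify ((Function.Embedding.refl _).trans
        (Equiv.swap 0 1).symm.toEmbedding) (S.op σ) := (hU σ).symm.trans h2
    rw [opAt, opAt, h3, amplify_amplify]
    rfl
  refine ContinuousLinearMap.ext fun A => ContinuousLinearMap.ext fun x => ?_
  rw [collision, collision, average_apply, average_apply]
  simp only [h1]
  have hc := ((S.isContractiveFamily_opAt p).continuous_conj A x).aestronglyMeasurable
    (μ := S.ν.map τ)
  conv_rhs => rw [← hτ.map_eq]
  exact (integral_map hτ.measurable.aemeasurable hc).symm

end CollisionSpec

theorem castAdd_lt_natAdd {k M : ℕ} (i : Fin k) (j : Fin M) :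
    Fin.castAdd M i < Fin.natAdd k j := by
  rw [Fin.lt_def, Fin.val_castAdd, Fin.val_natAdd]
  omega

theorem sum_pairs_one (N : ℕ) :
    ∑ i : Fin N, ∑ j : Fin N, (if i < j then (1 : ℂ) else 0) = (N.choose 2 : ℂ) := by
  induction N with
  | zero => simp
  | succ N ih =>
    simp only [Fin.sum_univ_castSucc, Fin.castSucc_lt_castSucc_iff, Fin.castSucc_lt_last, if_true,
      Finset.sum_add_distrib, ih, lt_self_iff_false, if_false, Fin.not_lt.2 (Fin.le_last _),
      Finset.sum_const_zero, add_zero, Finset.sum_const, Finset.card_univ, Fintype.card_fin]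
    rw [Nat.choose_succ_succ' N 1, Nat.choose_one_right]
    push_cast
    simp [add_comm]

/-! ### The Kac semigroup on symmetric states, and the hierarchy of marginals -/

namespace CollisionSpec
variable {H : Type*} [NormedAddCommGroup H] [InnerProductSpace ℂ H] [CompleteSpace H]
variable {h : H →ₗ.[ℂ] H} {C : Type*} [MetricSpace C] [CompactSpace C] [MeasurableSpace C]
  [BorelSpace C] (S : CollisionSpec h C)

/-- `Q_N` on trace class operators. -/
def kacAverageTC (N : ℕ) : TC (TensorPow H (Fin N)) →L[ℂ] TC (TensorPow H (Fin N)) :=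
  (N.choose 2 : ℂ)⁻¹ • ∑ i : Fin N, ∑ j : Fin N,
    if hij : i < j then S.collisionTC (pairEmb i j hij) else 0

/-- `L_N` on trace class operators. -/
def generatorTC (N : ℕ) : TC (TensorPow H (Fin N)) →L[ℂ] TC (TensorPow H (Fin N)) :=
  (N : ℂ) • (S.kacAverageTC N - 1)

/-- `exp (t L_N)` on trace class operators. -/
def flowTC (N : ℕ) (t : ℝ) : TC (TensorPow H (Fin N)) →L[ℂ] TC (TensorPow H (Fin N)) :=
  NormedSpace.exp ((t : ℂ) • S.generatorTC N)

theorem kacAverageTC_apply (N : ℕ) (T : TC (TensorPow H (Fin N))) :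
    S.kacAverageTC N T = (N.choose 2 : ℂ)⁻¹ • ∑ i : Fin N, ∑ j : Fin N,
      if hij : i < j then S.collisionTC (pairEmb i j hij) T else 0 := by
  simp only [kacAverageTC, smul_apply, sum_apply]
  congr 1
  refine Finset.sum_congr rfl fun i _ => Finset.sum_congr rfl fun j _ => ?_
  split_ifs <;> rfl

theorem kacAverage_apply (N : ℕ) (A : TensorPow H (Fin N) →L[ℂ] TensorPow H (Fin N)) :
    S.kacAverage N A = (N.choose 2 : ℂ)⁻¹ • ∑ i : Fin N, ∑ j : Fin N,
      if hij : i < j then S.collision (pairEmb i j hij) A else 0 := by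
  simp only [kacAverage, smul_apply, sum_apply]
  congr 1
  refine Finset.sum_congr rfl fun i _ => Finset.sum_congr rfl fun j _ => ?_
  split_ifs <;> rfl

theorem op_kacAverageTC (N : ℕ) (T : TC (TensorPow H (Fin N))) :
    TC.op (S.kacAverageTC N T) = S.kacAverage N (TC.op T) := by
  rw [kacAverageTC_apply, kacAverage_apply, map_smul, map_sum]
  congr 1
  refine Finset.sum_congr rfl fun i _ => ?_
  rw [map_sum]
  refine Finset.sum_congr rfl fun j _ => ?_
  split_ifs
  · rfl
  · exact map_zero _

/-- The inclusion of `TC` into the bounded operators is continuous and intertwines the two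
generators. The flow can therefore be differentiated in trace norm although it is given as an
exponential on bounded operators. -/
theorem op_flowTC (N : ℕ) (t : ℝ) (T : TC (TensorPow H (Fin N))) :
    TC.op (S.flowTC N t T) = S.kacSemigroup N t (TC.op T) := by
  refine exp_intertwine TC.opL (fun X => ?_) T
  simp only [generatorTC, kacGenerator, smul_apply, sub_apply, one_apply_eq_self, map_smul, map_sub,
    TC.opL_apply, op_kacAverageTC]

theorem tr_kacAverageTC [TopologicalSpace.SeparableSpace H] {N : ℕ} (hN : 2 ≤ N)
    (T : TC (TensorPow H (Fin N))) : TC.tr (S.kacAverageTC N T) = TC.tr T := by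
  have h1 : ∀ i j : Fin N, TC.tr (if hij : i < j then S.collisionTC (pairEmb i j hij) T else 0) =
      (if i < j then 1 else 0) * TC.tr T := fun i j => by
    split_ifs
    · rw [one_mul, collisionTC, tr_averageTC]
    · rw [map_zero, zero_mul]
  rw [kacAverageTC_apply, map_smul, map_sum]
  simp only [map_sum, h1, ← Finset.sum_mul]
  rw [sum_pairs_one, smul_eq_mul, inv_mul_cancel_left₀]
  exact_mod_cast (Nat.choose_pos hN).ne'

/-- The trace annihilates the generator, so it intertwines the flow with the exponential of `0`. -/
theorem tr_flowTC [TopologicalSpace.SeparableSpace H] {N : ℕ} (hN : 2 ≤ N) (t : ℝ)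
    (T : TC (TensorPow H (Fin N))) : TC.tr (S.flowTC N t T) = TC.tr T := by
  have h1 := exp_intertwine TC.tr (L := (t : ℂ) • S.generatorTC N) (M := 0) (fun X => by
    simp [generatorTC, S.tr_kacAverageTC hN]) T
  rw [NormedSpace.exp_zero] at h1
  exact h1

theorem isPositive_smul {K : Type*} [NormedAddCommGroup K] [InnerProductSpace ℂ K]
    [CompleteSpace K] {A : K →L[ℂ] K} (hA : A.IsPositive) {c : ℝ} (hc : 0 ≤ c) :
    ((c : ℂ) • A).IsPositive := hA.smul_of_nonneg (by exact_mod_cast hc)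

theorem isPositive_kacAverage (N : ℕ) {A : TensorPow H (Fin N) →L[ℂ] TensorPow H (Fin N)}
    (hA : A.IsPositive) : (S.kacAverage N A).IsPositive := by
  rw [kacAverage_apply, ← Complex.ofReal_natCast, ← Complex.ofReal_inv]
  refine isPositive_smul ?_ (by positivity)
  refine ContinuousLinearMap.isPositive_sum _ fun i _ =>
    ContinuousLinearMap.isPositive_sum _ fun j _ => ?_
  split_ifs
  · exact S.isPositive_collision _ hA
  · exact ContinuousLinearMap.isPositive_zero

/-- After the factor `e^{-tN}` is taken out, the series for `exp (tN Q_N)` has nonnegative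
coefficients and `Q_N` preserves positivity; the positive cone is closed. -/
theorem isPositive_kacSemigroup (N : ℕ) {t : ℝ} (ht : 0 ≤ t)
    {A : TensorPow H (Fin N) →L[ℂ] TensorPow H (Fin N)} (hA : A.IsPositive) :
    (S.kacSemigroup N t A).IsPositive := by
  rw [kacSemigroup, expSuperOp, kacGenerator, smul_smul, exp_smul_sub_one_apply,
    ← Complex.ofReal_natCast, ← Complex.ofReal_mul, ← Complex.ofReal_neg, ← Complex.ofReal_exp]
  refine isPositive_smul ?_ (Real.exp_pos _).le
  refine isPositive_of_hasSum (hasSum_exp_apply _ A) fun n => ?_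
  rw [smul_pow_apply, ← Complex.ofReal_pow, ← Complex.ofReal_natCast n.factorial,
    ← Complex.ofReal_inv]
  refine isPositive_smul (isPositive_smul ?_ (by positivity)) (by positivity)
  induction n with
  | zero => rw [pow_zero_apply]; exact hA
  | succ n ih =>
    rw [pow_succ_apply]
    exact S.isPositive_kacAverage N ih

/-- The pair of distinct particles `i`, `j`. -/
def pairNe {N : ℕ} (i j : Fin N) (hij : i ≠ j) : Fin 2 ↪ Fin N :=
  ⟨![i, j], by
    intro a b
    fin_cases a <;> fin_cases b <;> simp [hij, hij.symm]⟩

theorem pairNe_swap {N : ℕ} {i j : Fin N} (hij : i ≠ j) :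
    pairNe j i hij.symm = (Equiv.swap 0 1).toEmbedding.trans (pairNe i j hij) := by
  ext a
  fin_cases a <;> rfl

theorem pairNe_trans {N : ℕ} {i j : Fin N} (hij : i ≠ j) (π : Equiv.Perm (Fin N)) :
    (pairNe i j hij).trans π.toEmbedding = pairNe (π i) (π j) (π.injective.ne hij) := by
  ext a
  fin_cases a <;> rfl

/-- A sum over all ordered pairs `i ≠ j` can be reindexed by any permutation, which the condition `i
< j` does not allow. -/
theorem two_smul_sum_pairs (N : ℕ) (A : TensorPow H (Fin N) →L[ℂ] TensorPow H (Fin N)) :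
    (2 : ℂ) • ∑ i : Fin N, ∑ j : Fin N,
        (if hij : i < j then S.collision (pairEmb i j hij) A else 0) =
      ∑ i : Fin N, ∑ j : Fin N, if hij : i ≠ j then S.collision (pairNe i j hij) A else 0 := by
  rw [two_smul]
  conv_lhs => enter [2]; rw [Finset.sum_comm]
  rw [← Finset.sum_add_distrib]
  refine Finset.sum_congr rfl fun i _ => ?_
  rw [← Finset.sum_add_distrib]
  refine Finset.sum_congr rfl fun j _ => ?_
  rcases lt_trichotomy i j with hij | hij | hij
  · rw [dif_pos hij, dif_neg hij.asymm, dif_pos hij.ne, add_zero]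
    rfl
  · subst hij
    simp
  · rw [dif_neg hij.asymm, dif_pos hij, dif_pos hij.ne', zero_add, pairNe_swap hij.ne,
      collision_swap]
    rfl

theorem kacAverage_conj (N : ℕ) (π : Equiv.Perm (Fin N))
    (A : TensorPow H (Fin N) →L[ℂ] TensorPow H (Fin N)) :
    permuteOp π * S.kacAverage N A * star (permuteOp π) =
      S.kacAverage N (permuteOp π * A * star (permuteOp π)) := by
  have hc : ∀ i j (hij : i ≠ j), permuteOp π * S.collision (pairNe i j hij) A *
      star (permuteOp π) = S.collision (pairNe (π.symm i) (π.symm j) (π.symm.injective.ne hij))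
        (permuteOp π * A * star (permuteOp π)) := fun i j hij => by
    refine unitary_conj_average _ S.ν _ (permuteU π) (fun σ => ?_) A
    rw [← pairNe_trans]
    exact (permuteOp_conj_amplify π (pairNe i j hij) (S.op σ)).symm
  have h2 : ∀ B : TensorPow H (Fin N) →L[ℂ] TensorPow H (Fin N), S.kacAverage N B =
      ((N.choose 2 : ℂ)⁻¹ * 2⁻¹) • ∑ i : Fin N, ∑ j : Fin N,
        if hij : i ≠ j then S.collision (pairNe i j hij) B else 0 := fun B => by
    rw [← two_smul_sum_pairs, kacAverage_apply, smul_smul, mul_assoc, inv_mul_cancel₀ two_ne_zero,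
      mul_one]
  rw [h2, h2, mul_smul_comm, smul_mul_assoc, Finset.mul_sum, Finset.sum_mul]
  congr 1
  refine (Equiv.sum_comp π _).symm.trans (Finset.sum_congr rfl fun i _ => ?_)
  rw [Finset.mul_sum, Finset.sum_mul]
  refine (Equiv.sum_comp π _).symm.trans (Finset.sum_congr rfl fun j _ => ?_)
  by_cases hij : i = j
  · subst hij; simp
  · rw [dif_pos hij, dif_pos (π.injective.ne hij), hc]
    simp only [Equiv.symm_apply_apply]

theorem isPermSymmetric_kacSemigroup (N : ℕ) (t : ℝ)
    {A : TensorPow H (Fin N) →L[ℂ] TensorPow H (Fin N)} (hA : IsPermSymmetric A) :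
    IsPermSymmetric (S.kacSemigroup N t A) := by
  rw [isPermSymmetric_iff] at hA ⊢
  intro π
  let Φ : (TensorPow H (Fin N) →L[ℂ] TensorPow H (Fin N)) →L[ℂ]
      (TensorPow H (Fin N) →L[ℂ] TensorPow H (Fin N)) :=
    ((ContinuousLinearMap.mul ℂ _).flip (star (permuteOp π))).comp
      (ContinuousLinearMap.mul ℂ _ (permuteOp π))
  have hΦ : ∀ B, Φ B = permuteOp π * B * star (permuteOp π) := fun B => rfl
  have h1 := exp_intertwine Φ (L := (t : ℂ) • S.kacGenerator N) (M := (t : ℂ) • S.kacGenerator N)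
    (fun B => by
      simp only [smul_apply, map_smul, kacGenerator, sub_apply, map_sub, one_apply_eq_self]
      rw [hΦ (S.kacAverage N B), kacAverage_conj, hΦ]) A
  rw [hΦ A, hA π] at h1
  exact h1

/-- The collisions of the first `k` of `k + 1` particles with the last one. -/
def gain (k : ℕ) : TC (TensorPow H (Fin (k + 1))) →L[ℂ] TC (TensorPow H (Fin k)) :=
  ∑ i : Fin k, (ptr (Fin.castAddEmb 1)).comp (S.collisionTC (lastPair i))

theorem gain_apply (k : ℕ) (X : TC (TensorPow H (Fin (k + 1)))) :
    S.gain k X = ∑ i : Fin k, ptr (Fin.castAddEmb 1) (S.collisionTC (lastPair i) X) := by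
  simp [gain, sum_apply]

theorem norm_gain_apply_le (k : ℕ) (X : TC (TensorPow H (Fin (k + 1)))) :
    ‖S.gain k X‖ ≤ k * ‖X‖ := by
  rw [gain_apply]
  refine (norm_sum_le_of_le _ fun i _ => (norm_ptr_apply_le _ _).trans
    (S.norm_collisionTC_apply_le _ X)).trans ?_
  simp

/-- The right-hand side of the limiting hierarchy. -/
def hierarchy (k : ℕ) (X : TC (TensorPow H (Fin k))) (Y : TC (TensorPow H (Fin (k + 1)))) :
    TC (TensorPow H (Fin k)) := (2 : ℂ) • (S.gain k Y - (k : ℂ) • X)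

/-- The embedding of `k + 1` indices that keeps the first `k` of them and sends the last one to
the `j`-th of the `M` others. -/
def extendEmb {k M : ℕ} (j : Fin M) : Fin (k + 1) ↪ Fin (k + M) :=
  ⟨Fin.lastCases (Fin.natAdd k j) (Fin.castAdd M), by
    intro a b
    induction a using Fin.lastCases with
    | last =>
      induction b using Fin.lastCases with
      | last => simp
      | cast b =>
        simp only [Fin.lastCases_last, Fin.lastCases_castSucc]
        intro hab
        exact absurd hab (castAdd_lt_natAdd _ _).ne'
    | cast a =>
      induction b using Fin.lastCases with
      | last =>
        simp only [Fin.lastCases_last, Fin.lastCases_castSucc]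
        intro hab
        exact absurd hab (castAdd_lt_natAdd _ _).ne
      | cast b =>
        simp only [Fin.lastCases_castSucc]
        intro hab
        rw [Fin.castAdd_injective _ _ hab]⟩

theorem castAddEmb_trans_extendEmb {k M : ℕ} (j : Fin M) :
    (Fin.castAddEmb 1).trans (extendEmb j) = (Fin.castAddEmb M : Fin k ↪ Fin (k + M)) := by
  ext a
  exact congrArg Fin.val (Fin.lastCases_castSucc (motive := fun _ => Fin (k + M))
    (last := Fin.natAdd k j) (cast := Fin.castAdd M) a)

theorem lastPair_trans_extendEmb {k M : ℕ} (i : Fin k) (j : Fin M) :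
    (lastPair i).trans (extendEmb j) =
      pairEmb (Fin.castAdd M i) (Fin.natAdd k j) (castAdd_lt_natAdd i j) := by
  ext a
  fin_cases a
  · exact congrArg Fin.val (Fin.lastCases_castSucc (motive := fun _ => Fin (k + M))
      (last := Fin.natAdd k j) (cast := Fin.castAdd M) i)
  · exact congrArg Fin.val (Fin.lastCases_last (motive := fun _ => Fin (k + M))
      (last := Fin.natAdd k j) (cast := Fin.castAdd M))

/-- Trace first over all particles except the first `k` and the `j`-th outer one: this commutes with
the collision, since both partners are kept. By symmetry the `(k+1)`-particle marginal so obtained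
may be computed with any embedding `f`, so it does not depend on `j`. -/
theorem ptr_collisionTC_mixed [TopologicalSpace.SeparableSpace H] {k M : ℕ}
    (f : Fin (k + 1) ↪ Fin (k + M)) {X : TC (TensorPow H (Fin (k + M)))}
    (hX : IsPermSymmetric (TC.op X)) (i : Fin k) (j : Fin M) :
    ptr (Fin.castAddEmb M) (S.collisionTC
        (pairEmb (Fin.castAdd M i) (Fin.natAdd k j) (castAdd_lt_natAdd i j)) X) =
      ptr (Fin.castAddEmb 1) (S.collisionTC (lastPair i) (ptr f X)) := by
  rw [← lastPair_trans_extendEmb, ← castAddEmb_trans_extendEmb j, ← ptr_ptr,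
    ptr_collisionTC_trans, ptr_eq_of_isPermSymmetric (extendEmb j) f hX]

theorem ptr_collisionTC_outside [TopologicalSpace.SeparableSpace H] {k M : ℕ}
    (X : TC (TensorPow H (Fin (k + M)))) (i j : Fin M) (hij : Fin.natAdd k i < Fin.natAdd k j) :
    ptr (Fin.castAddEmb M) (S.collisionTC (pairEmb (Fin.natAdd k i) (Fin.natAdd k j) hij) X) =
      ptr (Fin.castAddEmb M) X := by
  refine S.ptr_collisionTC_of_disjoint _ _ (fun a b => ?_) X
  fin_cases b
  · exact (castAdd_lt_natAdd a i).ne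
  · exact (castAdd_lt_natAdd a j).ne

/-- Here `N / (N choose 2) = 2 / (N - 1)`. Subtracting the identity pair by pair makes the pairs
that do not affect the marginal drop out individually. -/
theorem ptr_generatorTC {k N : ℕ} (hN : 2 ≤ N) (f : Fin k ↪ Fin N)
    (X : TC (TensorPow H (Fin N))) :
    ptr f (S.generatorTC N X) = (2 / ((N : ℂ) - 1)) • ∑ i : Fin N, ∑ j : Fin N,
      if hij : i < j then ptr f (S.collisionTC (pairEmb i j hij) X) - ptr f X else 0 := by
  have hN0 : (N : ℂ) ≠ 0 := by exact_mod_cast (by omega : N ≠ 0)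
  have hN1 : (N : ℂ) - 1 ≠ 0 := by
    rw [sub_ne_zero]; exact_mod_cast (by omega : N ≠ 1)
  have hch : (N.choose 2 : ℂ) = N * (N - 1) / 2 := Nat.cast_choose_two ℂ N
  have h1 : (∑ i : Fin N, ∑ j : Fin N,
      if hij : i < j then ptr f (S.collisionTC (pairEmb i j hij) X) - ptr f X else 0) =
      (∑ i : Fin N, ∑ j : Fin N, if hij : i < j then
        ptr f (S.collisionTC (pairEmb i j hij) X) else 0) - (N.choose 2 : ℂ) • ptr f X := by
    rw [← sum_pairs_one, Finset.sum_smul, ← Finset.sum_sub_distrib]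
    refine Finset.sum_congr rfl fun i _ => ?_
    rw [Finset.sum_smul, ← Finset.sum_sub_distrib]
    refine Finset.sum_congr rfl fun j _ => ?_
    split_ifs <;> simp
  have h2 : ptr f (S.kacAverageTC N X) = (N.choose 2 : ℂ)⁻¹ • ∑ i : Fin N, ∑ j : Fin N,
      if hij : i < j then ptr f (S.collisionTC (pairEmb i j hij) X) else 0 := by
    rw [kacAverageTC_apply, map_smul, map_sum]
    congr 1
    refine Finset.sum_congr rfl fun i _ => ?_
    rw [map_sum]
    refine Finset.sum_congr rfl fun j _ => ?_
    split_ifs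
    · rfl
    · exact map_zero _
  rw [h1, generatorTC, smul_apply, sub_apply, one_apply_eq_self, map_smul, map_sub, h2, smul_sub,
    smul_sub, smul_smul, smul_smul, hch]
  congr 2
  · field_simp
  · field_simp

/-- The marginals of a symmetric state satisfy the hierarchy up to an error of order `1 / N`. -/
theorem norm_ptr_generatorTC_sub_hierarchy_le [TopologicalSpace.SeparableSpace H] {k M : ℕ}
    (hk : 1 ≤ k) (f : Fin (k + 1) ↪ Fin (k + M)) {X : TC (TensorPow H (Fin (k + M)))}
    (hX : IsPermSymmetric (TC.op X)) :
    ‖ptr (Fin.castAddEmb M) (S.generatorTC (k + M) X) -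
        S.hierarchy k (ptr (Fin.castAddEmb M) X) (ptr f X)‖ ≤
      8 * k ^ 2 / ((k + M : ℕ) - 1 : ℝ) * ‖X‖ := by
  have hM : 1 ≤ M := by
    have := Fintype.card_le_of_embedding f
    simp only [Fintype.card_fin] at this
    omega
  set F : TC (TensorPow H (Fin (k + M))) →L[ℂ] TC (TensorPow H (Fin k)) :=
    ptr (Fin.castAddEmb M) with hF
  let Z : Fin (k + M) → Fin (k + M) → TC (TensorPow H (Fin k)) := fun i j =>
    if hij : i < j then F (S.collisionTC (pairEmb i j hij) X) - F X else 0
  let Eo : Fin k → TC (TensorPow H (Fin k)) := fun i =>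
    ptr (Fin.castAddEmb 1) (S.collisionTC (lastPair i) (ptr f X)) - F X
  have hZ : ∀ i j, ‖Z i j‖ ≤ 2 * ‖X‖ := fun i j => by
    simp only [Z]
    split_ifs with hij
    · refine (norm_sub_le _ _).trans ?_
      have h1 := (norm_ptr_apply_le (Fin.castAddEmb M) (S.collisionTC (pairEmb i j hij) X)).trans
        (S.norm_collisionTC_apply_le _ X)
      have h2 := norm_ptr_apply_le (Fin.castAddEmb M : Fin k ↪ _) X
      linarith
    · rw [norm_zero]; positivity
  have hE : ∀ i, ‖Eo i‖ ≤ 2 * ‖X‖ := fun i => by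
    refine (norm_sub_le _ _).trans ?_
    have h1 := ((norm_ptr_apply_le (Fin.castAddEmb 1) (S.collisionTC (lastPair i) (ptr f X))).trans
      (S.norm_collisionTC_apply_le _ _)).trans (norm_ptr_apply_le f X)
    have h2 := norm_ptr_apply_le (Fin.castAddEmb M : Fin k ↪ _) X
    linarith
  -- Three kinds of pairs: both kept (at most `k²` bounded terms), one kept and one traced out (`M`
  -- equal copies for each `i`), both traced out (no contribution).
  have hsum : ∑ i, ∑ j, Z i j =
      ∑ i : Fin k, ∑ j : Fin k, Z (Fin.castAdd M i) (Fin.castAdd M j) + (M : ℂ) • ∑ i, Eo i := by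
    have h1 : ∀ (i : Fin k) (j : Fin M), Z (Fin.castAdd M i) (Fin.natAdd k j) = Eo i :=
        fun i j => by
      simp only [Z, Eo]
      rw [dif_pos (castAdd_lt_natAdd i j), hF, S.ptr_collisionTC_mixed f hX]
    have h2 : ∀ (i : Fin M) (j : Fin k), Z (Fin.natAdd k i) (Fin.castAdd M j) = 0 := fun i j =>
      dif_neg (castAdd_lt_natAdd j i).asymm
    have h3 : ∀ i j : Fin M, Z (Fin.natAdd k i) (Fin.natAdd k j) = 0 := fun i j => by
      simp only [Z]
      split_ifs with hij
      · rw [hF, S.ptr_collisionTC_outside, sub_self]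
      · rfl
    simp only [Fin.sum_univ_add, h1, h2, h3, Finset.sum_const_zero, add_zero, Finset.sum_const,
      Finset.card_univ, Fintype.card_fin, Finset.sum_add_distrib]
    rw [Nat.cast_smul_eq_nsmul, Finset.smul_sum]
  set A := ∑ i : Fin k, ∑ j : Fin k, Z (Fin.castAdd M i) (Fin.castAdd M j)
  have hA : ‖A‖ ≤ k * (k * (2 * ‖X‖)) := by
    refine (norm_sum_le_of_le _ fun i _ => norm_sum_le_of_le _ fun j _ => hZ _ _).trans ?_
    simp
  have hEs : ‖∑ i, Eo i‖ ≤ k * (2 * ‖X‖) := by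
    refine (norm_sum_le_of_le _ fun i _ => hE i).trans ?_
    simp
  have hH : S.hierarchy k (F X) (ptr f X) = (2 : ℂ) • ∑ i, Eo i := by
    simp only [hierarchy, gain_apply, Eo, Finset.sum_sub_distrib, Finset.sum_const,
      Finset.card_univ, Fintype.card_fin, Nat.cast_smul_eq_nsmul]
  have hn : (0 : ℝ) < (k + M : ℕ) - 1 := by
    rw [sub_pos]; exact_mod_cast (by omega : 1 < k + M)
  have hn' : ((k + M : ℕ) : ℂ) - 1 ≠ 0 := by exact_mod_cast hn.ne'
  -- With `N = k + M`, the mixed pairs carry the weight `2M / (N - 1) = 2 - 2(k - 1) / (N - 1)`, so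
  -- after subtraction of the limit both remaining coefficients are of order `1 / N`.
  have hgen : F (S.generatorTC (k + M) X) - S.hierarchy k (F X) (ptr f X) =
      ((2 / (((k + M : ℕ) : ℝ) - 1) : ℝ) : ℂ) • A -
        ((2 * ((k : ℝ) - 1) / (((k + M : ℕ) : ℝ) - 1) : ℝ) : ℂ) • ∑ i, Eo i := by
    rw [hH, hF, S.ptr_generatorTC (by omega)]
    change _ • (∑ i, ∑ j, Z i j) - _ = _
    rw [hsum, smul_add, add_sub_assoc, smul_smul, ← sub_smul, sub_eq_add_neg _ (_ • ∑ i, Eo i),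
      ← neg_smul]
    congr 2
    · push_cast; rfl
    · push_cast at hn' ⊢
      field_simp
      ring
  rw [hgen]
  refine (norm_sub_le _ _).trans ?_
  rw [norm_smul, norm_smul, Complex.norm_real, Complex.norm_real,
    Real.norm_of_nonneg (by positivity),
    Real.norm_of_nonneg (div_nonneg (mul_nonneg zero_le_two
      (sub_nonneg.2 (by exact_mod_cast hk))) hn.le)]
  have hk' : (0 : ℝ) ≤ (k : ℝ) - 1 := sub_nonneg.2 (by exact_mod_cast hk)
  calc _ ≤ 2 / (((k + M : ℕ) : ℝ) - 1) * (k * (k * (2 * ‖X‖))) +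
        2 * ((k : ℝ) - 1) / (((k + M : ℕ) : ℝ) - 1) * (k * (2 * ‖X‖)) := by gcongr
    _ = (4 * k ^ 2 + 4 * (k * ((k : ℝ) - 1))) / (((k + M : ℕ) : ℝ) - 1) * ‖X‖ := by ring
    _ ≤ _ := by
        gcongr
        nlinarith [(Nat.cast_nonneg k : (0 : ℝ) ≤ k)]

end CollisionSpec

/-! ### Derivatives of tensor powers -/

section PowerDerivative
variable {H : Type*} [NormedAddCommGroup H] [InnerProductSpace ℂ H] [CompleteSpace H]

/-- The tensor power `A ⊗ ⋯ ⊗ A` with the identity in place of its `i`-th factor. -/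
def restPow (A : H →L[ℂ] H) : ∀ k : ℕ, Fin k → (TensorPow H (Fin k) →L[ℂ] TensorPow H (Fin k))
  | 0 => fun i => i.elim0
  | k + 1 => Fin.lastCases (motive := fun _ => _) (amplify (Fin.castAddEmb 1) (tensorPowOp k A))
      fun i => amplify (Fin.castAddEmb 1) (restPow A k i) * atFactor (Fin.last k) A

theorem restPow_last (A : H →L[ℂ] H) (k : ℕ) :
    restPow A (k + 1) (Fin.last k) = amplify (Fin.castAddEmb 1) (tensorPowOp k A) := by
  rw [restPow, Fin.lastCases_last]

theorem restPow_castSucc (A : H →L[ℂ] H) (k : ℕ) (i : Fin k) :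
    restPow A (k + 1) i.castSucc =
      amplify (Fin.castAddEmb 1) (restPow A k i) * atFactor (Fin.last k) A := by
  rw [restPow, Fin.lastCases_castSucc]

theorem restPow_castSucc_mul_atFactor (A B : H →L[ℂ] H) (k : ℕ) (i : Fin k) :
    restPow A (k + 1) i.castSucc * atFactor i.castSucc B =
      amplify (Fin.castAddEmb 1) (restPow A k i * atFactor i B) * atFactor (Fin.last k) A := by
  rw [restPow_castSucc, amplify_mul, amplify_atFactor, mul_assoc, mul_assoc,
    (commute_atFactor (Fin.castSucc_lt_last i).ne' A B).eq]
  rfl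

theorem restPow_mul_atFactor (A : H →L[ℂ] H) (k : ℕ) (i : Fin k) :
    restPow A k i * atFactor i A = tensorPowOp k A := by
  induction k with
  | zero => exact i.elim0
  | succ k ih =>
    rw [tensorPowOp_succ]
    induction i using Fin.lastCases with
    | last => rw [restPow_last]
    | cast i => rw [restPow_castSucc_mul_atFactor, ih]

/-- The operator `restPow A k i` is the identity in slot `i`, so its other slots alone must avoid
the range of `g`. This lets the spectators of a collision pass through the collision of particle `i`
with a new one. -/
theorem commute_amplify_restPow {ι κ : Type} (A : H →L[ℂ] H) (k : ℕ) (f : Fin k ↪ ι) (g : κ ↪ ι)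
    (i : Fin k) (hfg : ∀ j, j ≠ i → ∀ a, f j ≠ g a) (Y : TensorPow H κ →L[ℂ] TensorPow H κ) :
    Commute (amplify f (restPow A k i)) (amplify g Y) := by
  induction k with
  | zero => exact i.elim0
  | succ k ih =>
    induction i using Fin.lastCases with
    | last =>
      rw [restPow_last, amplify_amplify]
      exact commute_amplify (fun j a => hfg j.castSucc (Fin.castSucc_lt_last j).ne a) _ _
    | cast i =>
      rw [restPow_castSucc, amplify_mul, amplify_amplify, amplify_atFactor]
      refine Commute.mul_left (ih _ i fun j hj a => ?_) ?_
      · exact hfg j.castSucc (fun h => hj (Fin.castSucc_injective _ h)) a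
      · exact commute_amplify (fun _ a => hfg _ (Fin.castSucc_lt_last i).ne' a) _ _

/-- The derivative of the `k`-th tensor power at `A` in the direction `B`. -/
def dpowTC (A B : TC H) : ∀ k : ℕ, TC (TensorPow H (Fin k))
  | 0 => 0
  | k + 1 => snocTC k (dpowTC A B k) A + snocTC k (powTC A k) B

theorem op_dpowTC (A B : TC H) (k : ℕ) : TC.op (dpowTC A B k) =
    ∑ i, restPow (TC.op A) k i * atFactor i (TC.op B) := by
  induction k with
  | zero => rw [Fin.sum_univ_zero]; exact map_zero _
  | succ k ih =>
    rw [Fin.sum_univ_castSucc, dpowTC, map_add, op_snocTC, op_snocTC, ih, op_powTC, restPow_last,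
      ← amplifyL_apply, map_sum, Finset.sum_mul]
    congr 1
    exact Finset.sum_congr rfl fun i _ => (restPow_castSucc_mul_atFactor _ _ k i).symm

theorem hasDerivWithinAt_powTC {α : ℝ → TC H} {α' : TC H} {s : Set ℝ} {t : ℝ}
    (h : HasDerivWithinAt α α' s t) (k : ℕ) :
    HasDerivWithinAt (fun t => powTC (α t) k) (dpowTC (α t) α' k) s t := by
  induction k with
  | zero => exact hasDerivWithinAt_const _ _ _
  | succ k ih =>
    have h1 := ((snocTC (H := H) k).bilinearRestrictScalars ℝ).hasDerivWithinAt_of_bilinear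
      ih h
    exact h1.congr_deriv (add_comm _ _)

/-- The tensor product of two trace class operators. -/
def pairTC : TC H →L[ℂ] TC H →L[ℂ] TC (TensorPow H (Fin 2)) :=
  (tensorTC (pointEmb 0) (pointEmb 1) (fun _ _ => zero_ne_one) (fun i => by
    fin_cases i
    · exact Or.inl ⟨0, rfl⟩
    · exact Or.inr ⟨0, rfl⟩)).bilinearComp raise raise

theorem op_pairTC (A B : TC H) : TC.op (pairTC A B) = tensorOp (TC.op A) (TC.op B) := rfl

end PowerDerivative

/-! ### Tensor powers solve the limiting hierarchy -/

namespace CollisionSpec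
variable {H : Type*} [NormedAddCommGroup H] [InnerProductSpace ℂ H] [CompleteSpace H]
variable {h : H →ₗ.[ℂ] H} {C : Type*} [MetricSpace C] [CompactSpace C] [MeasurableSpace C]
  [BorelSpace C] (S : CollisionSpec h C)

/-- The Wild convolution on trace class operators. -/
def wildTC : TC H →L[ℂ] TC H →L[ℂ] TC H :=
  (ContinuousLinearMap.compL ℂ (TC H) (TC (TensorPow H (Fin 2))) (TC H)
    (lower.comp ((ptr (Fin.castAddEmb 1 : Fin 1 ↪ Fin (1 + 1))).comp S.collisionOpTC))).comp pairTC

theorem op_wildTC (A B : TC H) : TC.op (S.wildTC A B) = S.wild (TC.op A) (TC.op B) := by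
  change TC.op (lower (ptr (Fin.castAddEmb 1) (S.collisionOpTC (pairTC A B)))) = _
  rw [op_lower, op_ptr, op_collisionOpTC, op_pairTC]
  rfl

/-- The collision of one of `k` independent particles with a further one. -/
theorem op_ptr_collisionTC_powTC (A : TC H) (k : ℕ) (i : Fin k) :
    TC.op (ptr (Fin.castAddEmb 1) (S.collisionTC (lastPair i) (powTC A (k + 1)))) =
      restPow (TC.op A) k i * atFactor i (S.wild (TC.op A) (TC.op A)) := by
  -- Regroup the tensor power as the `k - 1` spectators times the colliding pair, so that the
  -- average acts on the pair only.
  have h1 : TC.op (powTC A (k + 1)) = amplify (Fin.castAddEmb 1) (restPow (TC.op A) k i) *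
      amplify (lastPair i) (TC.op (pairTC A A)) := by
    rw [op_powTC, tensorPowOp_succ, ← restPow_mul_atFactor (TC.op A) k i, amplify_mul, mul_assoc,
      op_pairTC, tensorOp, amplify_mul, amplify_atFactor, amplify_atFactor, amplify_atFactor]
    rfl
  have h2 : ∀ σ, Commute (amplify (Fin.castAddEmb 1) (restPow (TC.op A) k i))
      (S.opAt (lastPair i) σ) := fun σ => by
    refine commute_amplify_restPow _ k _ _ i (fun j hj a => ?_) _
    fin_cases a
    · exact fun h => hj (Fin.castSucc_injective _ h)
    · exact (Fin.castSucc_lt_last j).ne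
  rw [op_ptr, op_collisionTC, h1, collision, average_mul_left _ _ h2, ← collision,
    ← amplify_collisionOp, ← op_collisionOpTC, partialTrace_amplify_mul_lastPair,
    ← atFactor_lowerOp, op_collisionOpTC, op_pairTC]
  rfl

/-- The gain term closes on tensor powers: colliding each of the `k` particles in turn with an
independent one is differentiation of the `k`-th tensor power in the direction `A ⋆ A`. This turns
the linear hierarchy into the nonlinear equation. -/
theorem gain_powTC (A : TC H) (k : ℕ) :
    S.gain k (powTC A (k + 1)) = dpowTC A (S.wildTC A A) k := by
  refine TC.ext ?_
  rw [gain_apply, map_sum, op_dpowTC, op_wildTC]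
  exact Finset.sum_congr rfl fun i _ => S.op_ptr_collisionTC_powTC A k i

/-- The right-hand side of the quantum Kac–Boltzmann equation. -/
def kacBoltzmann (A : TC H) : TC H := (2 : ℂ) • (S.wildTC A A - A)

/-- Tensor powers of solutions of the quantum Kac–Boltzmann equation solve the hierarchy. -/
theorem dpowTC_kacBoltzmann (A : TC H) (k : ℕ) :
    dpowTC A (S.kacBoltzmann A) k = S.hierarchy k (powTC A k) (powTC A (k + 1)) := by
  have h1 : ∀ i : Fin k, atFactor i (TC.op (S.kacBoltzmann A)) =
      (2 : ℂ) • (atFactor i (TC.op (S.wildTC A A)) - atFactor i (TC.op A)) := fun i => by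
    simp only [atFactor_eq, ← amplifyL_apply, ← op_raise]
    simp only [kacBoltzmann, map_smul, map_sub]
  refine TC.ext ?_
  rw [hierarchy, gain_powTC, map_smul, map_sub, map_smul, op_dpowTC, op_dpowTC, op_powTC]
  simp only [h1, mul_smul_comm, mul_sub, restPow_mul_atFactor, ← Finset.smul_sum,
    Finset.sum_sub_distrib, Finset.sum_const, Finset.card_univ, Fintype.card_fin,
    Nat.cast_smul_eq_nsmul]

end CollisionSpec

/-! ### Local solutions with a uniform life span -/

section LocalSolution
variable {E : Type*} [NormedAddCommGroup E] [NormedSpace ℝ E] [CompleteSpace E]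

/-- Solutions with initial data in the unit ball exist on a common time interval and remain in the
ball of radius `2`. -/
theorem exists_local_solution {F : E → E} {K : NNReal} {τ : ℝ} (hτ : 0 ≤ τ) (hτK : 2 * K * τ ≤ 1)
    (hF0 : F 0 = 0) (hF : LipschitzOnWith K F (Metric.closedBall 0 2)) {x : E} (hx : ‖x‖ ≤ 1) :
    ∃ α : ℝ → E, α 0 = x ∧ ∀ t ∈ Set.Icc 0 τ, ‖α t‖ ≤ 2 ∧
      HasDerivWithinAt α (F (α t)) (Set.Icc 0 τ) t := by
  have hsub : Metric.closedBall x 1 ⊆ Metric.closedBall (0 : E) 2 :=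
    Metric.closedBall_subset_closedBall' (by rw [dist_zero_right]; linarith)
  -- Since `F` vanishes at `0`, on the ball of radius `2` it is bounded by `2 K`; with `2 K τ ≤ 1` a
  -- solution moves by at most `1`.
  have hn : ∀ y ∈ Metric.closedBall x 1, ‖F y‖ ≤ ((2 * K : NNReal) : ℝ) := fun y hy => by
    have h1 := hF.dist_le_mul y (hsub hy) 0 (by simp)
    rw [hF0, dist_zero_right, dist_zero_right] at h1
    have h2 : ‖y‖ ≤ 2 := by simpa using hsub hy
    push_cast
    nlinarith [K.coe_nonneg]
  have hp : IsPicardLindelof (fun _ => F) (tmin := 0) (tmax := τ) ⟨0, le_rfl, hτ⟩ x 1 0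
      (2 * K) K := by
    refine IsPicardLindelof.of_time_independent hn (hF.mono hsub) ?_
    push_cast
    rw [sub_zero, sub_zero, max_eq_left hτ]
    simpa using hτK
  -- The Picard fixed point itself is used because it carries, besides the equation, the confinement
  -- to the ball around `x`.
  obtain ⟨α, hα⟩ := ODE.FunSpace.exists_isFixedPt_next hp (x := x) (by simp)
  have hmem : ∀ t, α.compProj t ∈ Metric.closedBall x 1 := fun t =>
    α.compProj_mem_closedBall hp.mul_max_le
  have heq : ∀ t ∈ Set.Icc 0 τ, α.compProj t = ODE.picard (fun _ => F) 0 x α.compProj t :=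
    fun t ht => by
      conv_lhs => rw [← hα]
      rw [ODE.FunSpace.compProj_apply, ODE.FunSpace.next_apply, Set.projIcc_of_mem _ ht]
  refine ⟨α.compProj, ?_, fun t ht => ⟨?_, ?_⟩⟩
  · rw [heq 0 ⟨le_rfl, hτ⟩, ODE.picard_apply₀]
  · simpa using hsub (hmem t)
  · have hd := ODE.hasDerivWithinAt_picard_Icc (f := fun _ => F) (t₀ := 0) (tmin := 0) (tmax := τ)
      (u := Metric.closedBall x 1) ⟨le_rfl, hτ⟩
      ((hF.mono hsub).continuousOn.comp continuousOn_snd fun p hp => hp.2)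
      α.continuous_compProj.continuousOn (fun t _ => hmem t) x ht
    exact hd.congr heq (heq t ht)

end LocalSolution

/-! ### Iterated estimate for hierarchies -/

section Comparison
variable {E : ℕ → Type*} [∀ k, NormedAddCommGroup (E k)] [∀ k, NormedSpace ℝ (E k)]

/-- The bound after `m` iterations of the hierarchy. -/
def iterBound (c : ℝ) (k m : ℕ) : ℝ := 2 * c ^ (k + m) * 4 ^ m * ((k + m).choose m : ℝ)

theorem iterBound_nonneg {c : ℝ} (hc : 1 ≤ c) (k m : ℕ) : 0 ≤ iterBound c k m := by
  unfold iterBound; positivity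

/-- Lets the term `‖f_k‖` in the differential inequality be absorbed into the bound for `‖f_{k+1}‖`,
turning `2k + 2k` into `4k`. -/
theorem iterBound_mono {c : ℝ} (hc : 1 ≤ c) (k m : ℕ) :
    iterBound c k m ≤ iterBound c (k + 1) m := by
  unfold iterBound
  have h1 : c ^ (k + m) ≤ c ^ (k + 1 + m) := pow_le_pow_right₀ hc (by omega)
  have h2 : ((k + m).choose m : ℝ) ≤ ((k + 1 + m).choose m : ℝ) :=
    Nat.cast_le.2 (Nat.choose_le_choose m (by omega))
  gcongr

/-- The recursion that the binomial form is made for: integrating `4k` times the bound at level `k +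
1` produces `t^(m+1) / (m + 1)`, and the factor `k`, enlarged to `k + 1`, is absorbed by the next
binomial coefficient. -/
theorem iterBound_succ {c : ℝ} (hc : 1 ≤ c) (k m : ℕ) :
    4 * k * iterBound c (k + 1) m ≤ (m + 1) * iterBound c k (m + 1) := by
  unfold iterBound
  have h1 : (k + (m + 1)).choose (m + 1) * (m + 1) = (k + 1 + m).choose m * (k + 1) := by
    rw [show k + 1 + m = k + (m + 1) by ring, Nat.choose_succ_right_eq]
    congr 1; omega
  have h2 : ((k + (m + 1)).choose (m + 1) : ℝ) * (m + 1) =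
      ((k + 1 + m).choose m : ℝ) * (k + 1) := by
    exact_mod_cast h1
  have h3 : (0 : ℝ) ≤ ((k + 1 + m).choose m : ℝ) := Nat.cast_nonneg _
  rw [show k + 1 + m = k + (m + 1) by ring] at h2 h3 ⊢
  have h4 : (0 : ℝ) ≤ 2 * c ^ (k + (m + 1)) * 4 ^ (m + 1) := by positivity
  calc _ = 2 * c ^ (k + (m + 1)) * 4 ^ (m + 1) * (((k + (m + 1)).choose m : ℝ) * k) := by ring
    _ ≤ 2 * c ^ (k + (m + 1)) * 4 ^ (m + 1) * (((k + (m + 1)).choose m : ℝ) * (k + 1)) := by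
        gcongr; linarith
    _ = _ := by rw [← h2]; ring

/-- Bounding the binomial coefficient by `2^(k+m)` leaves a geometric sequence in `m` with ratio
`8cτ ≤ 1/2`; this dictates the length of the time step. -/
theorem iterBound_mul_pow_le {c τ : ℝ} (hc : 1 ≤ c) (hτ : 0 ≤ τ) (hcτ : 16 * c * τ ≤ 1) (k m : ℕ) :
    iterBound c k m * τ ^ m ≤ 2 * (2 * c) ^ k * (1 / 2) ^ m := by
  unfold iterBound
  have h1 : ((k + m).choose m : ℝ) ≤ 2 ^ (k + m) := by
    exact_mod_cast Nat.choose_le_two_pow (k + m) m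
  calc _ ≤ 2 * c ^ (k + m) * 4 ^ m * 2 ^ (k + m) * τ ^ m := by gcongr
    _ = 2 * (2 * c) ^ k * (8 * c * τ) ^ m := by
        rw [pow_add, pow_add, show 8 * c * τ = c * 4 * 2 * τ by ring]
        simp only [mul_pow]
        ring
    _ ≤ _ := by
        gcongr
        linarith

/-- Approximate solutions of a hierarchy with vanishing initial data vanish in the limit, on a short
time interval. -/
theorem hierarchy_comparison {c τ : ℝ} (hc : 1 ≤ c) (hτ : 0 ≤ τ) (hcτ : 16 * c * τ ≤ 1)
    {f f' : ∀ k : ℕ, ℕ → ℝ → E k} {e : ℕ → ℕ → ℝ}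
    (hbd : ∀ k, 1 ≤ k → ∀ᶠ N in atTop, ∀ t ∈ Set.Icc 0 τ, ‖f k N t‖ ≤ 2 * c ^ k)
    (hd : ∀ k, 1 ≤ k → ∀ᶠ N in atTop, ∀ t ∈ Set.Icc 0 τ,
      HasDerivWithinAt (f k N) (f' k N t) (Set.Icc 0 τ) t)
    (hd' : ∀ k, 1 ≤ k → ∀ᶠ N in atTop, ∀ t ∈ Set.Icc 0 τ,
      ‖f' k N t‖ ≤ 2 * k * (‖f k N t‖ + ‖f (k + 1) N t‖) + e k N)
    (he : ∀ k, 1 ≤ k → Tendsto (e k) atTop (𝓝 0))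
    (h0 : ∀ k, 1 ≤ k → Tendsto (fun N => ‖f k N 0‖) atTop (𝓝 0)) {k : ℕ} (hk : 1 ≤ k) {ε : ℝ}
    (hε : 0 < ε) : ∀ᶠ N in atTop, ∀ t ∈ Set.Icc 0 τ, ‖f k N t‖ ≤ ε := by
  have key : ∀ m k : ℕ, 1 ≤ k → ∀ ε : ℝ, 0 < ε → ∀ᶠ N in atTop, ∀ t ∈ Set.Icc 0 τ,
      ‖f k N t‖ ≤ iterBound c k m * t ^ m + ε := by
    intro m
    induction m with
    | zero =>
      intro k hk ε hε
      filter_upwards [hbd k hk] with N hN t ht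
      have := hN t ht
      simp only [iterBound, add_zero, pow_zero, mul_one, Nat.choose_zero_right, Nat.cast_one]
      linarith
    | succ m ih =>
      intro k hk ε hε
      -- Chosen so that all errors of this iteration, `(4k + 1) η` per unit of time plus `η` at time
      -- `0`, add up to at most `ε` on `[0, τ]`.
      set η : ℝ := ε / (1 + (4 * k + 1) * τ) with hη
      have hden : 0 < 1 + (4 * k + 1) * τ := by positivity
      have hη0 : 0 < η := div_pos hε hden
      filter_upwards [ih k hk η hη0, ih (k + 1) (by omega) η hη0, hd k hk, hd' k hk,
        (he k hk).eventually (gt_mem_nhds hη0), (h0 k hk).eventually (gt_mem_nhds hη0)]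
        with N h1 h2 h3 h4 h5 h6
      -- Instead of integrating, compare with a barrier that starts at `η` and grows at least as
      -- fast as the bound on `‖f'‖`.
      have hfen := image_norm_le_of_norm_deriv_right_le_deriv_boundary (a := 0) (b := τ)
        (f := f k N) (f' := f' k N)
        (B := fun t => iterBound c k (m + 1) * t ^ (m + 1) + ((4 * k + 1) * η * t + η))
        (B' := fun t => iterBound c k (m + 1) * ((m + 1) * t ^ m) + (4 * k + 1) * η)
        (fun t ht => (h3 t ht).continuousWithinAt)
        (fun t ht => (h3 t ⟨ht.1, ht.2.le⟩).mono_of_mem_nhdsWithin (Icc_mem_nhdsGE_of_mem ht))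
        (by simpa using h6.le)
        (fun t => by
          have h7 := ((hasDerivAt_pow (m + 1) t).const_mul (iterBound c k (m + 1))).add
            (((hasDerivAt_id t).const_mul ((4 * k + 1) * η)).add_const η)
          refine h7.congr_deriv ?_
          push_cast
          simp)
        (fun t ht => by
          have ht' : t ∈ Set.Icc 0 τ := ⟨ht.1, ht.2.le⟩
          have h8 : 0 ≤ t ^ m := pow_nonneg ht.1 m
          have hk0 : (0 : ℝ) ≤ k := Nat.cast_nonneg k
          calc ‖f' k N t‖ ≤ 2 * k * (‖f k N t‖ + ‖f (k + 1) N t‖) + e k N := h4 t ht'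
            _ ≤ 2 * k * ((iterBound c (k + 1) m * t ^ m + η) +
                (iterBound c (k + 1) m * t ^ m + η)) + η := by
                gcongr
                · exact (h1 t ht').trans (by gcongr; exact iterBound_mono hc k m)
                · exact h2 t ht'
            _ = 4 * k * iterBound c (k + 1) m * t ^ m + (4 * k + 1) * η := by ring
            _ ≤ (m + 1) * iterBound c k (m + 1) * t ^ m + (4 * k + 1) * η := by
                gcongr ?_ * _ + _
                exact iterBound_succ hc k m
            _ = _ := by ring)
      intro t ht
      refine (hfen ht).trans ?_
      have h9 : (4 * k + 1) * η * t + η ≤ ε := by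
        calc _ ≤ (4 * k + 1) * η * τ + η := by gcongr; exact ht.2
          _ = η * (1 + (4 * k + 1) * τ) := by ring
          _ = ε := by rw [hη]; field_simp
      simpa only using add_le_add_right h9 _
  have hlim : Tendsto (fun m : ℕ => 2 * (2 * c) ^ k * (1 / 2 : ℝ) ^ m) atTop (𝓝 0) := by
    simpa using (tendsto_pow_atTop_nhds_zero_of_lt_one (r := (1 / 2 : ℝ)) (by norm_num)
      (by norm_num)).const_mul (2 * (2 * c) ^ k)
  -- The number of iterations is fixed before `N` tends to infinity, so only finitely many levels of
  -- the hierarchy are used.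
  obtain ⟨m, hm⟩ := (hlim.eventually (gt_mem_nhds (half_pos hε))).exists
  filter_upwards [key m k hk (ε / 2) (half_pos hε)] with N hN t ht
  refine (hN t ht).trans ?_
  have h1 : iterBound c k m * t ^ m ≤ iterBound c k m * τ ^ m :=
    mul_le_mul_of_nonneg_left (pow_le_pow_left₀ ht.1 ht.2 m) (iterBound_nonneg hc k m)
  have h2 := iterBound_mul_pow_le hc hτ hcτ k m
  linarith

end Comparison

/-! ### Density matrices in trace norm -/

section States
variable {K : Type*} [NormedAddCommGroup K] [InnerProductSpace ℂ K] [CompleteSpace K]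

theorem IsDensityMatrix.traceNorm_ne_top {T : K →L[ℂ] K} (hT : IsDensityMatrix T) :
    traceNorm T ≠ ∞ := by
  rw [traceNorm_eq_tsum hT.1 (basis K)]
  simp_rw [← ofReal_norm]
  exact hT.2.summable.norm.tsum_ofReal_ne_top

theorem TC.isDensityMatrix_iff (T : TC K) :
    IsDensityMatrix (TC.op T) ↔ (TC.op T).IsPositive ∧ TC.tr T = 1 :=
  and_congr_right fun _ =>
    ⟨fun h => (TC.hasSum_tr T (basis K)).unique h, fun h => h ▸ TC.hasSum_tr T (basis K)⟩

theorem TC.norm_eq_one {T : TC K} (hT : IsDensityMatrix (TC.op T)) : ‖T‖ = 1 := by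
  obtain ⟨h1, h2⟩ := T.isDensityMatrix_iff.1 hT
  rw [TC.tr_of_isPositive T h1] at h2
  exact_mod_cast h2

theorem TC.isDensityMatrix_of_tendsto {X : ℕ → TC K} {A : TC K} (h : Tendsto X atTop (𝓝 A))
    (hX : ∀ᶠ n in atTop, IsDensityMatrix (TC.op (X n))) : IsDensityMatrix (TC.op A) := by
  rw [TC.isDensityMatrix_iff]
  constructor
  · rw [← ContinuousLinearMap.nonneg_iff_isPositive]
    refine CStarAlgebra.isClosed_nonneg.mem_of_tendsto ((TC.opL.continuous.tendsto A).comp h) ?_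
    filter_upwards [hX] with n hn
    exact (ContinuousLinearMap.nonneg_iff_isPositive _).2 hn.1
  · refine tendsto_nhds_unique ((TC.tr.continuous.tendsto A).comp h) ?_
    refine tendsto_const_nhds.congr' ?_
    filter_upwards [hX] with n hn
    exact ((X n).isDensityMatrix_iff.1 hn).2.symm

/-- A bounded operator as a trace class operator, `0` if it is not one. -/
def TC.ofOp (T : K →L[ℂ] K) : TC K :=
  open scoped Classical in if hT : traceNorm T ≠ ∞ then TC.mk T hT else 0

theorem TC.op_ofOp {T : K →L[ℂ] K} (hT : traceNorm T ≠ ∞) : TC.op (TC.ofOp T) = T := by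
  rw [TC.ofOp, dif_pos hT, TC.op_mk]

end States

/-! ### Reduced density matrices and chaos -/

section Marginals
variable {H : Type*} [NormedAddCommGroup H] [InnerProductSpace ℂ H] [CompleteSpace H]

/-- The `k`-particle reduced density matrix of a state of `N ≥ k` particles. -/
def marg (k N : ℕ) : TC (TensorPow H (Fin N)) →L[ℂ] TC (TensorPow H (Fin k)) :=
  if hk : k ≤ N then ptr (Fin.castLEEmb hk) else 0

theorem marg_add (k M : ℕ) :
    (marg k (k + M) : TC (TensorPow H (Fin (k + M))) →L[ℂ] _) = ptr (Fin.castAddEmb M) :=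
  dif_pos (Nat.le_add_right k M)

theorem marg_of_le {k N : ℕ} (hk : k ≤ N) :
    (marg k N : TC (TensorPow H (Fin N)) →L[ℂ] _) = ptr (Fin.castLEEmb hk) :=
  dif_pos hk

theorem norm_marg_apply_le (k N : ℕ) (X : TC (TensorPow H (Fin N))) : ‖marg k N X‖ ≤ ‖X‖ := by
  by_cases hk : k ≤ N
  · rw [marg_of_le hk]
    exact norm_ptr_apply_le _ X
  · rw [marg, dif_neg hk, zero_apply, norm_zero]
    exact norm_nonneg X

theorem powTC_one (A : TC H) : powTC A 1 = raise A := by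
  refine TC.ext ?_
  have h : pointEmb (0 : Fin 1) = Function.Embedding.refl _ := by
    ext i
    exact congrArg Fin.val (Subsingleton.elim (0 : Fin 1) i)
  rw [op_powTC, tensorPowOp, List.ofFn_succ, List.ofFn_zero, List.prod_singleton, atFactor_eq, h,
    amplify_refl, op_raise]

theorem isDensityMatrix_of_raise {A : TC H} (hA : IsDensityMatrix (TC.op (raise A))) :
    IsDensityMatrix (TC.op A) := by
  have hp : (TC.op A).IsPositive := by
    rw [← lower_raise A, op_lower]
    exact hA.1.adjoint_conj _
  rw [TC.isDensityMatrix_iff]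
  refine ⟨hp, ?_⟩
  have h1 : ‖A‖ = ‖raise A‖ := by
    refine le_antisymm ?_ (norm_raise_apply_le A)
    conv_lhs => rw [← lower_raise A]
    exact norm_lower_apply_le _
  rw [TC.tr_of_isPositive A hp, h1, TC.norm_eq_one hA, Complex.ofReal_one]

/-- A sequence of symmetric states. -/
def IsSymmState (X : ∀ N : ℕ, TC (TensorPow H (Fin N))) : Prop :=
  ∀ N, 2 ≤ N → IsDensityMatrix (TC.op (X N)) ∧ IsPermSymmetric (TC.op (X N))

/-- Convergence of the reduced density matrices to the tensor powers of `A`. -/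
def Chaotic (A : TC H) (X : ∀ N : ℕ, TC (TensorPow H (Fin N))) : Prop :=
  ∀ k, 1 ≤ k → Tendsto (fun N => ‖marg k N (X N) - powTC A k‖) atTop (𝓝 0)

theorem Chaotic.tendsto_raise {A : TC H} {X : ∀ N : ℕ, TC (TensorPow H (Fin N))}
    (hX : Chaotic A X) : Tendsto (fun N => marg 1 N (X N)) atTop (𝓝 (raise A)) := by
  rw [tendsto_iff_norm_sub_tendsto_zero, ← powTC_one]
  exact hX 1 le_rfl

/-- The one-particle marginals alone determine the limit. This is what glues local solutions,
without a uniqueness theorem for the equation. -/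
theorem Chaotic.unique {A B : TC H} {X : ∀ N : ℕ, TC (TensorPow H (Fin N))}
    (hA : Chaotic A X) (hB : Chaotic B X) : A = B := by
  have h := tendsto_nhds_unique hA.tendsto_raise hB.tendsto_raise
  rw [← lower_raise A, h, lower_raise]

theorem Chaotic.isDensityMatrix {A : TC H} {X : ∀ N : ℕ, TC (TensorPow H (Fin N))}
    (hA : Chaotic A X) (hX : IsSymmState X) : IsDensityMatrix (TC.op A) := by
  refine isDensityMatrix_of_raise (TC.isDensityMatrix_of_tendsto hA.tendsto_raise ?_)
  filter_upwards [eventually_ge_atTop 2] with N hN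
  obtain ⟨h1, h2⟩ := (X N).isDensityMatrix_iff.1 (hX N hN).1
  rw [TC.isDensityMatrix_iff, marg_of_le (by omega : 1 ≤ N), tr_ptr]
  exact ⟨isPositive_ptr _ h1, h2⟩

theorem chaotic_iff {A : TC H} {X : ∀ N : ℕ, TC (TensorPow H (Fin N))}
    {ϱ : ∀ N : ℕ, TensorPow H (Fin N) →L[ℂ] TensorPow H (Fin N)}
    (hX : ∀ N, 2 ≤ N → TC.op (X N) = ϱ N) : Chaotic A X ↔ ∀ k, 1 ≤ k →
      Tendsto (fun M => traceNorm (marginal k M (ϱ (k + M)) - tensorPowOp k (TC.op A)))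
        atTop (𝓝 0) := by
  refine forall₂_congr fun k hk => ?_
  rw [← tendsto_add_atTop_iff_nat k]
  -- Since `k ≥ 1`, the restriction `M ≥ 1` ensures at least two particles, the range in which `X`
  -- is known to agree with `ϱ`.
  have h1 : ∀ M, 1 ≤ M → traceNorm (marginal k M (ϱ (k + M)) - tensorPowOp k (TC.op A)) =
      ENNReal.ofReal ‖marg k (M + k) (X (M + k)) - powTC A k‖ := fun M hM => by
    rw [add_comm M k, marg_add, TC.ofReal_norm, map_sub, op_ptr, op_powTC, hX _ (by omega)]
    rfl
  have h2 : Tendsto (fun M => traceNorm (marginal k M (ϱ (k + M)) - tensorPowOp k (TC.op A)))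
      atTop (𝓝 0) ↔
      Tendsto (fun M => ENNReal.ofReal ‖marg k (M + k) (X (M + k)) - powTC A k‖) atTop (𝓝 0) := by
    refine tendsto_congr' ?_
    filter_upwards [eventually_ge_atTop 1] with M hM
    exact h1 M hM
  rw [h2]
  constructor
  · intro h
    simpa using ENNReal.tendsto_ofReal h
  · intro h
    simpa [Function.comp_def] using (ENNReal.tendsto_toReal ENNReal.zero_ne_top).comp h

end Marginals

/-! ### Propagation of chaos and the quantum Kac–Boltzmann equation -/

namespace CollisionSpec
variable {H : Type*} [NormedAddCommGroup H] [InnerProductSpace ℂ H] [CompleteSpace H]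
variable {h : H →ₗ.[ℂ] H} {C : Type*} [MetricSpace C] [CompactSpace C] [MeasurableSpace C]
  [BorelSpace C] (S : CollisionSpec h C)

theorem isSymmState_flowTC [TopologicalSpace.SeparableSpace H]
    {X : ∀ N : ℕ, TC (TensorPow H (Fin N))} (hX : IsSymmState X) {t : ℝ} (ht : 0 ≤ t) :
    IsSymmState fun N => S.flowTC N t (X N) := fun N hN => by
  obtain ⟨h1, h2⟩ := (X N).isDensityMatrix_iff.1 (hX N hN).1
  refine ⟨(TC.isDensityMatrix_iff _).2 ⟨?_, ?_⟩, ?_⟩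
  · rw [op_flowTC]
    exact S.isPositive_kacSemigroup N ht h1
  · rw [S.tr_flowTC hN, h2]
  · rw [op_flowTC]
    exact S.isPermSymmetric_kacSemigroup N t (hX N hN).2

theorem flowTC_zero (N : ℕ) (X : TC (TensorPow H (Fin N))) : S.flowTC N 0 X = X := by
  rw [flowTC, Complex.ofReal_zero, zero_smul, NormedSpace.exp_zero]
  rfl

theorem flowTC_add (N : ℕ) (s t : ℝ) (X : TC (TensorPow H (Fin N))) :
    S.flowTC N (s + t) X = S.flowTC N s (S.flowTC N t X) := by
  rw [flowTC, Complex.ofReal_add, exp_add_smul_apply]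
  rfl

theorem hierarchy_sub (k : ℕ) (X X' : TC (TensorPow H (Fin k)))
    (Y Y' : TC (TensorPow H (Fin (k + 1)))) :
    S.hierarchy k X Y - S.hierarchy k X' Y' = S.hierarchy k (X - X') (Y - Y') := by
  simp only [hierarchy, map_sub, ← smul_sub]
  congr 1
  rw [smul_sub]
  abel

theorem norm_hierarchy_le (k : ℕ) (X : TC (TensorPow H (Fin k)))
    (Y : TC (TensorPow H (Fin (k + 1)))) : ‖S.hierarchy k X Y‖ ≤ 2 * k * (‖X‖ + ‖Y‖) := by
  rw [hierarchy, norm_smul, Complex.norm_ofNat]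
  have h1 := S.norm_gain_apply_le k Y
  have h2 : ‖(k : ℂ) • X‖ = k * ‖X‖ := by rw [norm_smul, Complex.norm_natCast]
  have h3 := norm_sub_le (S.gain k Y) ((k : ℂ) • X)
  linarith

theorem norm_marg_generatorTC_sub_le [TopologicalSpace.SeparableSpace H] {k N : ℕ} (hk : 1 ≤ k)
    (hN : k + 1 ≤ N) {X : TC (TensorPow H (Fin N))} (hX : IsPermSymmetric (TC.op X)) :
    ‖marg k N (S.generatorTC N X) - S.hierarchy k (marg k N X) (marg (k + 1) N X)‖ ≤
      8 * k ^ 2 / ((N : ℝ) - 1) * ‖X‖ := by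
  obtain ⟨M, rfl⟩ := Nat.exists_eq_add_of_le (by omega : k ≤ N)
  rw [marg_add, marg_of_le hN]
  exact S.norm_ptr_generatorTC_sub_hierarchy_le hk _ hX

/-- The value `288 = 144 · 2` is the constant `c` of the comparison argument. -/
theorem norm_powTC_le_of_norm_le_two {A : TC H} (hA : ‖A‖ ≤ 2) (k : ℕ) :
    ‖powTC A k‖ ≤ 288 ^ k :=
  (norm_powTC_le A k).trans (pow_le_pow_left₀ (by positivity) (by linarith) k)

/-- Propagation of chaos on a short time interval. -/
theorem chaotic_flowTC [TopologicalSpace.SeparableSpace H] {τ : ℝ} (hτ : 0 ≤ τ)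
    (hτc : 16 * 288 * τ ≤ 1) {X : ∀ N : ℕ, TC (TensorPow H (Fin N))} (hX : IsSymmState X)
    {α : ℝ → TC H} (hα : ∀ t ∈ Set.Icc 0 τ, ‖α t‖ ≤ 2 ∧
      HasDerivWithinAt α (S.kacBoltzmann (α t)) (Set.Icc 0 τ) t)
    (h0 : Chaotic (α 0) X) {t : ℝ} (ht : t ∈ Set.Icc 0 τ) :
    Chaotic (α t) fun N => S.flowTC N t (X N) := by
  have hn : ∀ N, 2 ≤ N → ∀ t ∈ Set.Icc 0 τ, ‖S.flowTC N t (X N)‖ = 1 := fun N hN t ht =>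
    TC.norm_eq_one (S.isSymmState_flowTC hX ht.1 N hN).1
  intro k hk
  rw [NormedAddGroup.tendsto_nhds_zero]
  intro ε hε
  have hcmp := hierarchy_comparison (E := fun k => TC (TensorPow H (Fin k))) (c := 288) (τ := τ)
    (by norm_num) hτ hτc
    (f := fun k N t => marg k N (S.flowTC N t (X N)) - powTC (α t) k)
    (f' := fun k N t => marg k N (S.generatorTC N (S.flowTC N t (X N))) -
      S.hierarchy k (powTC (α t) k) (powTC (α t) (k + 1)))
    (e := fun k N => 8 * k ^ 2 / ((N : ℝ) - 1)) ?_ ?_ ?_ ?_ ?_ hk (half_pos hε)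
  · filter_upwards [hcmp] with N hN
    rw [norm_norm]
    exact (hN t ht).trans_lt (half_lt_self hε)
  · intro k _
    filter_upwards [eventually_ge_atTop 2] with N hN t ht
    have h1 := norm_sub_le (marg k N (S.flowTC N t (X N))) (powTC (α t) k)
    have h2 := norm_marg_apply_le k N (S.flowTC N t (X N))
    have h3 := norm_powTC_le_of_norm_le_two (hα t ht).1 k
    have h4 : (1 : ℝ) ≤ 288 ^ k := one_le_pow₀ (by norm_num)
    rw [hn N hN t ht] at h2
    linarith
  · intro k _
    refine Eventually.of_forall fun N t ht => ?_
    have h1 := ((marg k N).restrictScalars ℝ).hasFDerivAt.comp_hasDerivAt t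
      (hasDerivAt_exp_apply (S.generatorTC N) (X N) t)
    have h2 := hasDerivWithinAt_powTC (hα t ht).2 k
    rw [dpowTC_kacBoltzmann] at h2
    exact h1.hasDerivWithinAt.sub h2
  · intro k hk
    filter_upwards [eventually_ge_atTop (k + 1)] with N hN t ht
    have hN2 : 2 ≤ N := by omega
    have h1 := S.norm_marg_generatorTC_sub_le hk hN (S.isSymmState_flowTC hX ht.1 N hN2).2
    rw [hn N hN2 t ht, mul_one] at h1
    -- Insert the limiting hierarchy evaluated at the true marginals: one difference is the `1 / N`
    -- consistency error, the other is controlled by linearity of the hierarchy.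
    refine (norm_sub_le_norm_sub_add_norm_sub _
      (S.hierarchy k (marg k N (S.flowTC N t (X N)))
        (marg (k + 1) N (S.flowTC N t (X N)))) _).trans ?_
    rw [hierarchy_sub, add_comm]
    exact add_le_add (S.norm_hierarchy_le k _ _) h1
  · intro k _
    refine Tendsto.div_atTop tendsto_const_nhds ?_
    exact tendsto_atTop_add_const_right _ (-1 : ℝ) tendsto_natCast_atTop_atTop
  · intro k hk
    simpa only [flowTC_zero] using h0 k hk

/-- By bilinearity `A ⋆ A - B ⋆ B = A ⋆ (A - B) + (A - B) ⋆ B`; on the ball of radius `2` each term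
costs `2 ‖⋆‖`. -/
theorem lipschitzOnWith_kacBoltzmann :
    ∃ K : NNReal, LipschitzOnWith K S.kacBoltzmann (Metric.closedBall 0 2) := by
  refine ⟨⟨2 * (4 * ‖S.wildTC‖ + 1), by positivity⟩, LipschitzOnWith.of_dist_le_mul ?_⟩
  intro A hA B hB
  rw [mem_closedBall_zero_iff] at hA hB
  have h1 : S.kacBoltzmann A - S.kacBoltzmann B =
      (2 : ℂ) • (S.wildTC A (A - B) + S.wildTC (A - B) B - (A - B)) := by
    rw [kacBoltzmann, kacBoltzmann, ← smul_sub]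
    congr 1
    simp only [map_sub, sub_apply]
    abel
  have h2 := S.wildTC.le_opNorm₂ A (A - B)
  have h3 := S.wildTC.le_opNorm₂ (A - B) B
  have h4 := norm_sub_le (S.wildTC A (A - B) + S.wildTC (A - B) B) (A - B)
  have h5 := norm_add_le (S.wildTC A (A - B)) (S.wildTC (A - B) B)
  have h6 : ‖S.wildTC‖ * ‖A‖ * ‖A - B‖ ≤ ‖S.wildTC‖ * 2 * ‖A - B‖ := by gcongr
  have h7 : ‖S.wildTC‖ * ‖A - B‖ * ‖B‖ ≤ ‖S.wildTC‖ * ‖A - B‖ * 2 := by gcongr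
  rw [dist_eq_norm, dist_eq_norm, h1, norm_smul, Complex.norm_ofNat]
  change _ ≤ 2 * (4 * ‖S.wildTC‖ + 1) * ‖A - B‖
  linarith

theorem kacBoltzmann_zero : S.kacBoltzmann 0 = 0 := by
  rw [kacBoltzmann, map_zero, sub_zero, smul_zero]

/-- There is a time step over which every chaotic sequence of states remains chaotic, along a
solution of the quantum Kac–Boltzmann equation. -/
theorem exists_chaotic_step [TopologicalSpace.SeparableSpace H] :
    ∃ τ : ℝ, 0 < τ ∧ ∀ (A : TC H) (X : ∀ N : ℕ, TC (TensorPow H (Fin N))), IsSymmState X →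
      Chaotic A X → ∃ α : ℝ → TC H, α 0 = A ∧ ∀ t ∈ Set.Icc 0 τ,
        HasDerivWithinAt α (S.kacBoltzmann (α t)) (Set.Icc 0 τ) t ∧
        Chaotic (α t) fun N => S.flowTC N t (X N) := by
  obtain ⟨K, hK⟩ := S.lipschitzOnWith_kacBoltzmann
  -- Short enough both for the local solution (`2 K τ ≤ 1`) and for the comparison (`16 · 288 τ ≤
  -- 1`). It depends on `S` only, because every density matrix has trace norm `1`.
  refine ⟨1 / (2 * K + 16 * 288), by positivity, fun A X hX hA => ?_⟩
  set τ : ℝ := 1 / (2 * K + 16 * 288) with hτ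
  have hden : (0 : ℝ) < 2 * K + 16 * 288 := by positivity
  have hτ0 : 0 < τ := by positivity
  have hτ1 : (2 * K + 16 * 288) * τ = 1 := by rw [hτ]; field_simp
  have hKτ : 0 ≤ K * τ := by positivity
  obtain ⟨α, hα0, hα⟩ := exists_local_solution hτ0.le (by linarith) S.kacBoltzmann_zero hK
    (TC.norm_eq_one (hA.isDensityMatrix hX)).le
  refine ⟨α, hα0, fun t ht => ⟨(hα t ht).2, ?_⟩⟩
  exact S.chaotic_flowTC hτ0.le (by linarith) hX hα (hα0 ▸ hA) ht

/-- After each step the evolved sequence is again a chaotic sequence of symmetric states, so a step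
of the same length applies; finitely many steps reach any time. -/
theorem exists_chaotic [TopologicalSpace.SeparableSpace H] {A : TC H}
    {X : ∀ N : ℕ, TC (TensorPow H (Fin N))} (hX : IsSymmState X) (hA : Chaotic A X) {t : ℝ}
    (ht : 0 ≤ t) : ∃ B, Chaotic B fun N => S.flowTC N t (X N) := by
  obtain ⟨τ, hτ, hstep⟩ := S.exists_chaotic_step
  have key : ∀ (n : ℕ) (t : ℝ), 0 ≤ t → t ≤ n * τ →
      ∃ B, Chaotic B fun N => S.flowTC N t (X N) := by
    intro n
    induction n with
    | zero =>
      intro t ht htn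
      obtain rfl : t = 0 := le_antisymm (by simpa using htn) ht
      exact ⟨A, by simpa only [flowTC_zero] using hA⟩
    | succ n ih =>
      intro t ht htn
      -- Go back by one time step, but not before time `0`.
      have hs : 0 ≤ max 0 (t - τ) := le_max_left _ _
      have hst : t - τ ≤ max 0 (t - τ) := le_max_right _ _
      push_cast at htn
      obtain ⟨B, hB⟩ := ih (max 0 (t - τ)) hs (max_le (by positivity) (by linarith))
      obtain ⟨α, -, hα⟩ := hstep B _ (S.isSymmState_flowTC hX hs) hB
      have h1 := (hα (t - max 0 (t - τ))
        ⟨sub_nonneg.2 (max_le ht (by linarith)), by linarith⟩).2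
      simp only [← flowTC_add, sub_add_cancel] at h1
      exact ⟨_, h1⟩
  obtain ⟨n, hn⟩ := exists_nat_ge (t / τ)
  exact key n t ht ((div_le_iff₀ hτ).1 hn)

/-- The limits of the one-particle reduced density matrices solve the quantum Kac–Boltzmann
equation. -/
theorem hasDerivWithinAt_of_chaotic [TopologicalSpace.SeparableSpace H]
    {X : ∀ N : ℕ, TC (TensorPow H (Fin N))} (hX : IsSymmState X) {R : ℝ → TC H}
    (hR : ∀ t, 0 ≤ t → Chaotic (R t) fun N => S.flowTC N t (X N)) {t : ℝ} (ht : 0 ≤ t) :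
    HasDerivWithinAt R (S.kacBoltzmann (R t)) (Set.Ici 0) t := by
  obtain ⟨τ, hτ, hstep⟩ := S.exists_chaotic_step
  -- Starting half a step earlier makes `[s, s + τ]` a neighbourhood of `t` within `[0, ∞)`, so the
  -- derivative is two-sided for `t > 0`.
  set s : ℝ := max 0 (t - τ / 2) with hs
  have hs0 : 0 ≤ s := le_max_left _ _
  have hst : t - τ / 2 ≤ s := le_max_right _ _
  have hs1 : s ≤ t := max_le ht (by linarith)
  obtain ⟨α, -, hα⟩ := hstep (R s) _ (S.isSymmState_flowTC hX hs0) (hR s hs0)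
  -- Both sides are chaotic limits of the same evolved sequence, so the local solution started at
  -- `s` coincides with `R`.
  have heq : ∀ r ∈ Set.Icc s (s + τ), R r = α (r - s) := fun r hr => by
    have h1 := (hα (r - s) ⟨sub_nonneg.2 hr.1, by linarith [hr.2]⟩).2
    simp only [← flowTC_add, sub_add_cancel] at h1
    exact (hR r (hs0.trans hr.1)).unique h1
  have htm : t ∈ Set.Icc s (s + τ) := ⟨hs1, by linarith⟩
  have h2 := (hα (t - s) ⟨sub_nonneg.2 htm.1, by linarith [htm.2]⟩).1
  have h3 : HasDerivWithinAt (fun r => α (r - s)) (S.kacBoltzmann (α (t - s)))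
      (Set.Icc s (s + τ)) t := by
    have hmaps : Set.MapsTo (fun r => r - s) (Set.Icc s (s + τ)) (Set.Icc 0 τ) := fun r hr =>
      ⟨sub_nonneg.2 hr.1, by linarith [hr.2]⟩
    have h4 := h2.scomp t ((hasDerivWithinAt_id t (Set.Icc s (s + τ))).sub_const s) hmaps
    rwa [one_smul] at h4
  rw [← heq t htm] at h3
  refine (h3.congr heq (heq t htm)).mono_of_mem_nhdsWithin ?_
  have h5 : Set.Ioo (t - τ / 2) (t + τ / 2) ∈ 𝓝 t := Ioo_mem_nhds (by linarith) (by linarith)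
  filter_upwards [self_mem_nhdsWithin, mem_nhdsWithin_of_mem_nhds h5] with r hr0 hr
  exact ⟨max_le hr0 hr.1.le, by linarith [hr.2]⟩

theorem hasTraceNormDerivWithinAt_of_hasDerivWithinAt {R : ℝ → TC H} {G : TC H} {s : Set ℝ} {t : ℝ}
    (hR : HasDerivWithinAt R G s t) :
    HasTraceNormDerivWithinAt (fun r => TC.op (R r)) (TC.op G) s t := by
  rw [hasDerivWithinAt_iff_tendsto_slope, tendsto_iff_norm_sub_tendsto_zero] at hR
  have h1 := ENNReal.tendsto_ofReal hR
  rw [ENNReal.ofReal_zero] at h1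
  refine h1.congr fun r => ?_
  rw [TC.ofReal_norm, slope_def_module, ← Complex.coe_smul, map_sub, map_smul, map_sub,
    Complex.ofReal_inv]

end CollisionSpec

end QuantumKac

end

theorem mainTheorem2 {H : Type*} [NormedAddCommGroup H] [InnerProductSpace ℂ H] [CompleteSpace H]
    [TopologicalSpace.SeparableSpace H] (h : H →ₗ.[ℂ] H) (h_self : IsSelfAdjoint h)
    (h_res : HasCompactResolvent h)
    {C : Type*} [MetricSpace C] [CompactSpace C] [MeasurableSpace C] [BorelSpace C]
    (S : CollisionSpec h C) (ρ₀ : H →L[ℂ] H)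
    (ϱ : ∀ N : ℕ, TensorPow H (Fin N) →L[ℂ] TensorPow H (Fin N)) (h_chaos : IsChaotic ρ₀ ϱ) :
    ∃ ρ : ℝ → H →L[ℂ] H, ρ 0 = ρ₀ ∧
      (∀ t, 0 ≤ t → IsChaotic (ρ t) fun N => S.kacSemigroup N t (ϱ N)) ∧
      S.SolvesQKBE ρ := by
  -- Nothing is assumed for `N < 2`, where `TC.ofOp` may take its default value `0`; limits in `N`
  -- ignore these cases.
  have hX : ∀ N, 2 ≤ N → TC.op (TC.ofOp (ϱ N)) = ϱ N := fun N hN =>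
    TC.op_ofOp (h_chaos.2.1 N hN).1.traceNorm_ne_top
  have hA : TC.op (TC.ofOp ρ₀) = ρ₀ := TC.op_ofOp h_chaos.1.traceNorm_ne_top
  have hs : IsSymmState fun N => TC.ofOp (ϱ N) := fun N hN => by
    rw [hX N hN]
    exact h_chaos.2.1 N hN
  have h0 : Chaotic (TC.ofOp ρ₀) fun N => TC.ofOp (ϱ N) := by
    rw [chaotic_iff hX, hA]
    exact h_chaos.2.2
  choose! R hR using fun (t : ℝ) (ht : 0 ≤ t) => S.exists_chaotic hs h0 ht
  have hflow : ∀ t N, 2 ≤ N →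
      TC.op (S.flowTC N t (TC.ofOp (ϱ N))) = S.kacSemigroup N t (ϱ N) := fun t N hN => by
    rw [CollisionSpec.op_flowTC, hX N hN]
  have hR0 : R 0 = TC.ofOp ρ₀ := by
    have h1 := hR 0 le_rfl
    simp only [CollisionSpec.flowTC_zero] at h1
    exact h1.unique h0
  have hd : ∀ t, 0 ≤ t → IsDensityMatrix (TC.op (R t)) := fun t ht =>
    (hR t ht).isDensityMatrix (S.isSymmState_flowTC hs ht)
  refine ⟨fun t => TC.op (R t), ?_, fun t ht => ⟨hd t ht, fun N hN => ?_, ?_⟩,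
    fun t ht => ⟨hd t ht, ?_⟩⟩
  · simp only [hR0, hA]
  · change IsDensityMatrix (S.kacSemigroup N t (ϱ N)) ∧ IsPermSymmetric (S.kacSemigroup N t (ϱ N))
    rw [← hflow t N hN]
    exact S.isSymmState_flowTC hs ht N hN
  · exact (chaotic_iff (hflow t)).1 (hR t ht)
  · have h1 := CollisionSpec.hasTraceNormDerivWithinAt_of_hasDerivWithinAt
      (S.hasDerivWithinAt_of_chaotic hs hR ht)
    rwa [CollisionSpec.kacBoltzmann, map_smul, map_sub, CollisionSpec.op_wildTC] at h1
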